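/- Let $g:\mathbb N\to\mathbb N$ be computable. The parameterized approximation problem **$g(k)$-Approx-Vertex Deletion to Regular Subgraph** is the following. Input: a finite simple graph $G=(V,E)$ and integers $k,r\ge 0$; parameter: $k$. Output: either NO, asserting that there is no set $V'\subseteq V$ with $|V'|\le k$ such that $G[V\setminus V']$ is $r$-regular, or a set $V'\subseteq V$ with $|V'|\le g(k)$ such that $G[V\setminus V']$ is $r$-regular. (The empty graph counts as $r$-regular.) A parameterized reduction from a parameterized decision problem $A$ to this approximation problem is an algorithm that, for some computable functions $f,h$, maps every instance $(x,k)$ of $A$ in time $f(k)\cdot|x|^{O(1)}$ to an instance $(G',r',k')$ with $k'\le h(k)$, such that: if $(x,k)$ is a yes-instance of $A$, then NO is not a correct output for $(G',r',k')$; and if $(x,k)$ is not a yes-instance of $A$, then NO is the one and only correct output for $(G',r',k')$. (So, for $g(k)\ge k$: in the first case some set of at most $k'$ vertices can be deleted to leave an $r'$-regular graph, in the second case no set of at most $g(k')$ vertices can.) **Lemma.** $g(k)$-Approx-Vertex Deletion to Regular Subgraph is $\mathrm{W}[1]$-hard: every problem in $\mathrm W[1]$ has a parameterized reduction to it. (Here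 $\mathrm W[1]$ is the class of parameterized problems that are reducible, by parameterized many-one reductions, to weighted satisfiability of Boolean circuits of weft at most $1$ and depth at most $d$, for some constant $d$.) Moreover, there is a parameterized reduction to it, with $k'=k+\binom k2$, from the problem **Strongly Regular Multicolored Clique**: given a graph $G=(V,E)$ whose vertex set is partitioned into $k$ color classes $V_1,\dots,V_k$ of the same size $s$ such that, for some $d$, every vertex has exactly $d$ neighbors in every color class other than its own, with parameter $k$, is there a clique that contains exactly one vertex from each $V_i$? (An input that is not of this form is not a yes-instance.) -/

import Mathlib

/-! ### A machine model with running times: WHILE programs on binary trees -/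

/-- Binary trees (S-expressions): the data on which programs work. -/
inductive Data : Type
  | nil : Data
  | cons : Data → Data → Data

namespace Data

/-- The number of `cons` cells. -/
def size : Data → ℕ
  | nil => 0
  | cons a b => a.size + b.size + 1

def hd : Data → Data
  | nil => nil
  | cons a _ => a

def tl : Data → Data
  | nil => nil
  | cons _ b => b

/-- Unary coding of natural numbers. -/
def ofNat : ℕ → Data
  | 0 => nil
  | n + 1 => cons nil (ofNat n)

/-- Every tree is read as a natural number: the length of its right spine.
This is a left inverse of `ofNat`. -/
def toNat : Data → ℕ
  | nil => 0
  | cons _ b => b.toNat + 1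

/-- Every tree is read as the list of the trees that hang off its right spine. -/
def toList : Data → List Data
  | nil => []
  | cons a b => a :: b.toList

end Data

/-- WHILE programs. A program mentions finitely many of the variables `0, 1, 2, …`, each of which
holds a tree. The five assignments are `x := nil`, `x := y`, `x := cons y z`, `x := hd y` and
`x := tl y`. -/
inductive Prog : Type
  | setNil (x : ℕ) : Prog
  | copy (x y : ℕ) : Prog
  | cons (x y z : ℕ) : Prog
  | hd (x y : ℕ) : Prog
  | tl (x y : ℕ) : Prog
  | seq (p q : Prog) : Prog
  | ifNil (x : ℕ) (p q : Prog) : Prog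
  | whileCons (x : ℕ) (p : Prog) : Prog

/-- The contents of the variables. -/
abbrev Store : Type := ℕ → Data

/-- `Exec p σ σ' t`: started in the store `σ`, the program `p` halts in the store `σ'` after time
`t`. A test costs `1`, and an assignment costs `1` plus the size of the tree that is written, so
that a multitape Turing machine and a program can simulate each other with polynomial overhead. -/
inductive Exec : Prog → Store → Store → ℕ → Prop
  | setNil (x : ℕ) (σ : Store) :
      Exec (.setNil x) σ (Function.update σ x Data.nil) 1
  | copy (x y : ℕ) (σ : Store) :
      Exec (.copy x y) σ (Function.update σ x (σ y)) (1 + (σ y).size)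
  | cons (x y z : ℕ) (σ : Store) :
      Exec (.cons x y z) σ (Function.update σ x (Data.cons (σ y) (σ z)))
        (1 + (Data.cons (σ y) (σ z)).size)
  | hd (x y : ℕ) (σ : Store) :
      Exec (.hd x y) σ (Function.update σ x (σ y).hd) (1 + (σ y).hd.size)
  | tl (x y : ℕ) (σ : Store) :
      Exec (.tl x y) σ (Function.update σ x (σ y).tl) (1 + (σ y).tl.size)
  | seq {p q : Prog} {σ σ' σ'' : Store} {t t' : ℕ} :
      Exec p σ σ' t → Exec q σ' σ'' t' → Exec (.seq p q) σ σ'' (t + t')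
  | ifNil_nil {x : ℕ} {p q : Prog} {σ σ' : Store} {t : ℕ} :
      σ x = Data.nil → Exec p σ σ' t → Exec (.ifNil x p q) σ σ' (1 + t)
  | ifNil_cons {x : ℕ} {p q : Prog} {σ σ' : Store} {t : ℕ} :
      σ x ≠ Data.nil → Exec q σ σ' t → Exec (.ifNil x p q) σ σ' (1 + t)
  | while_nil {x : ℕ} {p : Prog} {σ : Store} :
      σ x = Data.nil → Exec (.whileCons x p) σ σ 1
  | while_cons {x : ℕ} {p : Prog} {σ σ' σ'' : Store} {t t' : ℕ} :
      σ x ≠ Data.nil → Exec p σ σ' t → Exec (.whileCons x p) σ' σ'' t' →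
        Exec (.whileCons x p) σ σ'' (1 + t + t')

/-- The program `p` on input `a` halts with output `b` after time `t`. Input and output are in
variable `0`; all other variables are initially `nil`. -/
def Prog.Outputs (p : Prog) (a b : Data) (t : ℕ) : Prop :=
  ∃ σ : Store, Exec p (Function.update (fun _ => Data.nil) 0 a) σ t ∧ σ 0 = b

/-! ### Parameterized problems, reductions, and the W-hierarchy -/

/-- A parameterized instance `(x, k)`: the input proper and the parameter. -/
abbrev Inst : Type := Data × ℕ

/-- The tree that is given to a program as the code of `(x, k)`. -/
def Inst.code (I : Inst) : Data := Data.cons I.1 (Data.ofNat I.2)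

/-- A parameterized (decision) problem, as the set of its yes-instances. -/
abbrev ParamProblem : Type := Set Inst

/-- There is a program that maps every instance `(x, k)` to an instance `(x', k')` in the relation
`R` to it, in time `f(k) · |x|^O(1)` and with `k' ≤ h(k)`, where `f` and `h` are computable. -/
def FPTTransforms (R : Inst → Inst → Prop) : Prop :=
  ∃ (p : Prog) (c : ℕ) (f h : ℕ → ℕ), Computable f ∧ Computable h ∧
    ∀ (x : Data) (k : ℕ), ∃ (x' : Data) (k' t : ℕ),
      p.Outputs (Inst.code (x, k)) (Inst.code (x', k')) t ∧
      t ≤ f k * (x.size + 1) ^ c ∧ k' ≤ h k ∧ R (x, k) (x', k')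

/-- Parameterized (many-one) reducibility of decision problems. -/
def FPTReduces (A B : ParamProblem) : Prop :=
  FPTTransforms fun I I' => I ∈ A ↔ I' ∈ B

/-- The gates of a Boolean circuit. A circuit is a list of gates in which the *output gate comes
first*. A gate refers to the gates *after* it in the list: wire `0` is the gate directly after it,
wire `1` the next one, and so on; a wire beyond the end of the list carries the constant false. -/
inductive Gate : Type
  | input (i : ℕ) : Gate
  | neg (j : ℕ) : Gate
  | conj (l : List ℕ) : Gate
  | disj (l : List ℕ) : Gate

namespace Gate

/-- The value of a gate under the assignment `a`, given the values `v` of the gates after it. -/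
def value (a : ℕ → Bool) (v : List Bool) : Gate → Bool
  | input i => a i
  | neg j => !(v.getD j false)
  | conj l => l.all fun j => v.getD j false
  | disj l => l.any fun j => v.getD j false

/-- The maximum of the total weight of the gates on a path from an input to the given gate, where
a gate of fan-in `m` weighs `w m`, and `v` holds these maxima for the gates after it. -/
def pathWeight (w : ℕ → ℕ) (v : List ℕ) : Gate → ℕ
  | input _ => 0
  | neg j => w 1 + v.getD j 0
  | conj l => w l.length + (l.map fun j => v.getD j 0).foldr max 0
  | disj l => w l.length + (l.map fun j => v.getD j 0).foldr max 0

end Gate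

namespace Circuit

/-- The values of all gates. -/
def values (a : ℕ → Bool) : List Gate → List Bool
  | [] => []
  | g :: C => g.value a (values a C) :: values a C

/-- The value of the output gate. -/
def eval (C : List Gate) (a : ℕ → Bool) : Bool := (values a C).headD false

def pathWeights (w : ℕ → ℕ) : List Gate → List ℕ
  | [] => []
  | g :: C => g.pathWeight w (pathWeights w C) :: pathWeights w C

/-- The maximal number of gates on a path from an input to the output. -/
def depth (C : List Gate) : ℕ := (pathWeights (fun _ => 1) C).headD 0

/-- The maximal number of large gates (fan-in more than two) on a path from an input to the
output. -/
def weft (C : List Gate) : ℕ := (pathWeights (fun m => if 2 < m then 1 else 0) C).headD 0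

end Circuit

def Data.toGate (x : Data) : Gate :=
  match x.hd.toNat with
  | 0 => .input x.tl.toNat
  | 1 => .neg x.tl.toNat
  | 2 => .conj (x.tl.toList.map Data.toNat)
  | _ => .disj (x.tl.toList.map Data.toNat)

/-- Weighted circuit satisfiability for circuits of weft at most `t` and depth at most `d`. The
tree `x` codes a number `n` of input variables and a circuit; the question is whether some
assignment that sets exactly `k` of the `n` variables to true satisfies the circuit. -/
def WeightedCircuitSat (t d : ℕ) : ParamProblem :=
  {I | Circuit.weft (I.1.tl.toList.map Data.toGate) ≤ t ∧
    Circuit.depth (I.1.tl.toList.map Data.toGate) ≤ d ∧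
    ∃ S : Finset ℕ, S ⊆ Finset.range I.1.hd.toNat ∧ S.card = I.2 ∧
      Circuit.eval (I.1.tl.toList.map Data.toGate) (fun i => decide (i ∈ S)) = true}

/-- The class `W[t]`. -/
def WClass (t : ℕ) : Set ParamProblem :=
  {L | ∃ d : ℕ, FPTReduces L (WeightedCircuitSat t d)}

/-! ### Parameterized approximation problems -/

/-- A minimization problem: candidate solutions of an instance, which of them are solutions, and
their cost. -/
structure MinProblem where
  Cand : Data → Type
  IsSol : (x : Data) → Cand x → Prop
  cost : (x : Data) → Cand x → ℕ

/-- The problem `g(k)`-Approx-`P`: which answers are correct on `(x, k)`. The answer `none` (NO)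
is correct if there is no solution of cost at most `k`; the answer `some S` is correct if `S` is a
solution of cost at most `g k`. -/
def MinProblem.ApproxAnswer (P : MinProblem) (g : ℕ → ℕ) (x : Data) (k : ℕ) :
    Option (P.Cand x) → Prop
  | none => ¬ ∃ S : P.Cand x, P.IsSol x S ∧ P.cost x S ≤ k
  | some S => P.IsSol x S ∧ P.cost x S ≤ g k

/-- The instance `J` of `g(k)`-Approx-`P` decides whether `I` is a yes-instance of `A`: if it is,
then NO is not a correct answer on `J`; if it is not, then NO is the one and only correct answer. -/
def GapCorrect (A : ParamProblem) (P : MinProblem) (g : ℕ → ℕ) (I J : Inst) : Prop :=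
  (I ∈ A → ∀ a, P.ApproxAnswer g J.1 J.2 a → a ≠ none) ∧
  (I ∉ A → ∀ a, P.ApproxAnswer g J.1 J.2 a ↔ a = none)

/-- Parameterized reducibility of a decision problem to an approximation problem. -/
def FPTReducesToApprox (A : ParamProblem) (P : MinProblem) (g : ℕ → ℕ) : Prop :=
  FPTTransforms (GapCorrect A P g)

/-- `g(k)`-Approx-`P` is hard for the class `𝒞` under parameterized reductions. -/
def ApproxHard (𝒞 : Set ParamProblem) (P : MinProblem) (g : ℕ → ℕ) : Prop :=
  ∀ A ∈ 𝒞, FPTReducesToApprox A P g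

/-! ### The graph problems -/

/-- The simple graph with vertex set `{0, …, n - 1}` whose edges are listed in `E` (a list of
pairs; loops and pairs that are out of range are ignored). -/
def graphOfEdges (n : ℕ) (E : List Data) : SimpleGraph (Fin n) :=
  SimpleGraph.fromRel fun u v => ∃ e ∈ E, e.hd.toNat = u ∧ e.tl.toNat = v

open Classical in
/-- Vertex Deletion to Regular Subgraph. The tree `x` codes the number `n` of vertices, the degree
`r` and the list of edges. A solution is a set of vertices whose deletion leaves an `r`-regular
graph; its cost is its cardinality. -/
def VertexDeletionToRegular : MinProblem where
  Cand x := Finset (Fin x.hd.toNat)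
  IsSol x S :=
    ((graphOfEdges x.hd.toNat x.tl.tl.toList).induce {v | v ∉ S}).IsRegularOfDegree x.tl.hd.toNat
  cost _ S := S.card

/-- Strongly Regular Multicolored Clique. The tree `x` codes the number of vertices, the list of
their colors and the list of edges. The vertices are partitioned into `k` color classes of the
same size `s`, and every vertex has exactly `d` neighbors in every color class other than its own;
the question is whether there is a clique with exactly one vertex of each color. -/
def StronglyRegularMulticoloredClique : ParamProblem :=
  {I |
    let n := I.1.hd.toNat
    let G := graphOfEdges n I.1.tl.tl.toList
    let color : Fin n → ℕ := fun v => (I.1.tl.hd.toList.map Data.toNat).getD v 0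
    (∃ s d : ℕ, (∀ v, color v < I.2) ∧
      (∀ i < I.2, {v | color v = i}.ncard = s) ∧
      (∀ v, ∀ j < I.2, j ≠ color v → {w | color w = j ∧ G.Adj v w}.ncard = d)) ∧
    ∃ Q : Set (Fin n), G.IsClique Q ∧ ∀ i < I.2, ∃! v, v ∈ Q ∧ color v = i}

/-! The heart of the proof is a graph in which deleting vertices amounts to choosing a transversal.
Consider finitely many elements with `P` colorings by `N` colors, and ask for a set with exactly one
element of each color in each coloring. For every coloring, every color and every one of `L` copies,
the elements of that color are attached to the two first vertices of a bipartite block. An element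
then has `r = 2 * P * L` neighbors. The block is filled so that its two first vertices have degree
`r + 1` and all its other vertices degree `r`. Deleting a transversal, which has at most `N`
elements as soon as there is a coloring, leaves an `r`-regular graph
(`ColoringGraph.regular_of_transversal`). Conversely, fewer than `L` deletions leave some copy
intact for each coloring and color, and its first vertices must lose exactly one neighbor, so the
deleted elements are a transversal (`ColoringGraph.transversal_of_regular`). Since `L` can exceed
any prescribed `M`, and in particular `g N`, the gap is free (`ColoringGraph.inst_gapCorrect`).

Transversals express constraint satisfaction. The elements are the values of the variables and the
allowed tuples of the constraints, grouped by variable or constraint, and the groups serve as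
colors. One coloring is by group and forces one choice per group. For an entry of a constraint, its
variable and a value `a`, a further coloring swaps the two group colors on the elements that
disagree with `a`; both colors occur exactly once if and only if the variable and the entry agree on
being `a` (`Csp.hasTransversal_iff_sat`). So the new parameter is the number of variables plus the
number of constraints. A multicolored clique problem has `k` variables and `k.choose 2` binary
constraints, which gives the second claim.

For hardness, weighted satisfiability of circuits of weft one and depth `d` is written with a number
of variables and constraints that depends on `k` and `d` only. The variables are the true inputs in
increasing order, with two sentinels, and a list of witnesses: wires that justify the values of
large gates. Weft one makes boundedly many witnesses enough (`Circuit.exists_witnesses`). With the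
witnesses fixed, a failure of the evaluation is already visible from a bounded number of points
(`Circuit.exists_refutation`), so constraints of bounded arity detect it (`CircuitSat.sat_iff_mem`).

Finally, all this must run on the machine model. `PTime` is closed under the usual list operations,
every computable `g` has a program with computable running time (`exists_prog_of_computable`), and
the pieces are joined by `FPTTransforms.comp_ptime`. -/

/-! ### Encodings and polynomial bounds -/

/-- Types whose elements are coded by trees. -/
class Enc (α : Type) where
  enc : α → Data

open Enc (enc)

instance : Enc Data := ⟨id⟩
instance : Enc ℕ := ⟨Data.ofNat⟩
instance : Enc Unit := ⟨fun _ => Data.nil⟩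
instance : Enc Bool := ⟨fun b => if b then Data.cons Data.nil Data.nil else Data.nil⟩
instance {α β : Type} [Enc α] [Enc β] : Enc (α × β) := ⟨fun p => Data.cons (enc p.1) (enc p.2)⟩
instance {α : Type} [Enc α] : Enc (List α) := ⟨fun l => l.foldr (fun a d => Data.cons (enc a) d) Data.nil⟩

/-- The size of the code of an object. -/
def esize {α : Type} [Enc α] (a : α) : ℕ := (enc a).size

section Sizes
variable {α β : Type} [Enc α] [Enc β]

@[simp] theorem enc_nil : enc ([] : List α) = Data.nil := rfl
@[simp] theorem enc_cons (a : α) (l : List α) : enc (a :: l) = Data.cons (enc a) (enc l) := rfl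
@[simp] theorem enc_pair (a : α) (b : β) : enc (a, b) = Data.cons (enc a) (enc b) := rfl
@[simp] theorem enc_zero : enc (0 : ℕ) = Data.nil := rfl
@[simp] theorem enc_succ (n : ℕ) : enc (n + 1) = Data.cons Data.nil (enc n) := rfl
@[simp] theorem enc_true : enc true = Data.cons Data.nil Data.nil := rfl
@[simp] theorem enc_false : enc false = Data.nil := rfl
@[simp] theorem enc_data (x : Data) : enc x = x := rfl
@[simp] theorem enc_unit (x : Unit) : enc x = Data.nil := rfl

theorem Data.size_ofNat (n : ℕ) : (Data.ofNat n).size = n := by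
  induction n with
  | zero => rfl
  | succ n ih => simp [Data.ofNat, Data.size, ih]

@[simp] theorem esize_nat (n : ℕ) : esize n = n := Data.size_ofNat n
@[simp] theorem esize_pair (p : α × β) : esize p = esize p.1 + esize p.2 + 1 := rfl
@[simp] theorem esize_nil : esize ([] : List α) = 0 := rfl
@[simp] theorem esize_cons (a : α) (l : List α) : esize (a :: l) = esize a + esize l + 1 := rfl
theorem esize_bool_le (b : Bool) : esize b ≤ 1 := by cases b <;> simp [esize, Data.size]
@[simp] theorem esize_unit (x : Unit) : esize x = 0 := rfl

theorem esize_append (l l' : List α) : esize (l ++ l') = esize l + esize l' := by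
  induction l with
  | nil => simp
  | cons a l ih => simp [ih]; omega

theorem length_le_esize (l : List α) : l.length ≤ esize l := by
  induction l with
  | nil => simp
  | cons a l ih => simp; omega

theorem esize_le_of_mem {a : α} {l : List α} (h : a ∈ l) : esize a ≤ esize l := by
  induction l with
  | nil => simp at h
  | cons b l ih =>
    rcases List.mem_cons.1 h with rfl | h
    · simp; omega
    · have := ih h; simp; omega

theorem esize_list_le {l : List α} {B : ℕ} (h : ∀ a ∈ l, esize a ≤ B) :
    esize l ≤ l.length * (B + 1) := by
  induction l with
  | nil => simp
  | cons a l ih =>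
    have h1 := h a (by simp)
    have h2 := ih fun b hb => h b (by simp [hb])
    simp [Nat.add_mul]; omega

end Sizes

/-- `b` is polynomially bounded in the size of the argument. -/
def PolyBdd {α : Type} [Enc α] (b : α → ℕ) : Prop := ∃ c, ∀ a, b a ≤ (esize a + 2) ^ c

namespace PolyBdd
variable {α β : Type} [Enc α] [Enc β] {b b' : α → ℕ}

theorem mono (h : PolyBdd b') (hb : ∀ a, b a ≤ b' a) : PolyBdd b := by
  obtain ⟨c, hc⟩ := h
  exact ⟨c, fun a => (hb a).trans (hc a)⟩

theorem exists_common (h : PolyBdd b) (h' : PolyBdd b') :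
    ∃ c, ∀ a, b a ≤ (esize a + 2) ^ c ∧ b' a ≤ (esize a + 2) ^ c := by
  obtain ⟨c, hc⟩ := h
  obtain ⟨c', hc'⟩ := h'
  exact ⟨max c c', fun a => ⟨(hc a).trans (Nat.pow_le_pow_right (by omega) (le_max_left _ _)),
    (hc' a).trans (Nat.pow_le_pow_right (by omega) (le_max_right _ _))⟩⟩

theorem mul (h : PolyBdd b) (h' : PolyBdd b') : PolyBdd fun a => b a * b' a := by
  obtain ⟨c, hc⟩ := h
  obtain ⟨c', hc'⟩ := h'
  exact ⟨c + c', fun a => by rw [pow_add]; exact Nat.mul_le_mul (hc a) (hc' a)⟩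

/-- Here the summand `2` in the base of `PolyBdd` matters: with base at least two, the exponent
alone absorbs any constant. -/
theorem const (n : ℕ) : PolyBdd fun _ : α => n :=
  ⟨n, fun a => (Nat.lt_pow_self (by omega : 1 < 2)).le.trans (Nat.pow_le_pow_left (by omega) n)⟩

theorem add (h : PolyBdd b) (h' : PolyBdd b') : PolyBdd fun a => b a + b' a := by
  obtain ⟨c, hc⟩ := exists_common h h'
  refine ⟨c + 1, fun a => ?_⟩
  have := hc a
  have h2 : 2 * (esize a + 2) ^ c ≤ (esize a + 2) ^ c * (esize a + 2) := by
    rw [mul_comm]; exact Nat.mul_le_mul_left _ (by omega)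
  simp only [pow_succ]; omega

theorem pow (h : PolyBdd b) (n : ℕ) : PolyBdd fun a => b a ^ n := by
  induction n with
  | zero => exact (const 1).mono fun a => by simp
  | succ n ih => exact (ih.mul h).mono fun a => by simp [pow_succ]

theorem size : PolyBdd fun a : α => esize a := ⟨1, fun a => by simp⟩

theorem comp {b : β → ℕ} (h : PolyBdd b) {f : α → β} (hf : PolyBdd fun a => esize (f a)) :
    PolyBdd fun a => b (f a) := by
  obtain ⟨c, hc⟩ := h
  exact ((hf.add (const 2)).pow c).mono fun a => hc (f a)

end PolyBdd

/-! ### Programs that respect a stack discipline -/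

theorem update_lt (σ : Store) (d : Data) {m n : ℕ} (h : m < n) :
    Function.update σ n d m = σ m :=
  Function.update_of_ne h.ne _ _

/-- Started with `x` in variable `n`, the program ends within time `t` with `y` in variable `n`,
and leaves the variables below `n` unchanged. -/
def RunsAt (p : Prog) (n : ℕ) (x y : Data) (t : ℕ) : Prop :=
  ∀ σ : Store, σ n = x → ∃ (σ' : Store) (t' : ℕ), t' ≤ t ∧ Exec p σ σ' t' ∧ σ' n = y ∧
    ∀ m < n, σ' m = σ m

theorem RunsAt.seq {p q : Prog} {n : ℕ} {x y z : Data} {t t' : ℕ} (hp : RunsAt p n x y t)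
    (hq : RunsAt q n y z t') : RunsAt (.seq p q) n x z (t + t') := by
  intro σ hσ
  obtain ⟨σ₁, t₁, ht₁, e₁, h₁, k₁⟩ := hp σ hσ
  obtain ⟨σ₂, t₂, ht₂, e₂, h₂, k₂⟩ := hq σ₁ h₁
  exact ⟨σ₂, t₁ + t₂, by omega, e₁.seq e₂, h₂, fun m hm => (k₂ m hm).trans (k₁ m hm)⟩

theorem RunsAt.mono {p : Prog} {n : ℕ} {x y : Data} {t t' : ℕ} (hp : RunsAt p n x y t)
    (h : t ≤ t') : RunsAt p n x y t' := by
  intro σ hσ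
  obtain ⟨σ₁, t₁, ht₁, r⟩ := hp σ hσ
  exact ⟨σ₁, t₁, ht₁.trans h, r⟩

/-- `f` is computed by a program in polynomial time, on the codes of its arguments. -/
def PTime {α β : Type} [Enc α] [Enc β] (f : α → β) : Prop :=
  PolyBdd (fun a => esize (f a)) ∧
    ∀ n, ∃ (p : Prog) (b : α → ℕ), PolyBdd b ∧ ∀ a, RunsAt p n (enc a) (enc (f a)) (b a)

namespace PTime
variable {α β γ δ : Type} [Enc α] [Enc β] [Enc γ] [Enc δ]

/-- Functions with the same codes are computed by the same programs. -/
theorem of_enc {β' : Type} [Enc β'] {f : α → β} (hf : PTime f) {g : α → β'}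
    (h : ∀ a, enc (g a) = enc (f a)) : PTime g := by
  refine ⟨hf.1.mono fun a => by simp [esize, h], fun n => ?_⟩
  obtain ⟨p, b, hb, hp⟩ := hf.2 n
  exact ⟨p, b, hb, fun a => by rw [h]; exact hp a⟩

theorem of_eq {f : α → β} (hf : PTime f) {g : α → β} (h : ∀ a, g a = f a) : PTime g :=
  hf.of_enc fun a => by rw [h]

theorem id : PTime (fun a : α => a) := by
  refine ⟨PolyBdd.size, fun n => ⟨.copy n n, fun a => 1 + esize a,
    (PolyBdd.const 1).add PolyBdd.size, fun a σ h => ⟨_, _, ?_, .copy n n σ, ?_, ?_⟩⟩⟩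
  · simp [h, esize]
  · simp [h]
  · intro m hm; rw [update_lt _ _ hm]

theorem cast {β' : Type} [Enc β'] {g : α → β'} (h : ∀ a, enc (g a) = enc a) : PTime g :=
  of_enc id h

theorem comp {g : β → γ} {f : α → β} (hg : PTime g) (hf : PTime f) : PTime fun a => g (f a) := by
  refine ⟨PolyBdd.comp hg.1 hf.1, fun n => ?_⟩
  obtain ⟨p, b, hb, hp⟩ := hf.2 n
  obtain ⟨q, b', hb', hq⟩ := hg.2 n
  exact ⟨.seq p q, fun a => b a + b' (f a), hb.add (hb'.comp hf.1),
    fun a => (hp a).seq (hq (f a))⟩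

end PTime

/-- The program assembles the tree bottom-up. The right subtree is built one variable higher, where
the stack discipline protects the finished left subtree. -/
theorem exists_const_prog (d : Data) (n : ℕ) :
    ∃ (p : Prog) (t : ℕ), ∀ x, RunsAt p n x d t := by
  induction d generalizing n with
  | nil =>
    refine ⟨.setNil n, 1, fun x σ h => ⟨_, _, le_rfl, .setNil n σ, by simp, ?_⟩⟩
    intro m hm; rw [update_lt _ _ hm]
  | cons a b iha ihb =>
    obtain ⟨p, t, hp⟩ := iha n
    obtain ⟨q, t', hq⟩ := ihb (n + 1)
    refine ⟨.seq p (.seq q (.cons n n (n + 1))), t + (t' + (1 + (Data.cons a b).size)),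
      fun x σ h => ?_⟩
    obtain ⟨σ₁, t₁, ht₁, e₁, h₁, k₁⟩ := hp x σ h
    obtain ⟨σ₂, t₂, ht₂, e₂, h₂, k₂⟩ := hq _ σ₁ rfl
    have h₃ : σ₂ n = a := (k₂ n (by omega)).trans h₁
    refine ⟨_, _, ?_, e₁.seq (e₂.seq (.cons n n (n + 1) σ₂)), by simp [h₂, h₃], ?_⟩
    · rw [h₂, h₃]; omega
    · intro m hm
      rw [update_lt _ _ hm]
      rw [k₂ m (by omega), k₁ m hm]

theorem Data.hd_size_le (x : Data) : x.hd.size ≤ x.size := by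
  cases x <;> simp [Data.hd, Data.size]; omega

theorem Data.tl_size_le (x : Data) : x.tl.size ≤ x.size := by
  cases x <;> simp [Data.tl, Data.size]; omega

namespace PTime
variable {α β γ δ : Type} [Enc α] [Enc β] [Enc γ] [Enc δ]

theorem const (b : β) : PTime (fun _ : α => b) := by
  refine ⟨PolyBdd.const _, fun n => ?_⟩
  obtain ⟨p, t, hp⟩ := exists_const_prog (enc b) n
  exact ⟨p, fun _ => t, PolyBdd.const t, fun a => hp _⟩

theorem hd : PTime Data.hd := by
  refine ⟨PolyBdd.size.mono Data.hd_size_le, fun n => ⟨.hd n n, fun a => 1 + esize a,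
    (PolyBdd.const 1).add PolyBdd.size, fun a σ h => ⟨_, _, ?_, .hd n n σ, ?_, ?_⟩⟩⟩
  · have := Data.hd_size_le a
    simp [h, esize]; omega
  · simp [h]
  · intro m hm; rw [update_lt _ _ hm]

theorem tl : PTime Data.tl := by
  refine ⟨PolyBdd.size.mono Data.tl_size_le, fun n => ⟨.tl n n, fun a => 1 + esize a,
    (PolyBdd.const 1).add PolyBdd.size, fun a σ h => ⟨_, _, ?_, .tl n n σ, ?_, ?_⟩⟩⟩
  · have := Data.tl_size_le a
    simp [h, esize]; omega
  · simp [h]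
  · intro m hm; rw [update_lt _ _ hm]

theorem encode : PTime (fun a : α => enc a) := cast fun _ => rfl

theorem fst : PTime (fun p : α × β => p.1) :=
  of_enc (hd.comp encode) fun _ => rfl

theorem snd : PTime (fun p : α × β => p.2) :=
  of_enc (tl.comp encode) fun _ => rfl

theorem pair {f : α → β} {g : α → γ} (hf : PTime f) (hg : PTime g) :
    PTime fun a => (f a, g a) := by
  refine ⟨((hf.1.add hg.1).add (PolyBdd.const 1)).mono fun a => by simp, fun n => ?_⟩
  obtain ⟨p, b, hb, hp⟩ := hf.2 (n + 1)
  obtain ⟨q, b', hb', hq⟩ := hg.2 (n + 2)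
  -- Variable `n` keeps the argument until both components stand in `n + 1` and `n + 2`.
  refine ⟨.seq (.copy (n + 1) n) (.seq p (.seq (.copy (n + 2) n)
    (.seq q (.cons n (n + 1) (n + 2))))), fun a => (1 + esize a) + (b a + ((1 + esize a) +
      (b' a + (1 + (esize (f a) + esize (g a) + 1))))),
    ((PolyBdd.const 1).add .size).add (hb.add (((PolyBdd.const 1).add .size).add
      (hb'.add ((PolyBdd.const 1).add ((hf.1.add hg.1).add (.const 1)))))), fun a σ h => ?_⟩
  obtain ⟨σ₁, t₁, ht₁, e₁, h₁, k₁⟩ := hp a (Function.update σ (n + 1) (σ n)) (by simp [h])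
  have h₁' : σ₁ n = enc a := by rw [k₁ n (by omega)]; simpa using h
  obtain ⟨σ₂, t₂, ht₂, e₂, h₂, k₂⟩ := hq a (Function.update σ₁ (n + 2) (σ₁ n)) (by simp [h₁'])
  have h₂' : σ₂ (n + 1) = enc (f a) := by rw [k₂ _ (by omega)]; simpa using h₁
  refine ⟨_, _, ?_, (Exec.copy _ _ _).seq (e₁.seq ((Exec.copy _ _ _).seq (e₂.seq
    (.cons n (n + 1) (n + 2) σ₂)))), by simp [h₂, h₂'], ?_⟩
  · rw [h, h₁', h₂, h₂']
    simp only [Data.size, esize]; omega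
  · intro m hm
    rw [update_lt _ _ hm, k₂ m (by omega)]
    rw [update_lt _ _ (by omega)]
    rw [k₁ m (by omega), update_lt _ _ (by omega)]

/-- Case distinction on whether the code of `c a` is `nil`. -/
theorem ite_enc_nil {c : α → δ} {f g : α → β} (hc : PTime c) (hf : PTime f) (hg : PTime g)
    {h : α → β} (h₀ : ∀ a, enc (c a) = Data.nil → h a = f a)
    (h₁ : ∀ a, enc (c a) ≠ Data.nil → h a = g a) : PTime h := by
  refine ⟨(hf.1.add hg.1).mono fun a => ?_, fun n => ?_⟩
  · by_cases hn : enc (c a) = Data.nil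
    · rw [h₀ a hn]; omega
    · rw [h₁ a hn]; omega
  obtain ⟨r, b'', hb'', hr⟩ := hc.2 (n + 1)
  obtain ⟨p, b, hb, hp⟩ := hf.2 n
  obtain ⟨q, b', hb', hq⟩ := hg.2 n
  refine ⟨.seq (.copy (n + 1) n) (.seq r (.ifNil (n + 1) p q)),
    fun a => (1 + esize a) + (b'' a + (1 + (b a + b' a))),
    ((PolyBdd.const 1).add .size).add (hb''.add ((PolyBdd.const 1).add (hb.add hb'))),
    fun a σ hσ => ?_⟩
  obtain ⟨σ₁, t₁, ht₁, e₁, g₁, k₁⟩ := hr a (Function.update σ (n + 1) (σ n)) (by simp [hσ])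
  have g₁' : σ₁ n = enc a := by rw [k₁ n (by omega)]; simpa using hσ
  by_cases hn : enc (c a) = Data.nil
  · obtain ⟨σ₂, t₂, ht₂, e₂, g₂, k₂⟩ := hp a σ₁ g₁'
    refine ⟨_, _, ?_, (Exec.copy _ _ _).seq (e₁.seq (.ifNil_nil (g₁.trans hn) e₂)),
      by rw [g₂, h₀ a hn], ?_⟩
    · rw [hσ]; simp only [esize]; omega
    · intro m hm
      rw [k₂ m hm, k₁ m (by omega), update_lt _ _ (by omega)]
  · obtain ⟨σ₂, t₂, ht₂, e₂, g₂, k₂⟩ := hq a σ₁ g₁'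
    refine ⟨_, _, ?_, (Exec.copy _ _ _).seq (e₁.seq (.ifNil_cons (by rwa [g₁]) e₂)),
      by rw [g₂, h₁ a hn], ?_⟩
    · rw [hσ]; simp only [esize]; omega
    · intro m hm
      rw [k₂ m hm, k₁ m (by omega), update_lt _ _ (by omega)]

theorem cond {c : α → Bool} {f g : α → β} (hc : PTime c) (hf : PTime f) (hg : PTime g) :
    PTime fun a => bif c a then f a else g a :=
  ite_enc_nil hc hg hf
    (fun a h => by cases hh : c a <;> simp [hh] at h ⊢)
    (fun a h => by cases hh : c a <;> simp [hh] at h ⊢)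

end PTime

/-! ### Loops over lists -/

/-- Variable `n` holds the rest of the list, `n + 1` the fixed parameter, `n + 2` the accumulator,
and the body works from `n + 3` upward. The bound `B` is demanded only for accumulators that the
loop really reaches, since the body may be costly on others. -/
theorem while_foldl {α β γ : Type} [Enc α] [Enc β] [Enc γ] (f : γ → β → α → β) {p : Prog}
    {n : ℕ} {b : γ × β × α → ℕ}
    (hp : ∀ q, RunsAt p (n + 3) (enc q) (enc (f q.1 q.2.1 q.2.2)) (b q)) (x : γ) (B : ℕ)
    (l : List α) (i : β)
    (hB : ∀ l' a, l' ++ [a] <+: l → b (x, l'.foldl (f x) i, a) + 5 * esize x +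
      5 * esize (l'.foldl (f x) i) + 5 * esize ((l' ++ [a]).foldl (f x) i) + 5 * esize l ≤ B)
    (σ : Store) (h₀ : σ n = enc l) (h₁ : σ (n + 1) = enc x) (h₂ : σ (n + 2) = enc i) :
    ∃ (σ' : Store) (t : ℕ), t ≤ l.length * (B + 20) + 1 ∧
      Exec (.whileCons n (.seq (.hd (n + 3) n) (.seq (.cons (n + 3) (n + 2) (n + 3))
        (.seq (.cons (n + 3) (n + 1) (n + 3)) (.seq p (.seq (.copy (n + 2) (n + 3))
          (.tl n n))))))) σ σ' t ∧
      σ' (n + 2) = enc (l.foldl (f x) i) ∧ ∀ m < n, σ' m = σ m := by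
  induction l generalizing i σ with
  | nil => exact ⟨σ, 1, by simp, .while_nil h₀, h₂, fun _ _ => rfl⟩
  | cons a l ih =>
    set σ₁ := Function.update σ (n + 3) (σ n).hd with hσ₁
    set σ₂ := Function.update σ₁ (n + 3) (Data.cons (σ₁ (n + 2)) (σ₁ (n + 3))) with hσ₂
    set σ₃ := Function.update σ₂ (n + 3) (Data.cons (σ₂ (n + 1)) (σ₂ (n + 3))) with hσ₃
    have v₁ : σ₁ (n + 3) = enc a := by simp [hσ₁, h₀, Data.hd]
    have v₁' : σ₁ (n + 2) = enc i := by rw [hσ₁, update_lt _ _ (by omega), h₂]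
    have v₂ : σ₂ (n + 3) = Data.cons (enc i) (enc a) := by
      rw [hσ₂, Function.update_self, v₁, v₁']
    have v₂' : σ₂ (n + 1) = enc x := by
      rw [hσ₂, update_lt _ _ (by omega), hσ₁, update_lt _ _ (by omega), h₁]
    have v₃ : σ₃ (n + 3) = enc (x, i, a) := by
      rw [hσ₃, Function.update_self, v₂, v₂']; rfl
    have w₃ : ∀ m < n + 3, σ₃ m = σ m := fun m hm => by
      rw [hσ₃, update_lt _ _ hm, hσ₂, update_lt _ _ hm, hσ₁, update_lt _ _ hm]
    obtain ⟨σ₄, t₄, ht₄, e₄, g₄, k₄⟩ := hp (x, i, a) σ₃ v₃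
    set σ₅ := Function.update σ₄ (n + 2) (σ₄ (n + 3)) with hσ₅
    have u₅ : σ₅ n = enc (a :: l) := by
      rw [hσ₅, update_lt _ _ (by omega), k₄ _ (by omega), w₃ _ (by omega), h₀]
    set σ₆ := Function.update σ₅ n (σ₅ n).tl with hσ₆
    have u₆ : σ₆ n = enc l := by rw [hσ₆, Function.update_self, u₅]; rfl
    have u₆' : σ₆ (n + 1) = enc x := by
      rw [hσ₆, Function.update_of_ne (by omega), hσ₅, update_lt _ _ (by omega), k₄ _ (by omega),
        w₃ _ (by omega), h₁]
    have u₆'' : σ₆ (n + 2) = enc (f x i a) := by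
      rw [hσ₆, Function.update_of_ne (by omega), hσ₅, Function.update_self, g₄]
    obtain ⟨σ₇, t₇, ht₇, e₇, g₇, k₇⟩ := ih (f x i a) (fun l' a' hl => by
      have h := hB (a :: l') a' (by simpa using hl)
      simp only [List.foldl_cons, List.cons_append, esize_cons] at h
      omega) σ₆ u₆ u₆' u₆''
    refine ⟨σ₇, _, ?_, .while_cons (by simp [h₀]) ((Exec.hd _ _ _).seq ((Exec.cons _ _ _ _).seq
      ((Exec.cons _ _ _ _).seq (e₄.seq ((Exec.copy _ _ _).seq (.tl _ _ _)))))) e₇, g₇, ?_⟩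
    · have h := hB [] a (by simp)
      rw [← hσ₁, ← hσ₂, ← hσ₅, v₁, v₁', v₂, v₂', g₄, u₅, h₀]
      simp only [List.foldl_nil, List.nil_append, List.foldl_cons, Data.size,
        List.length_cons, enc_cons, Data.hd, Data.tl, esize] at h ⊢
      rw [Nat.add_mul]
      omega
    · intro m hm
      rw [k₇ m hm, hσ₆, update_lt _ _ hm, hσ₅, update_lt _ _ (by omega), k₄ _ (by omega),
        w₃ _ (by omega)]

namespace PTime
variable {α β γ δ : Type} [Enc α] [Enc β] [Enc γ] [Enc δ]

/-- Folds are computed in polynomial time if all intermediate results have polynomial size. -/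
theorem foldl_of_bdd {f : γ → β → α → β} {g : γ → List α} {i : γ → β} {A : γ → ℕ}
    (hf : PTime fun q : γ × β × α => f q.1 q.2.1 q.2.2) (hg : PTime g) (hi : PTime i)
    (hA : PolyBdd A) (h : ∀ x l, l <+: g x → esize (l.foldl (f x) (i x)) ≤ A x) :
    PTime fun x => (g x).foldl (f x) (i x) := by
  refine ⟨hA.mono fun x => h x _ (List.prefix_refl _), fun n => ?_⟩
  obtain ⟨p, b, hb, hp⟩ := hf.2 (n + 3)
  obtain ⟨q, b', hb', hq⟩ := (pair hg (pair id hi)).2 n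
  obtain ⟨c, hc⟩ := hb
  have hg1 := hg.1
  have hi1 := hi.1
  have hx : PolyBdd fun x : γ => esize x := .size
  -- `S x` majorizes the size of each triple on which the body runs, so one round costs at most `S x
  -- ^ c` plus bookkeeping linear in `S x`.
  let S : γ → ℕ := fun x => esize x + A x + esize (g x) + esize (i x) + 4
  have hS : PolyBdd S := (((hx.add hA).add hg1).add hi1).add (.const 4)
  let B : γ → ℕ := fun x => S x ^ c + 20 * S x
  have hBp : PolyBdd B := (hS.pow c).add ((PolyBdd.const 20).mul hS)
  refine ⟨.seq q (.seq (.tl (n + 1) n) (.seq (.hd n n) (.seq (.tl (n + 2) (n + 1))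
    (.seq (.hd (n + 1) (n + 1)) (.seq (.whileCons n (.seq (.hd (n + 3) n)
      (.seq (.cons (n + 3) (n + 2) (n + 3)) (.seq (.cons (n + 3) (n + 1) (n + 3))
        (.seq p (.seq (.copy (n + 2) (n + 3)) (.tl n n))))))) (.copy n (n + 2))))))),
    fun x => b' x + (10 * S x + (esize (g x) * (B x + 20) + (S x + 1))),
    hb'.add (((PolyBdd.const 10).mul hS).add ((hg1.mul (hBp.add (.const 20))).add
      (hS.add (.const 1)))), fun x σ hσ => ?_⟩
  obtain ⟨σ₀, t₀, ht₀, e₀, g₀, k₀⟩ := hq x σ hσ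
  set σ₁ := Function.update σ₀ (n + 1) (σ₀ n).tl with hσ₁
  set σ₂ := Function.update σ₁ n (σ₁ n).hd with hσ₂
  set σ₃ := Function.update σ₂ (n + 2) (σ₂ (n + 1)).tl with hσ₃
  set σ₄ := Function.update σ₃ (n + 1) (σ₃ (n + 1)).hd with hσ₄
  have v₁ : σ₁ (n + 1) = enc (x, i x) := by rw [hσ₁, Function.update_self, g₀]; rfl
  have v₁' : σ₁ n = enc (g x, x, i x) := by rw [hσ₁, update_lt _ _ (by omega), g₀]
  have v₂ : σ₂ n = enc (g x) := by rw [hσ₂, Function.update_self, v₁']; rfl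
  have v₂' : σ₂ (n + 1) = enc (x, i x) := by rw [hσ₂, Function.update_of_ne (by omega), v₁]
  have v₃ : σ₃ (n + 2) = enc (i x) := by rw [hσ₃, Function.update_self, v₂']; rfl
  have v₃' : σ₃ (n + 1) = enc (x, i x) := by rw [hσ₃, update_lt _ _ (by omega), v₂']
  have v₄ : σ₄ (n + 1) = enc x := by rw [hσ₄, Function.update_self, v₃']; rfl
  have v₄' : σ₄ (n + 2) = enc (i x) := by rw [hσ₄, Function.update_of_ne (by omega), v₃]
  have v₄'' : σ₄ n = enc (g x) := by
    rw [hσ₄, update_lt _ _ (by omega), hσ₃, update_lt _ _ (by omega), v₂]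
  obtain ⟨σ₅, t₅, ht₅, e₅, g₅, k₅⟩ := while_foldl f hp x (B x) (g x) (i x)
    (fun l' a hl => by
      have h1 := h x l' ((List.prefix_append l' [a]).trans hl)
      have h2 := h x _ hl
      have h3 := esize_le_of_mem (hl.subset (by simp : a ∈ l' ++ [a]))
      have h4 := hc (x, l'.foldl (f x) (i x), a)
      have h5 : (esize (x, l'.foldl (f x) (i x), a) + 2) ^ c ≤ S x ^ c :=
        Nat.pow_le_pow_left (by simp only [esize_pair, S]; omega) c
      have h6 : B x = S x ^ c + 20 * S x := rfl
      have h7 : esize x + A x + esize (g x) ≤ S x := by simp only [S]; omega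
      omega) σ₄ v₄'' v₄ v₄'
  refine ⟨_, _, ?_, e₀.seq ((Exec.tl _ _ _).seq ((Exec.hd _ _ _).seq ((Exec.tl _ _ _).seq
    ((Exec.hd _ _ _).seq (e₅.seq (.copy _ _ _)))))), by simp [g₅], ?_⟩
  · have h8 := h x _ (List.prefix_refl _)
    have h9 : (g x).length * (B x + 20) ≤ esize (g x) * (B x + 20) :=
      Nat.mul_le_mul_right _ (length_le_esize _)
    have h10 : S x = esize x + A x + esize (g x) + esize (i x) + 4 := rfl
    rw [← hσ₁, ← hσ₂, ← hσ₃, g₀, v₁', v₂', v₃', g₅]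
    simp only [enc_pair, Data.hd, Data.tl, Data.size, esize] at h8 h9 h10 ht₅ ⊢
    omega
  · intro m hm
    rw [update_lt _ _ hm, k₅ m hm, hσ₄, update_lt _ _ (by omega), hσ₃, update_lt _ _ (by omega),
      hσ₂, update_lt _ _ hm, hσ₁, update_lt _ _ (by omega), k₀ m hm]

/-- Folds are computed in polynomial time if every step adds a polynomial amount to the size. -/
theorem foldl {f : γ → β → α → β} {g : γ → List α} {i : γ → β} {A : γ → ℕ}
    (hf : PTime fun q : γ × β × α => f q.1 q.2.1 q.2.2) (hg : PTime g) (hi : PTime i)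
    (hA : PolyBdd A) (h : ∀ x y, ∀ a ∈ g x, esize (f x y a) ≤ esize y + A x) :
    PTime fun x => (g x).foldl (f x) (i x) := by
  refine foldl_of_bdd hf hg hi (hi.1.add (hg.1.mul hA)) fun x l hl => ?_
  have key : ∀ (l : List α) (y : β), (∀ a ∈ l, a ∈ g x) →
      esize (l.foldl (f x) y) ≤ esize y + l.length * A x := by
    intro l
    induction l with
    | nil => simp
    | cons a l ih =>
      intro y hy
      have h1 := ih (f x y a) fun b hb => hy b (by simp [hb])
      have h2 := h x y a (hy a (by simp))
      simp only [List.foldl_cons, List.length_cons, Nat.add_mul, one_mul]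
      omega
  refine (key l (i x) fun a ha => hl.subset ha).trans ?_
  gcongr
  exact hl.length_le.trans (length_le_esize _)

end PTime

/-! ### A library of polynomial-time functions -/

attribute [fun_prop] PTime PTime.id PTime.const PTime.comp PTime.fst PTime.snd PTime.pair
  PTime.cond PTime.encode

namespace PTime
variable {α β γ δ : Type} [Enc α] [Enc β] [Enc γ] [Enc δ]

@[fun_prop]
theorem fst' {f : γ → α × β} (hf : PTime f) : PTime fun x => (f x).1 := fst.comp hf

@[fun_prop]
theorem snd' {f : γ → α × β} (hf : PTime f) : PTime fun x => (f x).2 := snd.comp hf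

@[fun_prop]
theorem data_hd {f : γ → Data} (hf : PTime f) : PTime fun x => (f x).hd := hd.comp hf

@[fun_prop]
theorem data_tl {f : γ → Data} (hf : PTime f) : PTime fun x => (f x).tl := tl.comp hf

/-- Every tree is the code of its own list of subtrees, so reading a tree as a list costs nothing.
-/
theorem enc_toList (x : Data) : enc x.toList = x := by
  induction x with
  | nil => rfl
  | cons a b _ ih => simp [Data.toList, ih]

@[fun_prop]
theorem data_toList {f : γ → Data} (hf : PTime f) : PTime fun x => (f x).toList :=
  of_enc hf fun _ => enc_toList _

@[fun_prop]
theorem list_cons {f : γ → α} {g : γ → List α} (hf : PTime f) (hg : PTime g) :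
    PTime fun x => f x :: g x :=
  of_enc (pair hf hg) fun _ => rfl

@[fun_prop]
theorem bool_not {f : γ → Bool} (hf : PTime f) : PTime fun x => !(f x) :=
  of_eq (cond hf (const false) (const true)) fun x => by cases f x <;> rfl

@[fun_prop]
theorem bool_and {f g : γ → Bool} (hf : PTime f) (hg : PTime g) : PTime fun x => f x && g x :=
  of_eq (cond hf hg (const false)) fun x => by cases f x <;> rfl

@[fun_prop]
theorem bool_or {f g : γ → Bool} (hf : PTime f) (hg : PTime g) : PTime fun x => f x || g x :=
  of_eq (cond hf (const true) hg) fun x => by cases f x <;> rfl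

@[fun_prop]
theorem nat_succ {f : γ → ℕ} (hf : PTime f) : PTime fun x => f x + 1 :=
  of_enc (pair (const ()) hf) fun _ => rfl

theorem enc_pred (n : ℕ) : enc (n - 1) = (enc n).tl := by cases n <;> rfl

@[fun_prop]
theorem nat_pred {f : γ → ℕ} (hf : PTime f) : PTime fun x => f x - 1 :=
  of_enc (tl.comp (encode.comp hf)) fun _ => enc_pred _

theorem enc_tail (l : List α) : enc l.tail = (enc l).tl := by cases l <;> rfl

@[fun_prop]
theorem list_tail {f : γ → List α} (hf : PTime f) : PTime fun x => (f x).tail :=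
  of_enc (tl.comp (encode.comp hf)) fun _ => enc_tail _

theorem enc_headD (l : List α) (d : α) :
    enc (l.headD d) = bif l.isEmpty then enc d else (enc l).hd := by cases l <;> rfl

@[fun_prop]
theorem list_isEmpty {f : γ → List α} (hf : PTime f) : PTime fun x => (f x).isEmpty :=
  ite_enc_nil hf (const true) (const false)
    (fun x h => by cases hh : f x <;> simp [hh] at h ⊢)
    (fun x h => by cases hh : f x <;> simp [hh] at h ⊢)

@[fun_prop]
theorem list_headD {f : γ → List α} {d : γ → α} (hf : PTime f) (hd : PTime d) :
    PTime fun x => (f x).headD (d x) :=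
  of_enc (f := fun x => bif (f x).isEmpty then enc (d x) else (enc (f x)).hd)
    (by fun_prop) fun _ => enc_headD _ _

theorem enc_replicate_unit (n : ℕ) : enc (List.replicate n ()) = enc n := by
  induction n with
  | zero => rfl
  | succ n ih => simp [List.replicate_succ, ih]

@[fun_prop]
theorem replicate_unit {f : γ → ℕ} (hf : PTime f) : PTime fun x => List.replicate (f x) () :=
  of_enc hf fun _ => enc_replicate_unit _

@[fun_prop]
theorem list_reverse {g : γ → List α} (hg : PTime g) : PTime fun x => (g x).reverse :=
  of_eq (f := fun x => (g x).foldl (fun l a => a :: l) [])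
    (foldl (f := fun _ l a => a :: l) (A := fun x => esize (g x) + 1) (by fun_prop) hg
      (const []) (hg.1.add (.const 1)) fun x y a ha => by
        have := esize_le_of_mem ha; simp; omega)
    fun x => by simp

theorem foldr {f : γ → α → β → β} {g : γ → List α} {i : γ → β} {A : γ → ℕ}
    (hf : PTime fun q : γ × α × β => f q.1 q.2.1 q.2.2) (hg : PTime g) (hi : PTime i)
    (hA : PolyBdd A) (h : ∀ x y, ∀ a ∈ g x, esize (f x a y) ≤ esize y + A x) :
    PTime fun x => (g x).foldr (f x) (i x) := by
  refine of_eq (foldl (f := fun x b a => f x a b) (A := A) (g := fun x => (g x).reverse)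
    (hf.comp (f := fun q : γ × β × α => (q.1, q.2.2, q.2.1)) (by fun_prop)) (by fun_prop) hi hA
    fun x y a ha => h x y a (by simpa using ha)) fun x => by simp

@[fun_prop]
theorem list_append {f g : γ → List α} (hf : PTime f) (hg : PTime g) :
    PTime fun x => f x ++ g x :=
  of_eq (foldr (f := fun _ a l => a :: l) (A := fun x => esize (f x) + 1) (by fun_prop) hf hg
      (hf.1.add (.const 1)) fun x y a ha => by have := esize_le_of_mem ha; simp; omega)
    fun x => by simp

/-- List members are no larger than the list, so the polynomial for `f` gives one bound for all
members. It supplies the size increments for the folds behind `map` and `flatMap`. -/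
theorem bdd_elem {f : γ → α → β} {g : γ → List α} (hf : PTime fun q : γ × α => f q.1 q.2)
    (hg : PTime g) : ∃ A : γ → ℕ, PolyBdd A ∧ ∀ x, ∀ a ∈ g x, esize (f x a) ≤ A x := by
  obtain ⟨c, hc⟩ := hf.1
  refine ⟨fun x => (esize x + esize (g x) + 3) ^ c,
    ((PolyBdd.size.add hg.1).add (.const 3)).pow c, fun x a ha => (hc (x, a)).trans ?_⟩
  have := esize_le_of_mem ha
  exact Nat.pow_le_pow_left (by simp only [esize_pair]; omega) c

@[fun_prop]
theorem list_map {f : γ → α → β} {g : γ → List α} (hf : PTime fun q : γ × α => f q.1 q.2)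
    (hg : PTime g) : PTime fun x => (g x).map (f x) := by
  obtain ⟨A, hA, h⟩ := bdd_elem hf hg
  refine of_eq (foldr (f := fun x a l => f x a :: l) (A := fun x => A x + 1) (i := fun _ => [])
    ?_ hg (const _) (hA.add (.const 1)) fun x y a ha => ?_) fun x => ?_
  · have := hf.comp (f := fun q : γ × α × List β => (q.1, q.2.1)) (by fun_prop)
    fun_prop
  · have := h x a ha
    simp; omega
  · induction g x with
    | nil => rfl
    | cons a l ih => exact congrArg (f x a :: ·) ih

@[fun_prop]
theorem list_flatMap {f : γ → α → List β} {g : γ → List α}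
    (hf : PTime fun q : γ × α => f q.1 q.2) (hg : PTime g) :
    PTime fun x => (g x).flatMap (f x) := by
  obtain ⟨A, hA, h⟩ := bdd_elem hf hg
  refine of_eq (foldr (f := fun x a l => f x a ++ l) (A := A) (i := fun _ => [])
    ?_ hg (const _) hA fun x y a ha => ?_) fun x => ?_
  · have := hf.comp (f := fun q : γ × α × List β => (q.1, q.2.1)) (by fun_prop)
    fun_prop
  · have := h x a ha
    rw [esize_append]; omega
  · induction g x with
    | nil => rfl
    | cons a l ih => simp [ih]

@[fun_prop]
theorem list_filter {f : γ → α → Bool} {g : γ → List α}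
    (hf : PTime fun q : γ × α => f q.1 q.2) (hg : PTime g) :
    PTime fun x => (g x).filter (f x) := by
  refine of_eq (list_flatMap (f := fun x a => bif f x a then [a] else []) ?_ hg) fun x => ?_
  · fun_prop
  · induction g x with
    | nil => rfl
    | cons a l ih => cases h : f x a <;> simp [h, ih]

@[fun_prop]
theorem list_any {f : γ → α → Bool} {g : γ → List α}
    (hf : PTime fun q : γ × α => f q.1 q.2) (hg : PTime g) :
    PTime fun x => (g x).any (f x) :=
  of_eq (f := fun x => !((g x).filter (f x)).isEmpty) (by fun_prop) fun x => by
    induction g x with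
    | nil => rfl
    | cons a l ih => cases h : f x a <;> simp [h, ih]

@[fun_prop]
theorem list_all {f : γ → α → Bool} {g : γ → List α}
    (hf : PTime fun q : γ × α => f q.1 q.2) (hg : PTime g) :
    PTime fun x => (g x).all (f x) :=
  of_eq (f := fun x => !((g x).any fun a => !(f x a))) (by fun_prop) fun x => by
    rw [Bool.eq_iff_iff]; simp

@[fun_prop]
theorem list_length {f : γ → List α} (hf : PTime f) : PTime fun x => (f x).length :=
  of_enc (f := fun x => (f x).map fun _ => ()) (by fun_prop) fun x => by
    induction f x with
    | nil => rfl
    | cons a l ih => simp [ih]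

@[fun_prop]
theorem data_toNat {f : γ → Data} (hf : PTime f) : PTime fun x => (f x).toNat :=
  of_eq (f := fun x => (f x).toList.length) (by fun_prop) fun x => by
    induction f x with
    | nil => rfl
    | cons a l _ ih => simp [Data.toNat, Data.toList, ih]

@[fun_prop]
theorem nat_add {f g : γ → ℕ} (hf : PTime f) (hg : PTime g) : PTime fun x => f x + g x :=
  of_enc (f := fun x => List.replicate (f x) () ++ List.replicate (g x) ()) (by fun_prop)
    fun x => by rw [List.replicate_append_replicate, enc_replicate_unit]

@[fun_prop]
theorem nat_mul {f g : γ → ℕ} (hf : PTime f) (hg : PTime g) : PTime fun x => f x * g x :=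
  of_eq (f := fun x => ((List.replicate (f x) ()).flatMap fun _ =>
    List.replicate (g x) ()).length) (by fun_prop) fun x => by simp

@[fun_prop]
theorem nat_pow {f : γ → ℕ} (hf : PTime f) (n : ℕ) : PTime fun x => f x ^ n := by
  induction n with
  | zero => simpa using const 1
  | succ n ih => simp only [pow_succ]; fun_prop

@[fun_prop]
theorem nat_sub {f g : γ → ℕ} (hf : PTime f) (hg : PTime g) : PTime fun x => f x - g x :=
  of_eq (foldl (f := fun _ y _ => y - 1) (g := fun x => List.replicate (g x) ()) (i := f)
    (A := fun _ => 0) (by fun_prop) (by fun_prop) hf (.const 0) fun x y a _ => by simp)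
    fun x => by
      have : ∀ n m : ℕ, (List.replicate n ()).foldl (fun y _ => y - 1) m = m - n := by
        intro n
        induction n with
        | zero => simp
        | succ n ih => intro m; simp [List.replicate_succ, ih]; omega
      rw [this]

@[fun_prop]
theorem list_drop {f : γ → List α} {g : γ → ℕ} (hf : PTime f) (hg : PTime g) :
    PTime fun x => (f x).drop (g x) :=
  of_eq (foldl (f := fun _ y _ => y.tail) (g := fun x => List.replicate (g x) ()) (i := f)
    (A := fun _ => 0) (by fun_prop) (by fun_prop) hf (.const 0) fun x y a _ => by
      cases y <;> simp; omega)
    fun x => by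
      have : ∀ (n : ℕ) (l : List α),
          (List.replicate n ()).foldl (fun y _ => y.tail) l = l.drop n := by
        intro n
        induction n with
        | zero => simp
        | succ n ih => intro m; simp [List.replicate_succ, ih]
      rw [this]

@[fun_prop]
theorem list_getD {f : γ → List α} {g : γ → ℕ} {d : γ → α} (hf : PTime f) (hg : PTime g)
    (hd : PTime d) : PTime fun x => (f x).getD (g x) (d x) :=
  of_eq (f := fun x => ((f x).drop (g x)).headD (d x)) (by fun_prop) fun x => by
    simp [List.headD_eq_head?_getD, List.getD_eq_getElem?_getD]

@[fun_prop]
theorem nat_decide_eq_zero {f : γ → ℕ} (hf : PTime f) : PTime fun x => decide (f x = 0) :=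
  of_eq (f := fun x => (List.replicate (f x) ()).isEmpty) (by fun_prop) fun x => by
    cases f x <;> simp [List.replicate_succ]

@[fun_prop]
theorem nat_decide_le {f g : γ → ℕ} (hf : PTime f) (hg : PTime g) :
    PTime fun x => decide (f x ≤ g x) :=
  of_eq (f := fun x => decide (f x - g x = 0)) (by fun_prop) fun x => by
    simp [Nat.sub_eq_zero_iff_le]

@[fun_prop]
theorem nat_decide_lt {f g : γ → ℕ} (hf : PTime f) (hg : PTime g) :
    PTime fun x => decide (f x < g x) :=
  of_eq (f := fun x => decide (f x + 1 ≤ g x)) (by fun_prop) fun x => rfl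

@[fun_prop]
theorem nat_decide_eq {f g : γ → ℕ} (hf : PTime f) (hg : PTime g) :
    PTime fun x => decide (f x = g x) :=
  of_eq (f := fun x => decide (f x ≤ g x) && decide (g x ≤ f x)) (by fun_prop) fun x => by
    rw [Bool.eq_iff_iff]; simp [le_antisymm_iff]

@[fun_prop]
theorem list_range {f : γ → ℕ} (hf : PTime f) : PTime fun x => List.range (f x) := by
  have key : ∀ l : List Unit,
      l.foldl (fun y _ => y ++ [y.length]) [] = List.range l.length := by
    intro l
    induction l using List.reverseRecOn with
    | nil => rfl
    | append_singleton l a ih => simp [ih, List.range_succ]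
  -- An arbitrary accumulator may grow by its own length here, so the increment criterion `foldl`
  -- does not apply. The accumulators that occur are initial ranges, of at most quadratic size.
  have := foldl_of_bdd (f := fun _ y _ => y ++ [y.length])
    (g := fun x => List.replicate (f x) ()) (i := fun _ : γ => [])
    (A := fun x => f x * (f x + 1)) (by fun_prop) (by fun_prop) (by fun_prop)
    ((hf.1.mul (hf.1.add (.const 1))).mono fun x => by simp) fun x l hl => by
      have hl' : l.length ≤ f x := by simpa using hl.length_le
      rw [key]
      refine (esize_list_le (B := f x) fun a ha => ?_).trans ?_
      · simp at ha ⊢; omega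
      · simpa using Nat.mul_le_mul_right (f x + 1) hl'
  exact of_eq this fun x => by rw [key]; simp

/-- All lists of length `n` with entries in `l`. -/
def _root_.listTuples {α : Type} (l : List α) : ℕ → List (List α)
  | 0 => [[]]
  | n + 1 => l.flatMap fun a => (listTuples l n).map fun t => a :: t

theorem _root_.mem_listTuples {α : Type} {l t : List α} {n : ℕ} :
    t ∈ listTuples l n ↔ t.length = n ∧ ∀ a ∈ t, a ∈ l := by
  induction n generalizing t with
  | zero => cases t <;> simp [listTuples]
  | succ n ih => cases t <;> simp [listTuples, ih]; tauto

theorem _root_.length_listTuples {α : Type} (l : List α) (n : ℕ) :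
    (listTuples l n).length = l.length ^ n := by
  induction n with
  | zero => simp [listTuples]
  | succ n ih => simp [listTuples, ih, pow_succ, mul_comm]

-- The length `n` is fixed and not part of the input; the recursion on it takes place in the
-- construction of the program. This keeps the number of tuples polynomial.
@[fun_prop]
theorem list_tuples {f : γ → List α} (hf : PTime f) (n : ℕ) :
    PTime fun x => listTuples (f x) n := by
  induction n with
  | zero => exact const _
  | succ n ih =>
    exact list_flatMap (f := fun x a => (listTuples (f x) n).map fun t => a :: t)
      (list_map (f := fun (q : γ × α) t => q.2 :: t) (by fun_prop) (ih.comp fst)) hf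

end PTime

/-! ### Programs for computable functions -/

theorem computable_esize : Computable (esize : List ℕ → ℕ) := by
  have h : Primrec fun l : List ℕ => l.foldr (fun a s => a + s + 1) 0 :=
    Primrec.list_foldr Primrec.id (Primrec.const 0)
      (Primrec.succ.comp (Primrec.nat_add.comp (Primrec.fst.comp Primrec.snd)
        (Primrec.snd.comp Primrec.snd))).to₂
  refine (h.of_eq fun l => ?_).to_comp
  induction l with
  | nil => rfl
  | cons a l ih => simp [ih]

theorem computable_pow_const (c : ℕ) : Computable fun n : ℕ => n ^ c := by
  induction c with
  | zero => simpa using Computable.const 1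
  | succ c ih =>
    simp only [pow_succ]
    exact Primrec.nat_mul.to_comp.comp ih .id

/-- `p` computes the partial function `e` on lists of numbers, in a time that is given by a partial
recursive function. -/
def ComputesWithin (e : List ℕ →. List ℕ) (n : ℕ) (p : Prog) (T : List ℕ →. List ℕ × ℕ) : Prop :=
  Partrec T ∧ ∀ v out, out ∈ e v → ∃ t, (out, t) ∈ T v ∧ RunsAt p n (enc v) (enc out) t

/-- The polynomial bound is itself a computable running time, so base cases can be taken from the
`PTime` library. -/
theorem PTime.computesWithin {f : List ℕ → List ℕ} (hf : PTime f) (hc : Computable f) (n : ℕ) :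
    ∃ p T, ComputesWithin (fun v => pure (f v)) n p T := by
  obtain ⟨p, b, ⟨c, hb⟩, hp⟩ := hf.2 n
  refine ⟨p, fun v => Part.some (f v, (esize v + 2) ^ c), ?_, fun v out h => ?_⟩
  · exact (hc.pair ((computable_pow_const c).comp
      (Primrec.nat_add.to_comp.comp computable_esize (.const 2)))).partrec
  · obtain rfl : out = f v := by simpa using h
    exact ⟨_, Part.mem_some _, (hp v).mono (hb v)⟩

theorem enc_headI (v : List ℕ) : enc v.headI = (enc v).hd := by cases v <;> rfl

theorem ptime_headI : PTime (List.headI : List ℕ → ℕ) :=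
  .of_enc (f := fun v : List ℕ => (enc v).hd) (by fun_prop) fun _ => enc_headI _

theorem computable_headI : Computable (List.headI : List ℕ → ℕ) :=
  (Primrec.list_headI).to_comp

/-- The time function runs the two given ones in sequence. It returns values along with times
because the cost of assembling the result depends on them. -/
theorem computesWithin_cons {e e' : List ℕ →. List ℕ} {n : ℕ} {p q : Prog}
    {T T' : List ℕ →. List ℕ × ℕ} (hp : ComputesWithin e (n + 1) p T)
    (hq : ComputesWithin e' (n + 2) q T') :
    ∃ p T, ComputesWithin (fun v => do
      let a ← e v
      let l ← e' v
      pure (a.headI :: l)) n p T := by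
  refine ⟨.seq (.copy (n + 1) n) (.seq p (.seq (.copy (n + 2) n)
    (.seq q (.seq (.hd (n + 1) (n + 1)) (.cons n (n + 1) (n + 2)))))),
    fun v => (T v).bind fun r => (T' v).map fun r' => (r.1.headI :: r'.1,
      r.2 + r'.2 + 2 * esize v + 2 * r.1.headI + esize r'.1 + 10), ?_, fun v out h => ?_⟩
  · have S := computable_esize
    have H := computable_headI
    have A := Primrec.nat_add.to_comp
    have M := Primrec.nat_mul.to_comp
    refine hp.1.bind (Partrec.map (hq.1.comp Computable.fst) ?_)
    have r : Computable fun x : (List ℕ × List ℕ × ℕ) × List ℕ × ℕ => x.1.2 :=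
      Computable.snd.comp .fst
    have r' : Computable fun x : (List ℕ × List ℕ × ℕ) × List ℕ × ℕ => x.2 := .snd
    have v : Computable fun x : (List ℕ × List ℕ × ℕ) × List ℕ × ℕ => x.1.1 :=
      Computable.fst.comp .fst
    have h := H.comp (Computable.fst.comp r)
    exact (Computable.list_cons.comp h (Computable.fst.comp r')).pair
      (A.comp (A.comp (A.comp (A.comp (A.comp (Computable.snd.comp r) (Computable.snd.comp r'))
        (M.comp (.const 2) (S.comp v))) (M.comp (.const 2) h)) (S.comp (Computable.fst.comp r')))
        (.const 10))
  · obtain ⟨a, ha, l, hl, rfl⟩ : ∃ a ∈ e v, ∃ l ∈ e' v, out = a.headI :: l := by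
      simpa [Part.bind_eq_bind] using h
    obtain ⟨t, ht, r⟩ := hp.2 v a ha
    obtain ⟨t', ht', r'⟩ := hq.2 v l hl
    refine ⟨t + t' + 2 * esize v + 2 * a.headI + esize l + 10,
      Part.mem_bind ht (Part.mem_map_iff _ |>.2 ⟨_, ht', rfl⟩), fun σ hσ => ?_⟩
    obtain ⟨σ₁, t₁, ht₁, e₁, h₁, k₁⟩ := r (Function.update σ (n + 1) (σ n)) (by simp [hσ])
    have h₁' : σ₁ n = enc v := by rw [k₁ n (by omega), update_lt _ _ (by omega), hσ]
    obtain ⟨σ₂, t₂, ht₂, e₂, h₂, k₂⟩ := r' (Function.update σ₁ (n + 2) (σ₁ n)) (by simp [h₁'])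
    have h₂' : σ₂ (n + 1) = enc a := by
      rw [k₂ _ (by omega), update_lt _ _ (by omega), h₁]
    set σ₃ := Function.update σ₂ (n + 1) (σ₂ (n + 1)).hd with hσ₃
    have h₃ : σ₃ (n + 1) = enc a.headI := by rw [hσ₃, Function.update_self, h₂', enc_headI]
    have h₃' : σ₃ (n + 2) = enc l := by rw [hσ₃, Function.update_of_ne (by omega), h₂]
    refine ⟨_, _, ?_, (Exec.copy _ _ _).seq (e₁.seq ((Exec.copy _ _ _).seq (e₂.seq
      ((Exec.hd _ _ _).seq (.cons n (n + 1) (n + 2) σ₃))))), by simp [h₃, h₃'], ?_⟩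
    · have h4 : (enc a.headI).size = a.headI := esize_nat _
      rw [h₃, h₃', h₂', hσ, h₁', ← enc_headI, Data.size, h4]
      simp only [esize]; omega
    · intro m hm
      rw [update_lt _ _ hm, hσ₃, update_lt _ _ (by omega), k₂ m (by omega),
        update_lt _ _ (by omega), k₁ m (by omega), update_lt _ _ (by omega)]

theorem computesWithin_comp {e e' : List ℕ →. List ℕ} {n : ℕ} {p q : Prog}
    {T T' : List ℕ →. List ℕ × ℕ} (hp : ComputesWithin e n p T)
    (hq : ComputesWithin e' n q T') : ∃ p T, ComputesWithin (fun v => e v >>= e') n p T := by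
  refine ⟨.seq p q, fun v => (T v).bind fun r => (T' r.1).map fun r' => (r'.1, r.2 + r'.2), ?_,
    fun v out h => ?_⟩
  · refine hp.1.bind (Partrec.map (hq.1.comp (Computable.fst.comp .snd)) ?_)
    exact (Computable.fst.comp .snd).pair (Primrec.nat_add.to_comp.comp
      (Computable.snd.comp (Computable.snd.comp .fst)) (Computable.snd.comp .snd))
  · obtain ⟨a, ha, hl⟩ : ∃ a ∈ e v, out ∈ e' a := Part.mem_bind_iff.1 h
    obtain ⟨t, ht, r⟩ := hp.2 v a ha
    obtain ⟨t', ht', r'⟩ := hq.2 a out hl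
    exact ⟨t + t', Part.mem_bind ht (Part.mem_map_iff _ |>.2 ⟨_, ht', rfl⟩), r.seq r'⟩

/-- The head of the list is moved above the argument and tested there; in the successor branch its
predecessor is pushed back onto the tail. -/
theorem computesWithin_case {e e' : List ℕ →. List ℕ} {n : ℕ} {p q : Prog}
    {T T' : List ℕ →. List ℕ × ℕ} (hp : ComputesWithin e n p T)
    (hq : ComputesWithin e' n q T') : ∃ p T, ComputesWithin
      (fun v => v.headI.rec (e v.tail) fun y _ => e' (y :: v.tail)) n p T := by
  refine ⟨.seq (.hd (n + 1) n) (.seq (.tl n n) (.ifNil (n + 1) p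
    (.seq (.tl (n + 1) (n + 1)) (.seq (.cons n (n + 1) n) q)))),
    fun v => (bif decide (v.headI = 0) then T v.tail else T' ((v.headI - 1) :: v.tail)).map
      fun r => (r.1, r.2 + 5 * esize v + 6), ?_, fun v out h => ?_⟩
  · refine Partrec.map (Partrec.cond ?_ (hp.1.comp ?_) (hq.1.comp ?_)) ?_
    · exact (PrimrecPred.decide (Primrec.eq.comp Primrec.list_headI (Primrec.const 0))).to_comp
    · exact Primrec.list_tail.to_comp
    · exact Computable.list_cons.comp (Primrec.pred.to_comp.comp computable_headI)
        Primrec.list_tail.to_comp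
    · exact (Computable.fst.comp .snd).pair (Primrec.nat_add.to_comp.comp
        (Primrec.nat_add.to_comp.comp (Computable.snd.comp .snd)
          (Primrec.nat_mul.to_comp.comp (.const 5) (computable_esize.comp .fst))) (.const 6))
  · have sz : (enc v).size = esize v := rfl
    have hs := Data.hd_size_le (enc v)
    have ts := Data.tl_size_le (enc v)
    have tts := Data.tl_size_le (enc v).hd
    set σf : Store → Store := fun σ =>
      Function.update (Function.update σ (n + 1) (σ n).hd) n
        (Function.update σ (n + 1) (σ n).hd n).tl with hσf
    have f₁ : ∀ σ : Store, σ n = enc v → σf σ (n + 1) = enc v.headI := fun σ hσ => by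
      simp [hσf, hσ, enc_headI]
    have f₂ : ∀ σ : Store, σ n = enc v → σf σ n = enc v.tail := fun σ hσ => by
      simp [hσf, hσ, PTime.enc_tail]
    have f₃ : ∀ σ : Store, ∀ m < n, σf σ m = σ m := fun σ m hm => by
      simp only [hσf]
      rw [update_lt _ _ hm, update_lt _ _ (by omega)]
    cases hv : v.headI with
    | zero =>
      simp only [hv] at h
      obtain ⟨t, ht, r⟩ := hp.2 _ out h
      refine ⟨t + 5 * esize v + 6, Part.mem_map_iff _ |>.2 ⟨(out, t), ?_, rfl⟩, fun σ hσ => ?_⟩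
      · simpa [hv] using ht
      obtain ⟨σ₁, t₁, ht₁, e₁, h₁, k₁⟩ := r (σf σ) (f₂ σ hσ)
      refine ⟨_, _, ?_, (Exec.hd _ _ _).seq ((Exec.tl _ _ _).seq (.ifNil_nil ?_ e₁)), h₁, ?_⟩
      · rw [update_lt _ _ (by omega), hσ]
        omega
      · exact (f₁ σ hσ).trans (by rw [hv]; rfl)
      · intro m hm
        rw [k₁ m hm, f₃ σ m hm]
    | succ y =>
      simp only [hv] at h
      obtain ⟨t, ht, r⟩ := hq.2 _ out h
      refine ⟨t + 5 * esize v + 6, Part.mem_map_iff _ |>.2 ⟨(out, t), ?_, rfl⟩, fun σ hσ => ?_⟩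
      · simpa [hv] using ht
      have f₁' := f₁ σ hσ
      rw [hv] at f₁'
      set σ₂ := Function.update (σf σ) (n + 1) (σf σ (n + 1)).tl with hσ₂
      have g₁ : σ₂ (n + 1) = enc y := by rw [hσ₂, Function.update_self, f₁']; rfl
      have g₂ : σ₂ n = enc v.tail := by rw [hσ₂, update_lt _ _ (by omega), f₂ σ hσ]
      set σ₃ := Function.update σ₂ n (Data.cons (σ₂ (n + 1)) (σ₂ n)) with hσ₃
      obtain ⟨σ₁, t₁, ht₁, e₁, h₁, k₁⟩ := r σ₃ (by rw [hσ₃, Function.update_self, g₁, g₂]; rfl)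
      refine ⟨_, _, ?_, (Exec.hd _ _ _).seq ((Exec.tl _ _ _).seq (.ifNil_cons ?_
        ((Exec.tl _ _ _).seq ((Exec.cons _ _ _ _).seq e₁)))), h₁, ?_⟩
      · have e0 : Data.size (Data.cons (σ₂ (n + 1)) (σ₂ n)) ≤ 2 * esize v + 1 := by
          rw [g₁, g₂, Data.size, PTime.enc_tail]
          have : (enc v.headI).size = y + 1 := by rw [hv]; exact esize_nat _
          have h' : (enc y).size = y := esize_nat _
          rw [enc_headI] at this
          omega
        have e1 : (σf σ (n + 1)).tl.size ≤ esize v := by rw [f₁ σ hσ, enc_headI]; omega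
        have e2 : (Function.update σ (n + 1) (σ n).hd n).tl.size ≤ esize v := by
          rw [update_lt _ _ (by omega), hσ]; omega
        have e3 : (σ n).hd.size ≤ esize v := by rw [hσ]; omega
        change 1 + (σ n).hd.size + (1 + (Function.update σ (n + 1) (σ n).hd n).tl.size +
          (1 + (1 + (σf σ (n + 1)).tl.size + (1 + Data.size (Data.cons (σ₂ (n + 1)) (σ₂ n)) +
          t₁)))) ≤ _
        omega
      · exact fun h0 => by have := f₁'.symm.trans h0; simp at this
      · intro m hm
        rw [k₁ m hm, hσ₃, update_lt _ _ hm, hσ₂, update_lt _ _ (by omega), f₃ σ m hm]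

/-- The running time is obtained by iterating on pairs of a list and the time spent so far: the
enlarged iteration is again a fixed point of a partial recursive step. -/
theorem computesWithin_fix {e : List ℕ →. List ℕ} {n : ℕ} {p : Prog}
    {T : List ℕ →. List ℕ × ℕ} (hp : ComputesWithin e (n + 1) p T) : ∃ p T, ComputesWithin
      (PFun.fix fun v => (e v).map fun w => if w.headI = 0 then Sum.inl w.tail else Sum.inr w.tail)
      n p T := by
  let step : List ℕ × ℕ → List ℕ × ℕ → List ℕ × ℕ := fun x r =>
    (r.1.tail, x.2 + r.2 + 2 * esize r.1 + 5)
  let F : List ℕ × ℕ →. (List ℕ × ℕ) ⊕ (List ℕ × ℕ) := fun x => (T x.1).map fun r =>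
    bif decide (r.1.headI = 0) then Sum.inl (step x r) else Sum.inr (step x r)
  let w : Prog := .whileCons n (.seq p (.seq (.hd n (n + 1)) (.tl (n + 1) (n + 1))))
  -- Variable `n` is the loop flag. It starts out different from `nil` because the body must be
  -- executed at least once.
  refine ⟨.seq (.copy (n + 1) n) (.seq (.setNil n) (.seq (.cons n n n)
      (.seq w (.copy n (n + 1))))), fun v => (PFun.fix F (v, 0)).map fun r =>
      (r.1, r.2 + esize v + esize r.1 + 10), ?_, fun v out h => ?_⟩
  · have A := Primrec.nat_add.to_comp
    have M := Primrec.nat_mul.to_comp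
    have hF : Partrec F := by
      have r : Computable fun x : (List ℕ × ℕ) × (List ℕ × ℕ) => x.2 := .snd
      have hs : Computable fun x : (List ℕ × ℕ) × (List ℕ × ℕ) => step x.1 x.2 :=
        (Primrec.list_tail.to_comp.comp (Computable.fst.comp r)).pair
          (A.comp (A.comp (A.comp (Computable.snd.comp .fst) (Computable.snd.comp r))
            (M.comp (.const 2) (computable_esize.comp (Computable.fst.comp r)))) (.const 5))
      refine Partrec.map (hp.1.comp .fst) (Computable.cond ?_ (Primrec.sumInl.to_comp.comp hs)
        (Primrec.sumInr.to_comp.comp hs))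
      exact ((PrimrecPred.decide (Primrec.eq.comp Primrec.list_headI (Primrec.const 0))).to_comp.comp
        (Computable.fst.comp r))
    refine Partrec.map (hF.fix.comp (Computable.id.pair (.const 0))) ?_
    exact (Computable.fst.comp .snd).pair (A.comp (A.comp (A.comp (Computable.snd.comp .snd)
      (computable_esize.comp .fst)) (computable_esize.comp (Computable.fst.comp .snd))) (.const 10))
  -- The induction follows the iteration of `e`, so the initial time `acc` has to be arbitrary.
  · have key : ∀ acc, ∃ t, (out, t) ∈ PFun.fix F (v, acc) ∧ acc ≤ t ∧ ∀ σ : Store,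
        σ n ≠ Data.nil → σ (n + 1) = enc v → ∃ (σ' : Store) (t' : ℕ), t' + acc ≤ t + 1 ∧
          Exec w σ σ' t' ∧ σ' (n + 1) = enc out ∧ ∀ m < n, σ' m = σ m := by
      refine PFun.fixInduction (C := fun v => ∀ acc, ∃ t, (out, t) ∈ PFun.fix F (v, acc) ∧
        acc ≤ t ∧ ∀ σ : Store, σ n ≠ Data.nil → σ (n + 1) = enc v →
          ∃ (σ' : Store) (t' : ℕ), t' + acc ≤ t + 1 ∧
          Exec w σ σ' t' ∧ σ' (n + 1) = enc out ∧ ∀ m < n, σ' m = σ m) h ?_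
      intro v hv ih acc
      have body : ∀ u ∈ e v, ∃ t, (u, t) ∈ T v ∧ ∀ σ : Store, σ (n + 1) = enc v →
          ∃ (σ' : Store) (t' : ℕ), t' ≤ t + 2 * esize u + 2 ∧
            Exec (.seq p (.seq (.hd n (n + 1)) (.tl (n + 1) (n + 1)))) σ σ' t' ∧
            σ' n = enc u.headI ∧ σ' (n + 1) = enc u.tail ∧ ∀ m < n, σ' m = σ m := by
        intro u hu
        obtain ⟨t, ht, r⟩ := hp.2 v u hu
        refine ⟨t, ht, fun σ hσ => ?_⟩
        obtain ⟨σ₁, t₁, ht₁, e₁, h₁, k₁⟩ := r σ hσ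
        set σ₂ := Function.update σ₁ n (σ₁ (n + 1)).hd with hσ₂
        have g₂ : σ₂ n = enc u.headI := by rw [hσ₂, Function.update_self, h₁, enc_headI]
        have g₂' : σ₂ (n + 1) = enc u := by rw [hσ₂, Function.update_of_ne (by omega), h₁]
        refine ⟨_, _, ?_, e₁.seq ((Exec.hd _ _ _).seq (.tl _ _ _)), ?_, ?_, fun m hm => ?_⟩
        · have h1 := Data.hd_size_le (enc u)
          have h2 := Data.tl_size_le (enc u)
          rw [← hσ₂, g₂', h₁]
          simp only [esize]; omega
        · rw [update_lt _ _ (by omega), ← hσ₂, g₂]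
        · rw [Function.update_self, ← hσ₂, g₂', PTime.enc_tail]
        · rw [update_lt _ _ (by omega), update_lt _ _ hm, k₁ m (by omega)]
      rcases PFun.mem_fix_iff.1 hv with h0 | ⟨v', h0, hv'⟩
      · obtain ⟨u, hu, h0⟩ := (Part.mem_map_iff _).1 h0
        have hu0 : u.headI = 0 := by by_contra hne; simp [hne] at h0
        obtain rfl : u.tail = out := by simpa [hu0] using h0
        obtain ⟨t, ht, r⟩ := body u hu
        refine ⟨acc + t + 2 * esize u + 5, PFun.mem_fix_iff.2 (.inl ((Part.mem_map_iff _).2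
          ⟨_, ht, by simp [hu0, step]⟩)), by omega, fun σ hn hσ => ?_⟩
        obtain ⟨σ₁, t₁, ht₁, e₁, g, g', k⟩ := r σ hσ
        exact ⟨σ₁, _, by omega, .while_cons hn e₁ (.while_nil (by rw [g, hu0]; rfl)), g', k⟩
      · have h0' := h0
        obtain ⟨u, hu, h0⟩ := (Part.mem_map_iff _).1 h0
        have hu0 : u.headI ≠ 0 := by intro he; simp [he] at h0
        obtain rfl : u.tail = v' := by simpa [hu0] using h0
        obtain ⟨t, ht, r⟩ := body u hu
        obtain ⟨t', ht', hle, r'⟩ := ih _ h0' (acc + t + 2 * esize u + 5)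
        refine ⟨t', PFun.mem_fix_iff.2 (.inr ⟨_, (Part.mem_map_iff _).2
          ⟨_, ht, by simp [hu0, step]⟩, ht'⟩), by omega, fun σ hn hσ => ?_⟩
        obtain ⟨σ₁, t₁, ht₁, e₁, g, g', k⟩ := r σ hσ
        obtain ⟨σ₂, t₂, ht₂, e₂, g₂, k₂⟩ := r' σ₁ (by
          rw [g]; obtain ⟨y, hy⟩ := Nat.exists_eq_succ_of_ne_zero hu0; rw [hy]; simp) g'
        exact ⟨σ₂, _, by omega, .while_cons hn e₁ e₂, g₂, fun m hm => (k₂ m hm).trans (k m hm)⟩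
    obtain ⟨t, ht, -, r⟩ := key 0
    refine ⟨t + esize v + esize out + 10, (Part.mem_map_iff _).2 ⟨_, ht, rfl⟩, fun σ hσ => ?_⟩
    set σ₁ := Function.update σ (n + 1) (σ n) with hσ₁
    set σ₂ := Function.update σ₁ n Data.nil with hσ₂
    set σ₃ := Function.update σ₂ n (Data.cons (σ₂ n) (σ₂ n)) with hσ₃
    obtain ⟨σ₄, t₄, ht₄, e₄, g₄, k₄⟩ := r σ₃ (by simp [hσ₃]) (by
      rw [hσ₃, Function.update_of_ne (by omega), hσ₂, Function.update_of_ne (by omega), hσ₁,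
        Function.update_self, hσ])
    refine ⟨_, _, ?_, (Exec.copy _ _ _).seq ((Exec.setNil _ _).seq ((Exec.cons _ _ _ _).seq
      (e₄.seq (.copy _ _ _)))), by simp [g₄], fun m hm => ?_⟩
    · have : σ₂ n = Data.nil := by simp [hσ₂]
      rw [← hσ₁, ← hσ₂, this, g₄, hσ]
      simp only [Data.size, esize] at *; omega
    · rw [update_lt _ _ hm, k₄ m hm, hσ₃, update_lt _ _ hm, hσ₂, update_lt _ _ hm, hσ₁,
        update_lt _ _ (by omega)]

theorem exists_computesWithin (c : Turing.ToPartrec.Code) (n : ℕ) :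
    ∃ p T, ComputesWithin c.eval n p T := by
  induction c generalizing n with
  | zero' =>
    rw [Turing.ToPartrec.Code.zero'_eval]
    exact PTime.computesWithin (by fun_prop) (Computable.list_cons.comp (.const 0) .id) n
  | succ =>
    rw [Turing.ToPartrec.Code.succ_eval]
    exact PTime.computesWithin (f := fun v => [v.headI + 1])
      (.list_cons (.nat_succ ptime_headI) (.const _))
      (Computable.list_cons.comp (Computable.succ.comp computable_headI) (.const [])) n
  | tail =>
    rw [Turing.ToPartrec.Code.tail_eval]
    exact PTime.computesWithin (by fun_prop) Primrec.list_tail.to_comp n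
  | cons f fs ihf ihfs =>
    obtain ⟨p, T, hp⟩ := ihf (n + 1)
    obtain ⟨q, T', hq⟩ := ihfs (n + 2)
    rw [Turing.ToPartrec.Code.cons_eval]
    exact computesWithin_cons hp hq
  | comp f g ihf ihg =>
    obtain ⟨p, T, hp⟩ := ihf n
    obtain ⟨q, T', hq⟩ := ihg n
    rw [Turing.ToPartrec.Code.comp_eval]
    exact computesWithin_comp hq hp
  | case f g ihf ihg =>
    obtain ⟨p, T, hp⟩ := ihf n
    obtain ⟨q, T', hq⟩ := ihg n
    rw [Turing.ToPartrec.Code.case_eval]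
    exact computesWithin_case hp hq
  | fix f ih =>
    obtain ⟨p, T, hp⟩ := ih (n + 1)
    rw [Turing.ToPartrec.Code.fix_eval]
    exact computesWithin_fix hp

/-- Every computable function is computed by a program whose running time is computable. -/
theorem exists_prog_of_computable {g : ℕ → ℕ} (hg : Computable g) (n : ℕ) :
    ∃ (p : Prog) (T : ℕ → ℕ), Computable T ∧ ∀ k, RunsAt p n (enc k) (enc (g k)) (T k) := by
  obtain ⟨c, hc⟩ := Turing.ToPartrec.Code.exists_code (Nat.Partrec'.part_iff₁.2 hg.partrec)
  obtain ⟨p, T, hT, hp⟩ := exists_computesWithin c n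
  have hc' : ∀ k, [g k] ∈ c.eval [k] := fun k => by
    have := hc (k ::ᵥ List.Vector.nil)
    simp only [List.Vector.cons_val, List.Vector.head_cons] at this
    have h : c.eval [k] = pure <$> (g : ℕ →. ℕ) k := this
    rw [h]
    exact (Part.mem_map_iff _).2 ⟨g k, Part.mem_some _, rfl⟩
  obtain ⟨q, b, ⟨d, hb⟩, hq⟩ := (PTime.list_cons (γ := ℕ) .id (.const [])).2 n
  obtain ⟨q', b', ⟨d', hb'⟩, hq'⟩ := ptime_headI.2 n
  choose t ht hr using fun k => hp [k] [g k] (hc' k)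
  have ht' : Computable t := by
    have h1 : Partrec fun k => (T [k]).map Prod.snd :=
      Partrec.map (hT.comp (Computable.list_cons.comp .id (.const []))) (Computable.snd.comp .snd)
    exact h1.of_eq_tot fun k => (Part.mem_map_iff _).2 ⟨_, ht k, rfl⟩
  refine ⟨.seq q (.seq p q'), fun k => (k + 2) ^ d + (t k + (g k + 3) ^ d'), ?_, fun k => ?_⟩
  · have A := Primrec.nat_add.to_comp
    exact A.comp ((computable_pow_const d).comp (A.comp .id (.const 2)))
      (A.comp ht' ((computable_pow_const d').comp (A.comp hg (.const 3))))
  · refine ((hq k).seq ((hr k).seq (hq' [g k]))).mono ?_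
    have h1 := hb k
    have h2 := hb' [g k]
    simp only [esize_nat, esize_cons, esize_nil] at h1 h2
    have : g k + 0 + 1 + 2 = g k + 3 := by omega
    rw [this] at h2
    exact Nat.add_le_add h1 (Nat.add_le_add_left h2 _)

/-! ### Composition of parameterized transformations -/

/-- An assignment pays for the size of the tree it writes. This bounds the output of the first stage
of a composition, the input of the second. -/
theorem Exec.size_le {p : Prog} {σ σ' : Store} {t : ℕ} (h : Exec p σ σ' t) (r : ℕ) :
    (σ' r).size ≤ (σ r).size + t := by
  induction h with
  | setNil x σ | copy x y σ | cons x y z σ | hd x y σ | tl x y σ =>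
    by_cases hr : r = x
    · subst hr; simp [Data.size]; try omega
    · rw [Function.update_of_ne hr]; omega
  | seq _ _ ih ih' => omega
  | ifNil_nil _ _ ih | ifNil_cons _ _ ih => omega
  | while_nil => omega
  | while_cons _ _ _ ih ih' => omega

/-- Computable functions need not be monotone; summing over all arguments up to a bound yields a
computable majorant of the value at any of them. -/
theorem computable_sum_range {f : ℕ → ℕ} (hf : Computable f) :
    Computable fun n => ∑ i ∈ Finset.range n, f i := by
  have h : Computable fun n : ℕ =>
      (Nat.rec 0 (fun y s => s + f y) n : ℕ) :=
    Computable.nat_rec (f := fun n : ℕ => n) (g := fun _ => 0) (h := fun _ q => q.2 + f q.1) .id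
      (.const 0) (Primrec.nat_add.to_comp.comp (Computable.snd.comp .snd)
        (hf.comp (Computable.fst.comp .snd)))
  refine h.of_eq fun n => ?_
  induction n with
  | zero => rfl
  | succ n ih => rw [Finset.sum_range_succ, ← ih]

/-- The trivial first stage, which lets `FPTTransforms.comp_ptime` handle a direct polynomial-time
reduction. -/
theorem fptTransforms_eq : FPTTransforms fun I J => I = J := by
  refine ⟨.copy 0 0, 1, fun k => k + 2, fun k => k, ?_, .id, fun x k =>
    ⟨x, k, _, ⟨_, .copy 0 0 _, by simp⟩, ?_, le_rfl, rfl⟩⟩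
  · exact Primrec.nat_add.to_comp.comp .id (.const 2)
  · have : (Inst.code (x, k)).size = x.size + k + 1 := by
      simp [Inst.code, Data.size, Data.size_ofNat]
    simp only [Function.update_self, this]
    nlinarith

/-- A parameterized transformation may be followed by a polynomial-time function that, in addition
to the instance, obtains the value of some computable function at the parameter. -/
theorem FPTTransforms.comp_ptime {R : Inst → Inst → Prop} (hR : FPTTransforms R) {G κ : ℕ → ℕ}
    (hG : Computable G) (hκ : Computable κ) {F : Inst × ℕ → Inst} (hF : PTime F)
    (hk : ∀ I a, (F (I, a)).2 ≤ κ I.2) :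
    FPTTransforms fun I J => ∃ I', R I I' ∧ J = F (I', G I'.2) := by
  obtain ⟨p, c, f, h, hf, hh, hp⟩ := hR
  obtain ⟨q, T, hT, hq⟩ := exists_prog_of_computable hG 1
  obtain ⟨r, b, ⟨d, hb⟩, hr⟩ := hF.2 0
  -- The intermediate parameter is known only to be at most `h k`, hence the sums.
  let m : ℕ → ℕ := fun k => ∑ j ∈ Finset.range (h k + 1), (T j + G j)
  let κ' : ℕ → ℕ := fun k => ∑ j ∈ Finset.range (h k + 1), κ j
  have A := Primrec.nat_add.to_comp
  have M := Primrec.nat_mul.to_comp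
  have hm : Computable m := (computable_sum_range (A.comp hT hG)).comp (A.comp hh (.const 1))
  have hκ' : Computable κ' := (computable_sum_range hκ).comp (A.comp hh (.const 1))
  let W : ℕ → ℕ := fun k => f k + k + h k + m k + 1
  have hW : Computable W :=
    A.comp (A.comp (A.comp (A.comp hf .id) hh) hm) (.const 1)
  refine ⟨.seq p (.seq (.seq (.copy 1 0) (.seq (.tl 1 1) (.seq q (.cons 0 0 1)))) r),
    (c + 1) * (d + 1), fun k => 2 * (40 * W k) ^ (d + 1), κ',
    M.comp (.const 2) ((computable_pow_const (d + 1)).comp (M.comp (.const 40) hW)), hκ',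
    fun x k => ?_⟩
  obtain ⟨x', k', t, ⟨σ, e, hσ⟩, ht, hk', hR'⟩ := hp x k
  have hs := e.size_le 0
  have mid : RunsAt (.seq (.copy 1 0) (.seq (.tl 1 1) (.seq q (.cons 0 0 1)))) 0 (enc (x', k'))
      (enc ((x', k'), G k')) (4 * esize (x', k') + T k' + G k' + 10) := by
    intro σ hσ
    set σ₁ := Function.update σ 1 (σ 0) with hσ₁
    set σ₂ := Function.update σ₁ 1 (σ₁ 1).tl with hσ₂
    have v₁ : σ₁ 1 = enc (x', k') := by rw [hσ₁, Function.update_self, hσ]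
    have v₂ : σ₂ 1 = enc k' := by rw [hσ₂, Function.update_self, v₁]; rfl
    obtain ⟨σ₃, t₃, ht₃, e₃, h₃, k₃⟩ := hq k' σ₂ v₂
    have v₃ : σ₃ 0 = enc (x', k') := by
      rw [k₃ 0 (by omega), hσ₂, update_lt _ _ (by omega), hσ₁, update_lt _ _ (by omega), hσ]
    refine ⟨_, _, ?_, (Exec.copy _ _ _).seq ((Exec.tl _ _ _).seq (e₃.seq (.cons _ _ _ _))),
      by simp [v₃, h₃], by simp⟩
    have h0 := Data.tl_size_le (enc (x', k'))
    have h1 : (enc (G k')).size = G k' := esize_nat _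
    rw [← hσ₁, v₁, v₃, h₃, hσ, Data.size, h1]
    simp only [esize] at *
    omega
  obtain ⟨σ', t', ht', e', h', -⟩ := (mid.seq (hr ((x', k'), G k'))) σ hσ
  refine ⟨(F ((x', k'), G k')).1, (F ((x', k'), G k')).2, _, ⟨σ', e.seq e', h'⟩, ?_, ?_,
    ⟨_, hR', rfl⟩⟩
  · have hb' := hb ((x', k'), G k')
    have hm' : T k' + G k' ≤ m k :=
      Finset.single_le_sum (f := fun j => T j + G j) (fun _ _ => Nat.zero_le _)
        (Finset.mem_range.2 (by omega))
    have sx : esize (x', k') ≤ x.size + k + 1 + t := by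
      have : (Function.update (fun _ => Data.nil) 0 (Inst.code (x, k)) 0 : Data).size =
          x.size + k + 1 := by simp [Inst.code, Data.size, Data.size_ofNat]
      rw [this, hσ] at hs
      exact hs
    set Y := (x.size + 1) ^ (c + 1) with hY
    have hY1 : x.size + 1 ≤ Y := Nat.le_self_pow (by omega) _
    have hY2 : (x.size + 1) ^ c ≤ Y := Nat.pow_le_pow_right (by omega) (by omega)
    have hWY : W k * Y = f k * Y + k * Y + h k * Y + m k * Y + Y := by
      simp only [W]; ring
    have ht2 : t ≤ f k * Y := ht.trans (Nat.mul_le_mul_left _ hY2)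
    have l1 : k ≤ k * Y := Nat.le_mul_of_pos_right _ (by omega)
    have l2 : h k ≤ h k * Y := Nat.le_mul_of_pos_right _ (by omega)
    have l3 : m k ≤ m k * Y := Nat.le_mul_of_pos_right _ (by omega)
    -- All costs before the final program, and the size of its input plus two, are at most `Z`. The
    -- total time is thus at most `Z + Z ^ d`, hence at most `2 * Z ^ (d + 1)`, which separates into
    -- a factor in `k` and a power of the input size.
    set Z := 40 * W k * Y with hZ
    have hZ' : Z = 40 * (W k * Y) := by rw [hZ, mul_assoc]
    have b1 : b ((x', k'), G k') ≤ Z ^ d := by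
      refine hb'.trans (Nat.pow_le_pow_left ?_ d)
      rw [esize_pair, esize_nat]
      dsimp only
      omega
    have hZ1 : 1 ≤ Z := by omega
    have b2 : Z ^ d ≤ Z ^ (d + 1) := Nat.pow_le_pow_right hZ1 (by omega)
    have b3 : Z ≤ Z ^ (d + 1) := Nat.le_self_pow (by omega) _
    have b4 : t + (4 * esize (x', k') + T k' + G k' + 10) ≤ Z := by omega
    have b5 : 2 * (40 * W k) ^ (d + 1) * (x.size + 1) ^ ((c + 1) * (d + 1)) = 2 * Z ^ (d + 1) := by
      rw [hZ, hY, mul_assoc, pow_mul, ← mul_pow]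
    change _ ≤ 2 * (40 * W k) ^ (d + 1) * (x.size + 1) ^ ((c + 1) * (d + 1))
    rw [b5]
    omega
  · exact (hk _ _).trans (Finset.single_le_sum (f := κ) (fun _ _ => Nat.zero_le _)
      (Finset.mem_range.2 (by omega)))

/-! ### The graph of a family of colorings -/

/-- Stating degrees through `ncard` removes the dependence on the `LocallyFinite` instance and on
the subtype. -/
theorem SimpleGraph.induce_isRegularOfDegree_iff {V : Type*} [Finite V] (G : SimpleGraph V)
    (s : Set V) {i : (G.induce s).LocallyFinite} (d : ℕ) :
    (G.induce s).IsRegularOfDegree d ↔ ∀ v ∈ s, {w | w ∈ s ∧ G.Adj v w}.ncard = d := by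
  have h : ∀ v : s, (G.induce s).degree v = {w | w ∈ s ∧ G.Adj v w}.ncard := by
    intro v
    rw [← SimpleGraph.card_neighborSet_eq_degree, ← Nat.card_eq_fintype_card,
      Nat.card_coe_set_eq,
      ← Set.ncard_image_of_injective _ (Subtype.val_injective : Function.Injective ((↑) : s → V))]
    congr 1
    ext w
    simp [SimpleGraph.mem_neighborSet, and_comm]
  simp [SimpleGraph.IsRegularOfDegree, h]

/-- Adjacency of the `i`-th vertex of one side and the `j`-th vertex of the other side of a block:
vertex `0` has `q + 1` neighbors, all other vertices have as many as there are vertices `≠ 0`. -/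
def BlockAdj (q i j : ℕ) : Prop :=
  (i = 0 ∧ j ≤ q) ∨ (j = 0 ∧ i ≤ q) ∨ (i ≠ 0 ∧ j ≠ 0 ∧ ¬ (i = j ∧ i ≤ q))

theorem BlockAdj.symm {q i j : ℕ} (h : BlockAdj q i j) : BlockAdj q j i := by
  unfold BlockAdj at *; omega

theorem ncard_blockAdj_zero {q r : ℕ} (h : q ≤ r) :
    {j : Fin (r + 1) | BlockAdj q 0 j}.ncard = q + 1 := by
  have : {j : Fin (r + 1) | BlockAdj q 0 j} = Set.Iic (⟨q, by omega⟩ : Fin (r + 1)) := by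
    ext j
    change BlockAdj q 0 j ↔ (j : ℕ) ≤ q
    unfold BlockAdj; omega
  rw [this, Set.ncard_eq_toFinset_card']
  simp

/-- Exactly one vertex of the other side is missing: the partner `i` if `i` was joined to vertex
`0`, and vertex `0` otherwise. -/
theorem ncard_blockAdj_of_ne {q r : ℕ} {i : Fin (r + 1)} (hi : i ≠ 0) :
    {j : Fin (r + 1) | BlockAdj q i j}.ncard = r := by
  have hi' : (i : ℕ) ≠ 0 := fun h => hi (Fin.ext h)
  have : {j : Fin (r + 1) | BlockAdj q i j} = {if (i : ℕ) ≤ q then i else 0}ᶜ := by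
    ext j
    change BlockAdj q i j ↔ ¬ j = if (i : ℕ) ≤ q then i else 0
    rw [Fin.ext_iff, BlockAdj]
    split_ifs
    · omega
    · rw [Fin.val_zero]; omega
  rw [this, Set.ncard_compl]
  simp

namespace ColoringGraph
variable {U P N L r : ℕ}

/-- Elements, and two-sided blocks: one for every coloring, color, and index below `L`. -/
abbrev Vertex (U P N L r : ℕ) : Type :=
  Fin U ⊕ Fin P × Fin N × Fin L × Fin 2 × Fin (r + 1)

/-- The number of elements of a color. -/
noncomputable def classSize (χ : Fin U → Fin P → Fin N) (p : Fin P) (b : Fin N) : ℕ :=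
  {u | χ u p = b}.ncard

theorem classSize_le (χ : Fin U → Fin P → Fin N) (p : Fin P) (b : Fin N) :
    classSize χ p b ≤ U :=
  (Set.ncard_le_card _).trans_eq (by simp)

/-- An element is joined to the first vertices of the blocks of its colors. -/
def Rel (r : ℕ) (χ : Fin U → Fin P → Fin N) : Vertex U P N L r → Vertex U P N L r → Prop
  | .inl u, .inr (p, b, _, _, i) => χ u p = b ∧ i = 0
  | .inr (p, b, l, s, i), .inr (p', b', l', s', j) =>
    p = p' ∧ b = b' ∧ l = l' ∧ s = 0 ∧ s' = 1 ∧ BlockAdj (r - classSize χ p b) i j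
  | _, _ => False

/-- The graph of a family of colorings. -/
def graph (L r : ℕ) (χ : Fin U → Fin P → Fin N) : SimpleGraph (Vertex U P N L r) :=
  SimpleGraph.fromRel (Rel r χ)

theorem adj_inl_iff (χ : Fin U → Fin P → Fin N) (u : Fin U) (w : Vertex U P N L r) :
    (graph L r χ).Adj (.inl u) w ↔ ∃ p l s, w = .inr (p, χ u p, l, s, 0) := by
  rcases w with u' | ⟨p, b, l, s, i⟩
  · simp [graph, Rel]
  · simp only [graph, SimpleGraph.fromRel_adj, Rel, ne_eq, reduceCtorEq, not_false_eq_true,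
      or_false, true_and, Sum.inr.injEq, Prod.mk.injEq]
    constructor
    · rintro ⟨rfl, rfl⟩; exact ⟨p, l, s, rfl, rfl, rfl, rfl, rfl⟩
    · rintro ⟨p', l', s', rfl, rfl, rfl, rfl, rfl⟩; exact ⟨rfl, rfl⟩

theorem adj_inr_iff (χ : Fin U → Fin P → Fin N) (p : Fin P) (b : Fin N) (l : Fin L) (s : Fin 2)
    (i : Fin (r + 1)) (w : Vertex U P N L r) :
    (graph L r χ).Adj (.inr (p, b, l, s, i)) w ↔ (∃ u, w = .inl u ∧ χ u p = b ∧ i = 0) ∨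
      ∃ j, w = .inr (p, b, l, s.rev, j) ∧ BlockAdj (r - classSize χ p b) i j := by
  rcases w with u | ⟨p', b', l', s', j⟩
  · simp [graph, Rel]
  · simp only [graph, SimpleGraph.fromRel_adj, Rel, ne_eq, reduceCtorEq, false_and, exists_false,
      false_or, Sum.inr.injEq, Prod.mk.injEq]
    constructor
    · rintro ⟨-, ⟨rfl, rfl, rfl, rfl, rfl, h⟩ | ⟨rfl, rfl, rfl, rfl, rfl, h⟩⟩
      · exact ⟨j, ⟨rfl, rfl, rfl, rfl, rfl⟩, h⟩
      · exact ⟨j, ⟨rfl, rfl, rfl, rfl, rfl⟩, h.symm⟩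
    · rintro ⟨j', ⟨rfl, rfl, rfl, rfl, rfl⟩, h⟩
      obtain rfl | rfl : s = 0 ∨ s = 1 := by omega
      · exact ⟨by simp, .inl ⟨rfl, rfl, rfl, rfl, rfl, h⟩⟩
      · exact ⟨by simp, .inr ⟨rfl, rfl, rfl, rfl, rfl, h.symm⟩⟩

theorem ncard_adj_inl (χ : Fin U → Fin P → Fin N) (u : Fin U) (T : Set (Vertex U P N L r))
    (hT : ∀ x, .inr x ∉ T) : {w | w ∈ Tᶜ ∧ (graph L r χ).Adj (.inl u) w}.ncard = 2 * P * L := by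
  have : {w | w ∈ Tᶜ ∧ (graph L r χ).Adj (.inl u) w} =
      Set.range fun x : Fin P × Fin L × Fin 2 =>
        (.inr (x.1, χ u x.1, x.2.1, x.2.2, 0) : Vertex U P N L r) := by
    ext w
    simp only [adj_inl_iff, Set.mem_ofPred_eq, Set.mem_range, Prod.exists, Set.mem_compl_iff]
    constructor
    · rintro ⟨-, p, l, s, rfl⟩; exact ⟨p, l, s, rfl⟩
    · rintro ⟨p, l, s, rfl⟩; exact ⟨hT _, p, l, s, rfl⟩
  rw [this, ← Set.image_univ, Set.ncard_image_of_injective, Set.ncard_univ]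
  · simp; ring
  · rintro ⟨p, l, s⟩ ⟨p', l', s'⟩ h
    simp at h ⊢; tauto

/-- In a block that `T` does not touch, a vertex can lose only elements as neighbors, and only if it
is the first vertex of its side. -/
theorem ncard_adj_inr (χ : Fin U → Fin P → Fin N) (p : Fin P) (b : Fin N) (l : Fin L) (s : Fin 2)
    (i : Fin (r + 1)) (T : Set (Vertex U P N L r)) (hT : ∀ s i, .inr (p, b, l, s, i) ∉ T) :
    {w | w ∈ Tᶜ ∧ (graph L r χ).Adj (.inr (p, b, l, s, i)) w}.ncard =
      {u | χ u p = b ∧ i = 0 ∧ Sum.inl u ∉ T}.ncard +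
        {j : Fin (r + 1) | BlockAdj (r - classSize χ p b) i j}.ncard := by
  have : {w | w ∈ Tᶜ ∧ (graph L r χ).Adj (.inr (p, b, l, s, i)) w} =
      (fun u => (.inl u : Vertex U P N L r)) '' {u | χ u p = b ∧ i = 0 ∧ Sum.inl u ∉ T} ∪
      (fun j => (.inr (p, b, l, s.rev, j) : Vertex U P N L r)) ''
        {j : Fin (r + 1) | BlockAdj (r - classSize χ p b) i j} := by
    ext w
    simp only [adj_inr_iff, Set.mem_ofPred_eq, Set.mem_union, Set.mem_image, Set.mem_compl_iff]
    constructor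
    · rintro ⟨hw, ⟨u, rfl, h, h'⟩ | ⟨j, rfl, h⟩⟩
      · exact .inl ⟨u, ⟨h, h', hw⟩, rfl⟩
      · exact .inr ⟨j, h, rfl⟩
    · rintro (⟨u, ⟨h, h', hw⟩, rfl⟩ | ⟨j, h, rfl⟩)
      · exact ⟨hw, .inl ⟨u, rfl, h, h'⟩⟩
      · exact ⟨hT _ _, .inr ⟨j, rfl, h⟩⟩
  rw [this, Set.ncard_union_eq, Set.ncard_image_of_injective, Set.ncard_image_of_injective]
  · intro j j' h; simpa using h
  · intro u u' h; simpa using h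
  · rw [Set.disjoint_left]; rintro _ ⟨u, -, rfl⟩ ⟨j, -, h⟩; simp at h

theorem ncard_class (χ : Fin U → Fin P → Fin N) (p : Fin P) (b : Fin N) (T : Set (Fin U)) :
    {u | χ u p = b ∧ u ∉ T}.ncard + {u | χ u p = b ∧ u ∈ T}.ncard = classSize χ p b := by
  rw [classSize, ← Set.ncard_union_eq]
  · congr 1; ext u; simp only [Set.mem_union, Set.mem_ofPred_eq]; tauto
  · rw [Set.disjoint_left]; rintro u ⟨-, h⟩ ⟨-, h'⟩; exact h h'

theorem ncard_eq_one_iff (χ : Fin U → Fin P → Fin N) (p : Fin P) (b : Fin N) (T : Set (Fin U)) :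
    {u | χ u p = b ∧ u ∈ T}.ncard = 1 ↔ ∃! u, u ∈ T ∧ χ u p = b := by
  rw [Set.ncard_eq_one]
  constructor
  · rintro ⟨a, ha⟩
    simp only [Set.ext_iff, Set.mem_ofPred_eq, Set.mem_singleton_iff] at ha
    exact ⟨a, ((ha a).2 rfl).symm, fun y hy => (ha y).1 hy.symm⟩
  · rintro ⟨a, ha, h⟩
    refine ⟨a, Set.ext fun u => ⟨fun hu => h u hu.symm, ?_⟩⟩
    rintro rfl; exact ha.symm

/-- Deleting a set of elements that has exactly one element of every color of every coloring
leaves a regular graph. -/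
theorem regular_of_transversal (χ : Fin U → Fin P → Fin N) (hL : U ≤ L) (S : Set (Fin U))
    (hS : ∀ p b, ∃! u, u ∈ S ∧ χ u p = b) :
    ∀ v ∈ (Sum.inl '' S : Set (Vertex U P N L (2 * P * L)))ᶜ,
      {w | w ∈ (Sum.inl '' S : Set (Vertex U P N L (2 * P * L)))ᶜ ∧
        (graph L (2 * P * L) χ).Adj v w}.ncard = 2 * P * L := by
  rintro (u | ⟨p, b, l, s, i⟩) -
  · exact ncard_adj_inl χ u _ (by simp)
  · rw [ncard_adj_inr χ p b l s i _ (by simp)]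
    have hU := classSize_le χ p b
    -- Together with `U ≤ L` this makes `r - classSize` a true difference. The first vertex then
    -- keeps `classSize - 1` elements and `r - classSize + 1` block neighbors.
    have hr : L ≤ 2 * P * L := Nat.le_mul_of_pos_left _ (by have := p.pos; omega)
    by_cases hi : i = 0
    · subst hi
      have h1 := ncard_class χ p b S
      rw [(ncard_eq_one_iff χ p b S).2 (hS p b)] at h1
      have h2 := ncard_blockAdj_zero (Nat.sub_le (2 * P * L) (classSize χ p b))
      simp only [true_and, Set.mem_image, Sum.inl.injEq, exists_eq_right, Fin.val_zero]
      rw [h2]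
      omega
    · rw [ncard_blockAdj_of_ne hi]
      simp [hi]

/-- If the deletion of few vertices leaves a regular graph, then the deleted elements have exactly
one element of every color of every coloring. -/
theorem transversal_of_regular (χ : Fin U → Fin P → Fin N) (hL : U ≤ L)
    (T : Set (Vertex U P N L (2 * P * L))) (hT : T.ncard < L)
    (h : ∀ v ∈ Tᶜ, {w | w ∈ Tᶜ ∧ (graph L (2 * P * L) χ).Adj v w}.ncard = 2 * P * L)
    (p : Fin P) (b : Fin N) : ∃! u, Sum.inl u ∈ T ∧ χ u p = b := by
  -- Pigeonhole: the `L` copies of the block are disjoint, and fewer than `L` vertices are deleted.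
  obtain ⟨l, hl⟩ : ∃ l : Fin L, ∀ s i, .inr (p, b, l, s, i) ∉ T := by
    by_contra! hc
    choose s i hsi using hc
    have h1 := Set.ncard_le_ncard (s := Set.range fun l : Fin L =>
      (.inr (p, b, l, s l, i l) : Vertex U P N L (2 * P * L))) (t := T)
      (by rintro _ ⟨l, rfl⟩; exact hsi l)
    rw [← Set.image_univ, Set.ncard_image_of_injective _ (fun l l' h => by simp at h; tauto),
      Set.ncard_univ] at h1
    simp at h1; omega
  have h2 := h _ (hl 0 0)
  have hU := classSize_le χ p b
  have hr : L ≤ 2 * P * L := Nat.le_mul_of_pos_left _ (by have := p.pos; omega)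
  rw [ncard_adj_inr χ p b l 0 0 T hl, Fin.val_zero,
    ncard_blockAdj_zero (Nat.sub_le (2 * P * L) (classSize χ p b))] at h2
  have h3 := ncard_class χ p b {u | Sum.inl u ∈ T}
  simp only [true_and] at h2
  refine (ncard_eq_one_iff χ p b {u | Sum.inl u ∈ T}).1 ?_
  simp only [Set.mem_ofPred_eq] at h3 ⊢
  omega

end ColoringGraph

/-! ### The coded instance of a family of colorings -/

@[simp] theorem toNat_enc (n : ℕ) : (enc n).toNat = n := by
  induction n with
  | zero => rfl
  | succ n ih => simp [Data.toNat, ih]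

@[simp] theorem toList_enc {α : Type} [Enc α] (l : List α) : (enc l).toList = l.map enc := by
  induction l with
  | nil => rfl
  | cons a l ih => simp [Data.toList, ih]

/-- Since `g` need not dominate the identity, `M` has to bound both the parameter, for the answer NO
to be correct, and its image under `g`, for all other answers to be wrong. -/
theorem gapCorrect_of {A : ParamProblem} {P : MinProblem} {g : ℕ → ℕ} {I J : Inst} (M : ℕ)
    (h₁ : J.2 ≤ M) (h₂ : g J.2 ≤ M) (yes : I ∈ A → ∃ S, P.IsSol J.1 S ∧ P.cost J.1 S ≤ J.2)
    (no : I ∉ A → ∀ S, P.IsSol J.1 S → M < P.cost J.1 S) : GapCorrect A P g I J := by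
  refine ⟨fun hI a ha => ?_, fun hI a => ?_⟩
  · rintro rfl
    exact ha (yes hI)
  · rcases a with _ | S
    · simp only [MinProblem.ApproxAnswer, iff_true]
      rintro ⟨S, hS, hc⟩
      have := no hI S hS
      omega
    · simp only [MinProblem.ApproxAnswer, reduceCtorEq, iff_false]
      rintro ⟨hS, hc⟩
      have := no hI S hS
      omega

theorem isSol_iff (x : Data) (S : Finset (Fin x.hd.toNat)) :
    VertexDeletionToRegular.IsSol x S ↔ ∀ v ∉ S, {w | w ∉ S ∧
      (graphOfEdges x.hd.toNat x.tl.tl.toList).Adj v w}.ncard = x.tl.hd.toNat := by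
  unfold VertexDeletionToRegular
  exact SimpleGraph.induce_isRegularOfDegree_iff _ {v | v ∉ S} _

/-- An instance without solutions of cost at most `M`. -/
def edgelessInst (M : ℕ) : Data := enc (M + 1, 1, ([] : List ℕ))

theorem edgelessInst_no {M : ℕ} (S : Finset (Fin (edgelessInst M).hd.toNat))
    (h : VertexDeletionToRegular.IsSol (edgelessInst M) S) : M < S.card := by
  rw [isSol_iff] at h
  by_contra! hc
  have hn : (edgelessInst M).hd.toNat = M + 1 := toNat_enc (M + 1)
  obtain ⟨v, hv⟩ : ∃ v, v ∉ S := by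
    by_contra! hall
    have := Finset.card_le_card (fun v _ => hall v : Finset.univ ⊆ S)
    simp only [Finset.card_univ, Fintype.card_fin] at this
    omega
  have h1 := h v hv
  have h2 : (edgelessInst M).tl.hd.toNat = 1 := rfl
  have h3 : (edgelessInst M).tl.tl.toList = [] := rfl
  rw [h2, h3] at h1
  simp [graphOfEdges] at h1

namespace ColoringGraph

/-- The degree of the regular graph that remains. -/
def degreeOf (rows : List (List ℕ)) (P M : ℕ) : ℕ := 2 * P * (M + rows.length + 1)

/-- The number of a vertex in a block. -/
def blockCode (U N L r p b l s i : ℕ) : ℕ :=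
  U + ((((i + (r + 1) * s) + 2 * (r + 1) * l) + L * (2 * (r + 1)) * b) +
    N * (L * (2 * (r + 1))) * p)

/-- The edges between elements and blocks. -/
def elementEdges (rows : List (List ℕ)) (P N M : ℕ) : List (ℕ × ℕ) :=
  (List.range rows.length).flatMap fun u => (List.range P).flatMap fun p =>
    (List.range (M + rows.length + 1)).flatMap fun l => (List.range 2).map fun s =>
      (u, blockCode rows.length N (M + rows.length + 1) (degreeOf rows P M) p
        ((rows.getD u []).getD p 0) l s 0)

def blockAdj (q i j : ℕ) : Bool :=
  (decide (i = 0) && decide (j ≤ q)) || ((decide (j = 0) && decide (i ≤ q)) ||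
    (!decide (i = 0) && (!decide (j = 0) && !(decide (i = j) && decide (i ≤ q)))))

/-- The number of neighbors of the first vertex of a block among the other vertices of its side
of the block. -/
def fillCount (rows : List (List ℕ)) (P M p b : ℕ) : ℕ :=
  degreeOf rows P M - (rows.filter fun row => decide (row.getD p 0 = b)).length

/-- The edges in the blocks. -/
def blockEdges (rows : List (List ℕ)) (P N M : ℕ) : List (ℕ × ℕ) :=
  (List.range P).flatMap fun p => (List.range N).flatMap fun b =>
    (List.range (M + rows.length + 1)).flatMap fun l =>
      (List.range (degreeOf rows P M + 1)).flatMap fun i =>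
        ((List.range (degreeOf rows P M + 1)).filter fun j =>
          blockAdj (fillCount rows P M p b) i j).map fun j =>
            (blockCode rows.length N (M + rows.length + 1) (degreeOf rows P M) p b l 0 i,
              blockCode rows.length N (M + rows.length + 1) (degreeOf rows P M) p b l 1 j)

def vertexCount (rows : List (List ℕ)) (P N M : ℕ) : ℕ :=
  rows.length + P * (N * ((M + rows.length + 1) * (2 * (degreeOf rows P M + 1))))

/-- The instance of Vertex Deletion to Regular Subgraph for a family of colorings: row `u` lists
the colors of element `u`. -/
def inst (rows : List (List ℕ)) (P N M : ℕ) : Data :=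
  enc (vertexCount rows P N M, degreeOf rows P M, elementEdges rows P N M ++ blockEdges rows P N M)

section PTime
variable {γ : Type} [Enc γ] {rows : γ → List (List ℕ)} {P N M : γ → ℕ}

@[fun_prop]
theorem ptime_degreeOf (hr : PTime rows) (hP : PTime P) (hM : PTime M) :
    PTime fun x => degreeOf (rows x) (P x) (M x) := by
  unfold degreeOf; fun_prop

@[fun_prop]
theorem ptime_blockCode {U L r p b l s i : γ → ℕ} (hU : PTime U) (hN : PTime N) (hL : PTime L)
    (hr : PTime r) (hp : PTime p) (hb : PTime b) (hl : PTime l) (hs : PTime s) (hi : PTime i) :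
    PTime fun x => blockCode (U x) (N x) (L x) (r x) (p x) (b x) (l x) (s x) (i x) := by
  unfold blockCode; fun_prop

@[fun_prop]
theorem ptime_blockAdj {q i j : γ → ℕ} (hq : PTime q) (hi : PTime i) (hj : PTime j) :
    PTime fun x => blockAdj (q x) (i x) (j x) := by
  unfold blockAdj; fun_prop

@[fun_prop]
theorem ptime_fillCount {p b : γ → ℕ} (hr : PTime rows) (hP : PTime P) (hM : PTime M)
    (hp : PTime p) (hb : PTime b) : PTime fun x => fillCount (rows x) (P x) (M x) (p x) (b x) := by
  unfold fillCount; fun_prop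

theorem ptime_elementEdges (hr : PTime rows) (hP : PTime P) (hN : PTime N) (hM : PTime M) :
    PTime fun x => elementEdges (rows x) (P x) (N x) (M x) := by
  unfold elementEdges; fun_prop

theorem ptime_blockEdges (hr : PTime rows) (hP : PTime P) (hN : PTime N) (hM : PTime M) :
    PTime fun x => blockEdges (rows x) (P x) (N x) (M x) := by
  unfold blockEdges; fun_prop

@[fun_prop]
theorem ptime_inst (hr : PTime rows) (hP : PTime P) (hN : PTime N) (hM : PTime M) :
    PTime fun x => inst (rows x) (P x) (N x) (M x) := by
  have h₁ := ptime_elementEdges hr hP hN hM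
  have h₂ := ptime_blockEdges hr hP hN hM
  unfold inst vertexCount
  refine PTime.encode.comp (.pair ?_ (.pair ?_ (.list_append h₁ h₂))) <;> fun_prop

end PTime

theorem blockAdj_eq_true {q i j : ℕ} : blockAdj q i j = true ↔ BlockAdj q i j := by
  simp only [blockAdj, BlockAdj, Bool.or_eq_true, Bool.and_eq_true, decide_eq_true_eq,
    Bool.not_eq_true', decide_eq_false_iff_not, Bool.and_eq_false_iff, not_and_or]

end ColoringGraph

/-- There is a set of rows that contains, for every column below `P` and every color below `N`,
exactly one row with this color in this column. -/
def HasTransversal (rows : List (List ℕ)) (P N : ℕ) : Prop :=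
  ∃ S : Set (Fin rows.length), ∀ p < P, ∀ b < N, ∃! u, u ∈ S ∧ rows[u].getD p 0 = b

/-! ### Correctness of the coded instance -/

namespace ColoringGraph

/-- The numbering of the vertices. -/
def vertexEquiv (U P N L r : ℕ) :
    Vertex U P N L r ≃ Fin (U + P * (N * (L * (2 * (r + 1))))) :=
  (Equiv.sumCongr (Equiv.refl _) ((Equiv.prodCongr (Equiv.refl _) ((Equiv.prodCongr (Equiv.refl _)
    ((Equiv.prodCongr (Equiv.refl _) finProdFinEquiv).trans finProdFinEquiv)).trans
      finProdFinEquiv)).trans finProdFinEquiv)).trans finSumFinEquiv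

theorem vertexEquiv_inr {U P N L r : ℕ} (p : Fin P) (b : Fin N) (l : Fin L) (s : Fin 2)
    (i : Fin (r + 1)) :
    (vertexEquiv U P N L r (.inr (p, b, l, s, i)) : ℕ) = blockCode U N L r p b l s i := by
  simp [vertexEquiv, blockCode]

variable {rows : List (List ℕ)} {P N : ℕ}

/-- The family of colorings that is given by a list of rows. -/
def coloring (h : ∀ row ∈ rows, ∀ p < P, row.getD p 0 < N) : Fin rows.length → Fin P → Fin N :=
  fun u p => ⟨rows[u].getD p 0, h _ (List.getElem_mem _) p p.2⟩

theorem fillCount_eq (h : ∀ row ∈ rows, ∀ p < P, row.getD p 0 < N) (M : ℕ) (p : Fin P)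
    (b : Fin N) :
    fillCount rows P M p b = degreeOf rows P M - classSize (coloring h) p b := by
  have h1 : ∀ (l : List (List ℕ)) (f : List ℕ → Bool),
      (l.filter f).length = {u : Fin l.length | f l[u] = true}.ncard := by
    intro l f
    conv_lhs => rw [← List.map_get_finRange l]
    rw [List.filter_map, List.length_map,
      ← List.toFinset_card_of_nodup ((List.nodup_finRange _).filter _), ← Set.ncard_coe_finset]
    congr 1
    ext u
    simp
  rw [fillCount, h1, classSize]
  congr 2
  ext u
  simp [coloring, Fin.ext_iff]

/-- The edge lists contain each edge in one direction only, the same as in `Rel`; both graphs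
symmetrize afterwards. -/
theorem rel_iff (h : ∀ row ∈ rows, ∀ p < P, row.getD p 0 < N) (M : ℕ)
    (v w : Vertex rows.length P N (M + rows.length + 1) (degreeOf rows P M)) :
    ((vertexEquiv _ _ _ _ _ v : ℕ), (vertexEquiv _ _ _ _ _ w : ℕ)) ∈
        elementEdges rows P N M ++ blockEdges rows P N M ↔
      Rel (degreeOf rows P M) (coloring h) v w := by
  have inj : ∀ {x y : Vertex rows.length P N (M + rows.length + 1)
      (degreeOf rows P M)},
      (vertexEquiv _ _ _ _ _ x : ℕ) = vertexEquiv _ _ _ _ _ y → x = y := fun hxy =>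
    (vertexEquiv _ _ _ _ _).injective (Fin.ext hxy)
  rw [List.mem_append]
  constructor
  · rintro (he | he)
    · simp only [elementEdges, List.mem_flatMap, List.mem_range, List.mem_map, Prod.mk.injEq] at he
      obtain ⟨u, hu, p, hp, l, hl, s, hs, h₁, h₂⟩ := he
      have hb : (rows.getD u []).getD p 0 < N := by
        rw [List.getD_eq_getElem _ _ hu]; exact h _ (List.getElem_mem _) p hp
      have h₁' : v = .inl ⟨u, hu⟩ := inj h₁.symm
      have h₂' : w = .inr (⟨p, hp⟩, ⟨_, hb⟩, ⟨l, hl⟩, ⟨s, hs⟩, 0) := inj (by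
        rw [vertexEquiv_inr, ← h₂]; rfl)
      rw [h₁', h₂']
      refine ⟨Fin.ext ?_, rfl⟩
      change rows[u].getD p 0 = (rows.getD u []).getD p 0
      rw [List.getD_eq_getElem _ _ hu]
    · simp only [blockEdges, List.mem_flatMap, List.mem_range, List.mem_map, Prod.mk.injEq,
        List.mem_filter, blockAdj_eq_true] at he
      obtain ⟨p, hp, b, hb, l, hl, i, hi, j, ⟨hj, hadj⟩, h₁, h₂⟩ := he
      have h₁' : v = .inr (⟨p, hp⟩, ⟨b, hb⟩, ⟨l, hl⟩, 0, ⟨i, hi⟩) := inj (by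
        rw [vertexEquiv_inr, ← h₁]; rfl)
      have h₂' : w = .inr (⟨p, hp⟩, ⟨b, hb⟩, ⟨l, hl⟩, 1, ⟨j, hj⟩) := inj (by
        rw [vertexEquiv_inr, ← h₂]; rfl)
      rw [h₁', h₂']
      refine ⟨rfl, rfl, rfl, rfl, rfl, ?_⟩
      rw [← fillCount_eq h M]; exact hadj
  · rcases v with u | ⟨p, b, l, s, i⟩ <;> rcases w with u' | ⟨p', b', l', s', j⟩
    · exact fun h => False.elim h
    · rintro ⟨rfl, rfl⟩
      left
      simp only [elementEdges, List.mem_flatMap, List.mem_range, List.mem_map, Prod.mk.injEq]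
      refine ⟨u, u.2, p', p'.2, l', l'.2, s', s'.2, rfl, ?_⟩
      rw [vertexEquiv_inr]
      simp [coloring]
    · exact fun h => False.elim h
    · rintro ⟨rfl, rfl, rfl, rfl, rfl, hadj⟩
      right
      simp only [blockEdges, List.mem_flatMap, List.mem_range, List.mem_map, Prod.mk.injEq,
        List.mem_filter, blockAdj_eq_true]
      refine ⟨p, p.2, b, b.2, l, l.2, i, i.2, j, ⟨j.2, ?_⟩, ?_, ?_⟩
      · rw [fillCount_eq h M]; exact hadj
      · rw [vertexEquiv_inr]; rfl
      · rw [vertexEquiv_inr]; rfl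

theorem adj_iff (h : ∀ row ∈ rows, ∀ p < P, row.getD p 0 < N) (M : ℕ)
    (v w : Vertex rows.length P N (M + rows.length + 1) (degreeOf rows P M)) {n : ℕ} {x y : Fin n}
    (hx : (x : ℕ) = vertexEquiv _ _ _ _ _ v) (hy : (y : ℕ) = vertexEquiv _ _ _ _ _ w) :
    (graphOfEdges n ((elementEdges rows P N M ++ blockEdges rows P N M).map enc)).Adj x y ↔
      (graph (M + rows.length + 1) (degreeOf rows P M) (coloring h)).Adj v w := by
  have key : ∀ (v w : Vertex rows.length P N (M + rows.length + 1) (degreeOf rows P M))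
      {x y : Fin n}, (x : ℕ) = vertexEquiv _ _ _ _ _ v → (y : ℕ) = vertexEquiv _ _ _ _ _ w →
      ((∃ e ∈ (elementEdges rows P N M ++ blockEdges rows P N M).map enc,
        e.hd.toNat = x ∧ e.tl.toNat = y) ↔ Rel (degreeOf rows P M) (coloring h) v w) := by
    intro v w x y hx hy
    rw [← rel_iff h M, ← hx, ← hy]
    constructor
    · rintro ⟨e, he, h₁, h₂⟩
      obtain ⟨⟨a, b⟩, hab, rfl⟩ := List.mem_map.1 he
      have h₁' : a = x := (toNat_enc a).symm.trans h₁
      have h₂' : b = y := (toNat_enc b).symm.trans h₂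
      rwa [← h₁', ← h₂']
    · exact fun he => ⟨_, List.mem_map.2 ⟨_, he, rfl⟩, toNat_enc _, toNat_enc _⟩
  unfold graphOfEdges graph
  rw [SimpleGraph.fromRel_adj, SimpleGraph.fromRel_adj]
  refine and_congr (not_congr ?_) (or_congr (key v w hx hy) (key w v hy hx))
  rw [Fin.ext_iff, hx, hy, ← Fin.ext_iff, (vertexEquiv _ _ _ _ _).injective.eq_iff]

theorem cost_eq (x : Data) (S : Finset (Fin x.hd.toNat)) :
    VertexDeletionToRegular.cost x S = S.card := rfl

/-- A list of rows yields an instance with a gap. -/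
theorem inst_gapCorrect {A : ParamProblem} {g : ℕ → ℕ} {I : Inst} {M : ℕ}
    (h : ∀ row ∈ rows, ∀ p < P, row.getD p 0 < N) (hP : 0 < P) (hM : N ≤ M) (hg : g N ≤ M)
    (hA : I ∈ A ↔ HasTransversal rows P N) :
    GapCorrect A VertexDeletionToRegular g I (inst rows P N M, N) := by
  set L := M + rows.length + 1 with hL
  set r := degreeOf rows P M with hr
  let e : Vertex rows.length P N L r ≃ Fin (inst rows P N M).hd.toNat :=
    (vertexEquiv _ _ _ _ _).trans (finCongr (toNat_enc (vertexCount rows P N M)).symm)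
  have hsol : ∀ S : Finset (Fin (inst rows P N M).hd.toNat),
      VertexDeletionToRegular.IsSol (inst rows P N M) S ↔
      ∀ v ∈ (e ⁻¹' S)ᶜ, {w | w ∈ (e ⁻¹' S)ᶜ ∧ (graph L r (coloring h)).Adj v w}.ncard = r := by
    intro S
    have h1 : (inst rows P N M).tl.hd.toNat = r := toNat_enc r
    have h2 : ∀ v w, (graphOfEdges (inst rows P N M).hd.toNat
        (inst rows P N M).tl.tl.toList).Adj (e v) (e w) ↔
        (graph L r (coloring h)).Adj v w := by
      intro v w
      have h3 : (inst rows P N M).tl.tl.toList =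
        (elementEdges rows P N M ++ blockEdges rows P N M).map enc := toList_enc _
      rw [h3]
      exact adj_iff h M v w rfl rfl
    rw [isSol_iff, h1, ← e.forall_congr_right]
    refine forall₂_congr fun v _ => ?_
    rw [← Set.ncard_image_of_injective _ e.injective]
    have : e '' {w | w ∈ (e ⁻¹' S)ᶜ ∧ (graph L r (coloring h)).Adj v w} = {w | w ∉ S ∧
      (graphOfEdges (inst rows P N M).hd.toNat
        (inst rows P N M).tl.tl.toList).Adj (e v) w} := by
      ext w
      obtain ⟨w, rfl⟩ := e.surjective w
      simp [h2]
    rw [this]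
  refine gapCorrect_of M hM hg (fun hI => ?_) fun hI => ?_
  · obtain ⟨S, hS⟩ := hA.1 hI
    have hS' : ∀ p b, ∃! u, u ∈ S ∧ coloring h u p = b := fun p b => by
      simpa [coloring, Fin.ext_iff] using hS p p.2 b b.2
    classical
    let S' : Finset (Fin rows.length) := Finset.univ.filter (· ∈ S)
    refine ⟨S'.map ((Function.Embedding.inl).trans e.toEmbedding), ?_, ?_⟩
    · rw [hsol]
      have := regular_of_transversal (coloring h) (L := L) (by omega) S hS'
      have heq : e ⁻¹' (S'.map ((Function.Embedding.inl).trans e.toEmbedding) :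
          Finset (Fin (inst rows P N M).hd.toNat)) =
          (Sum.inl '' S : Set (Vertex rows.length P N L r)) := by
        ext v
        simp [S']
      rw [heq]
      exact this
    · rw [cost_eq, Finset.card_map]
      -- A single coloring, which exists by `hP`, is injective on the transversal and so bounds its
      -- size by the number of colors.
      have := Finset.card_le_card_of_injOn (s := S') (t := (Finset.univ : Finset (Fin N)))
        (fun u => coloring h u ⟨0, hP⟩) (by simp) fun u hu u' hu' heq => by
          simp only [S', Finset.coe_filter, Finset.mem_univ, true_and] at hu hu'
          exact (hS' ⟨0, hP⟩ _).unique ⟨hu, rfl⟩ ⟨hu', heq.symm⟩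
      simpa using this
  · intro (S : Finset (Fin (inst rows P N M).hd.toNat)) hS
    rw [cost_eq]
    by_contra! hc
    refine hI (hA.2 ⟨{u | e (.inl u) ∈ S}, fun p hp b hb => ?_⟩)
    have hcard : (e ⁻¹' S : Set (Vertex rows.length P N L r)).ncard < L := by
      rw [Set.ncard_preimage_of_injective_subset_range e.injective (by simp)]
      have : Set.ncard (S : Set (Fin (inst rows P N M).hd.toNat)) ≤ M := by
        rw [Set.ncard_coe_finset]; exact hc
      omega
    have := transversal_of_regular (coloring h) (L := L) (by omega) (e ⁻¹' S) hcard
      ((hsol S).1 hS) ⟨p, hp⟩ ⟨b, hb⟩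
    exact (existsUnique_congr fun u => and_congr Iff.rfl Fin.ext_iff).1 this

end ColoringGraph

/-! ### Constraint satisfaction problems -/

namespace Csp

/-- Satisfiability of a constraint satisfaction problem: variable `i` gets a value from the list
`doms[i]`, and a constraint consists of a list of variables and the list of the allowed tuples. -/
def Sat (doms : List (List ℕ)) (cons : List (List ℕ × List (List ℕ))) : Prop :=
  ∃ σ : ℕ → ℕ, (∀ i < doms.length, σ i ∈ doms.getD i []) ∧
    ∀ c ∈ cons, ∃ τ ∈ c.2, ∀ j < c.1.length, τ.getD j 0 = σ (c.1.getD j 0)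

/-- The elements from which a transversal is selected: a value for every variable and a tuple for
every constraint. -/
def elements (doms : List (List ℕ)) (cons : List (List ℕ × List (List ℕ))) :
    List (ℕ × List ℕ) :=
  ((List.range doms.length).flatMap fun i => (doms.getD i []).map fun a => (i, [a])) ++
    (List.range cons.length).flatMap fun t => (cons.getD t ([], [])).2.map fun τ =>
      (doms.length + t, τ)

/-- The conditions that entry `j` of the tuple of a group equals `a` if and only if variable `i`
has value `a`. -/
def checks (doms : List (List ℕ)) (cons : List (List ℕ × List (List ℕ))) :
    List (ℕ × ℕ × ℕ × ℕ) :=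
  (List.range cons.length).flatMap fun t =>
    (List.range (cons.getD t ([], [])).1.length).flatMap fun j =>
      (doms.getD ((cons.getD t ([], [])).1.getD j 0) []).map fun a =>
        (doms.length + t, j, (cons.getD t ([], [])).1.getD j 0, a)

/-- The color of an element in the coloring of a check. -/
def color (z : ℕ × ℕ × ℕ × ℕ) (e : ℕ × List ℕ) : ℕ :=
  bif decide (e.1 = z.2.2.1) then
    bif decide (e.2.getD 0 0 = z.2.2.2) then z.2.2.1 else z.1
  else bif decide (e.1 = z.1) then
    bif decide (e.2.getD z.2.1 0 = z.2.2.2) then z.1 else z.2.2.1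
  else e.1

def rows (doms : List (List ℕ)) (cons : List (List ℕ × List (List ℕ))) : List (List ℕ) :=
  (elements doms cons).map fun e => e.1 :: (checks doms cons).map fun z => color z e

section PTime
variable {γ : Type} [Enc γ] {doms : γ → List (List ℕ)} {cons : γ → List (List ℕ × List (List ℕ))}

@[fun_prop]
theorem ptime_color {z : γ → ℕ × ℕ × ℕ × ℕ} {e : γ → ℕ × List ℕ} (hz : PTime z) (he : PTime e) :
    PTime fun x => color (z x) (e x) := by
  unfold color; fun_prop

@[fun_prop]
theorem ptime_elements (hd : PTime doms) (hc : PTime cons) :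
    PTime fun x => elements (doms x) (cons x) := by
  unfold elements; fun_prop

@[fun_prop]
theorem ptime_checks (hd : PTime doms) (hc : PTime cons) :
    PTime fun x => checks (doms x) (cons x) := by
  unfold checks; fun_prop

@[fun_prop]
theorem ptime_rows (hd : PTime doms) (hc : PTime cons) : PTime fun x => rows (doms x) (cons x) := by
  unfold rows; fun_prop

end PTime

/-! ### Transversals and satisfying assignments -/

variable {doms : List (List ℕ)} {cons : List (List ℕ × List (List ℕ))}

theorem mem_elements {γ : ℕ} {τ : List ℕ} : (γ, τ) ∈ elements doms cons ↔
    (γ < doms.length ∧ ∃ a ∈ doms.getD γ [], τ = [a]) ∨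
      ∃ t, ∃ ht : t < cons.length, γ = doms.length + t ∧ τ ∈ cons[t].2 := by
  simp only [elements, List.mem_append, List.mem_flatMap, List.mem_range, List.mem_map,
    Prod.mk.injEq]
  refine or_congr ⟨?_, ?_⟩ ⟨?_, ?_⟩
  · rintro ⟨i, hi, a, ha, rfl, rfl⟩; exact ⟨hi, a, ha, rfl⟩
  · rintro ⟨hi, a, ha, rfl⟩; exact ⟨γ, hi, a, ha, rfl, rfl⟩
  · rintro ⟨t, ht, τ', hτ, rfl, rfl⟩
    rw [List.getD_eq_getElem _ _ ht] at hτ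
    exact ⟨t, ht, rfl, hτ⟩
  · rintro ⟨t, ht, rfl, hτ⟩
    exact ⟨t, ht, τ, by rwa [List.getD_eq_getElem _ _ ht], rfl, rfl⟩

theorem mem_checks {z : ℕ × ℕ × ℕ × ℕ} : z ∈ checks doms cons ↔
    ∃ t, ∃ ht : t < cons.length, ∃ j < cons[t].1.length, ∃ a ∈ doms.getD (cons[t].1.getD j 0) [],
      z = (doms.length + t, j, cons[t].1.getD j 0, a) := by
  simp only [checks, List.mem_flatMap, List.mem_range, List.mem_map]
  constructor
  · rintro ⟨t, ht, j, hj, a, ha, rfl⟩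
    simp only [List.getD_eq_getElem _ _ ht] at hj ha ⊢
    exact ⟨t, ht, j, hj, a, ha, rfl⟩
  · rintro ⟨t, ht, j, hj, a, ha, rfl⟩
    refine ⟨t, ht, j, ?_, a, ?_, ?_⟩ <;> simp only [List.getD_eq_getElem _ _ ht]
    · exact hj
    · exact ha

theorem color_lt (h : ∀ c ∈ cons, ∀ j < c.1.length, c.1.getD j 0 < doms.length)
    {z : ℕ × ℕ × ℕ × ℕ} (hz : z ∈ checks doms cons) {e : ℕ × List ℕ}
    (he : e.1 < doms.length + cons.length) : color z e < doms.length + cons.length := by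
  obtain ⟨t, ht, j, hj, a, ha, rfl⟩ := mem_checks.1 hz
  have := h _ (List.getElem_mem ht) j hj
  simp only [color, Bool.cond_decide]
  split_ifs <;> omega

theorem elements_fst_lt {e : ℕ × List ℕ} (he : e ∈ elements doms cons) :
    e.1 < doms.length + cons.length := by
  obtain ⟨γ, τ⟩ := e
  rcases mem_elements.1 he with ⟨h, -⟩ | ⟨t, ht, rfl, -⟩ <;> dsimp only <;> omega

theorem rows_lt (h : ∀ c ∈ cons, ∀ j < c.1.length, c.1.getD j 0 < doms.length) :
    ∀ row ∈ rows doms cons, ∀ p < (checks doms cons).length + 1,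
      row.getD p 0 < doms.length + cons.length := by
  intro row hrow p hp
  obtain ⟨e, he, rfl⟩ := List.mem_map.1 hrow
  have he' := elements_fst_lt he
  rcases p with _ | p
  · exact he'
  · rw [List.getD_cons_succ, List.getD_eq_getElem _ _ (by simpa using hp), List.getElem_map]
    exact color_lt h (List.getElem_mem _) he'

/-- The characterization of transversals in terms of elements. -/
theorem hasTransversal_rows_iff : HasTransversal (rows doms cons) ((checks doms cons).length + 1)
    (doms.length + cons.length) ↔ ∃ S : Set (Fin (elements doms cons).length),
      ∀ b < doms.length + cons.length, (∃! u, u ∈ S ∧ (elements doms cons)[u].1 = b) ∧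
        ∀ z ∈ checks doms cons, ∃! u, u ∈ S ∧ color z (elements doms cons)[u] = b := by
  have hlen : (rows doms cons).length = (elements doms cons).length := by simp [rows]
  have h0 : ∀ u : Fin (elements doms cons).length,
      (rows doms cons)[Fin.cast hlen.symm u].getD 0 0 = (elements doms cons)[u].1 := by
    intro u; simp [rows]; rfl
  have h1 : ∀ (u : Fin (elements doms cons).length) (p : ℕ) (hp : p < (checks doms cons).length),
      (rows doms cons)[Fin.cast hlen.symm u].getD (p + 1) 0 =
        color (checks doms cons)[p] (elements doms cons)[u] := by
    intro u p hp; simp [rows, hp]; rfl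
  have tr : ∀ (S : Set (Fin (elements doms cons).length)) (p b : ℕ),
      (∃! u, u ∈ (Fin.cast hlen) ⁻¹' S ∧ (rows doms cons)[u].getD p 0 = b) ↔
      ∃! u, u ∈ S ∧ (rows doms cons)[Fin.cast hlen.symm u].getD p 0 = b := fun S p b =>
    (finCongr hlen).existsUnique_congr fun {u} => Iff.rfl
  constructor
  · rintro ⟨S, hS⟩
    refine ⟨(Fin.cast hlen.symm) ⁻¹' S, fun b hb => ⟨?_, fun z hz => ?_⟩⟩
    · have := (tr ((Fin.cast hlen.symm) ⁻¹' S) 0 b).1 (hS 0 (by omega) b hb)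
      simpa only [h0] using this
    · obtain ⟨p, hp, rfl⟩ := List.mem_iff_getElem.1 hz
      have := (tr ((Fin.cast hlen.symm) ⁻¹' S) (p + 1) b).1 (hS (p + 1) (by omega) b hb)
      simpa only [h1 _ p hp] using this
  · rintro ⟨S, hS⟩
    refine ⟨(Fin.cast hlen) ⁻¹' S, fun p hp b hb => (tr S p b).2 ?_⟩
    rcases p with _ | p
    · simpa only [h0] using (hS b hb).1
    · have hp' : p < (checks doms cons).length := by omega
      simpa only [h1 _ p hp'] using (hS b hb).2 _ (List.getElem_mem hp')

/-- The coloring by group selects one value per variable and one tuple per constraint; the checks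
then make each tuple agree with the values of its variables. -/
theorem sat_of_transversal (h : ∀ c ∈ cons, ∀ j < c.1.length, c.1.getD j 0 < doms.length)
    {S : Set (Fin (elements doms cons).length)}
    (hS : ∀ b < doms.length + cons.length, (∃! u, u ∈ S ∧ (elements doms cons)[u].1 = b) ∧
      ∀ z ∈ checks doms cons, ∃! u, u ∈ S ∧ color z (elements doms cons)[u] = b) :
    Sat doms cons := by
  have hsel : ∀ i, ∃ a, i < doms.length →
      a ∈ doms.getD i [] ∧ ∃ u ∈ S, (elements doms cons)[u] = (i, [a]) := by
    intro i
    by_cases hi : i < doms.length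
    · obtain ⟨u, ⟨hu, hui⟩, -⟩ := (hS i (by omega)).1
      have hmem : (elements doms cons)[u] ∈ elements doms cons := List.getElem_mem _
      obtain ⟨⟨γ, τ⟩, hx⟩ : ∃ e, (elements doms cons)[u] = e := ⟨_, rfl⟩
      rw [hx] at hui hmem
      obtain rfl : γ = i := hui
      rcases mem_elements.1 hmem with ⟨-, a, ha, rfl⟩ | ⟨t, ht, hγ, -⟩
      · exact ⟨a, fun _ => ⟨ha, u, hu, hx⟩⟩
      · omega
    · exact ⟨0, fun h => absurd h hi⟩
  choose σ hσ using hsel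
  refine ⟨σ, fun i hi => (hσ i hi).1, fun c hc => ?_⟩
  obtain ⟨t, ht, rfl⟩ := List.mem_iff_getElem.1 hc
  obtain ⟨u, ⟨hu, hut⟩, -⟩ := (hS (doms.length + t) (by omega)).1
  have hmem : (elements doms cons)[u] ∈ elements doms cons := List.getElem_mem _
  obtain ⟨⟨γ, τ⟩, hx⟩ : ∃ e, (elements doms cons)[u] = e := ⟨_, rfl⟩
  rw [hx] at hut hmem
  obtain rfl : γ = doms.length + t := hut
  have hτ : τ ∈ cons[t].2 := by
    rcases mem_elements.1 hmem with ⟨h0, -⟩ | ⟨t', ht', hγ, h'⟩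
    · omega
    · obtain rfl : t = t' := by omega
      exact h'
  refine ⟨τ, hτ, fun j hj => ?_⟩
  have hi := h _ hc j hj
  set i := cons[t].1.getD j 0 with hi_def
  obtain ⟨ha, v, hv, hvx⟩ := hσ i hi
  have hz : (doms.length + t, j, i, σ i) ∈ checks doms cons :=
    mem_checks.2 ⟨t, ht, j, hj, σ i, ha, rfl⟩
  by_contra hne
  -- In the check for the value `σ i`, the selected value of the variable has color `i`. A
  -- disagreeing tuple would have color `i` too, a collision of two different groups.
  have huv := ((hS i (by omega)).2 _ hz).unique (y₁ := u) (y₂ := v)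
    ⟨hu, by
      rw [hx]; simp only [color, Bool.cond_decide]
      rw [if_neg (by omega), if_pos trivial, if_neg hne]⟩ ⟨hv, by rw [hvx]; simp [color]⟩
  rw [huv, hvx] at hx
  have := congrArg Prod.fst hx
  dsimp only at this
  omega

/-- If the chosen elements carry the colors of their groups up to an involution of the groups, every
color occurs exactly once. -/
theorem existsUnique_range {N : ℕ} {ι : Type*} {idx : ℕ → ι} {c : ι → ℕ} {f : ℕ → ℕ}
    (hc : ∀ γ < N, c (idx γ) = f γ) (hf : ∀ γ < N, f γ < N) (hff : ∀ γ < N, f (f γ) = γ) {b : ℕ}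
    (hb : b < N) : ∃! u, u ∈ idx '' Set.Iio N ∧ c u = b := by
  refine ⟨idx (f b), ⟨⟨f b, hf b hb, rfl⟩, by rw [hc _ (hf b hb), hff b hb]⟩, ?_⟩
  rintro _ ⟨⟨γ, hγ, rfl⟩, h⟩
  rw [hc γ hγ] at h
  rw [← h, hff γ hγ]

theorem transversal_of_sat (h : ∀ c ∈ cons, ∀ j < c.1.length, c.1.getD j 0 < doms.length)
    (hsat : Sat doms cons) : ∃ S : Set (Fin (elements doms cons).length),
      ∀ b < doms.length + cons.length, (∃! u, u ∈ S ∧ (elements doms cons)[u].1 = b) ∧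
        ∀ z ∈ checks doms cons, ∃! u, u ∈ S ∧ color z (elements doms cons)[u] = b := by
  obtain ⟨σ, hσ, hτ⟩ := hsat
  have hidx : ∀ γ : Fin (doms.length + cons.length), ∃ u : Fin (elements doms cons).length,
      (elements doms cons)[u].1 = γ ∧
      ((γ : ℕ) < doms.length → (elements doms cons)[u].2.getD 0 0 = σ γ) ∧
      ∀ t, ∀ ht : t < cons.length, (γ : ℕ) = doms.length + t → ∀ j < cons[t].1.length,
        (elements doms cons)[u].2.getD j 0 = σ (cons[t].1.getD j 0) := by
    rintro ⟨γ, hγ⟩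
    by_cases hi : γ < doms.length
    · obtain ⟨u, hu, he⟩ := List.mem_iff_getElem.1
        (mem_elements.2 (.inl ⟨hi, σ γ, hσ γ hi, rfl⟩) : (γ, [σ γ]) ∈ elements doms cons)
      refine ⟨⟨u, hu⟩, ?_⟩
      simp only [Fin.getElem_fin, he]
      exact ⟨trivial, by simp, fun t _ h => by omega⟩
    · obtain ⟨t, rfl⟩ := Nat.exists_eq_add_of_le (not_lt.1 hi)
      have ht : t < cons.length := by omega
      obtain ⟨τ, hτ1, hτ2⟩ := hτ _ (List.getElem_mem ht)
      obtain ⟨u, hu, he⟩ := List.mem_iff_getElem.1 (mem_elements.2 (.inr ⟨t, ht, rfl, hτ1⟩) :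
        (doms.length + t, τ) ∈ elements doms cons)
      refine ⟨⟨u, hu⟩, ?_⟩
      simp only [Fin.getElem_fin, he]
      refine ⟨trivial, fun h => by omega, fun t' _ h => ?_⟩
      obtain rfl : t = t' := by omega
      exact hτ2
  choose idx h0 h1 h2 using hidx
  rcases Nat.eq_zero_or_pos (doms.length + cons.length) with hN | hN
  · exact ⟨∅, fun b hb => by omega⟩
  let idx' : ℕ → Fin (elements doms cons).length := fun γ =>
    if hγ : γ < doms.length + cons.length then idx ⟨γ, hγ⟩ else idx ⟨0, hN⟩
  have e' : ∀ {γ} (hγ : γ < doms.length + cons.length), idx' γ = idx ⟨γ, hγ⟩ := fun hγ => dif_pos hγ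
  refine ⟨idx' '' Set.Iio (doms.length + cons.length), fun b hb => ⟨?_, fun z hz => ?_⟩⟩
  · exact existsUnique_range (f := fun γ => γ) (fun γ hγ => by rw [e' hγ, h0])
      (fun _ h => h) (fun _ _ => rfl) hb
  · obtain ⟨t, ht, j, hj, a, ha, rfl⟩ := mem_checks.1 hz
    have hi := h _ (List.getElem_mem ht) j hj
    set i := cons[t].1.getD j 0 with hi_def
    -- If the variable has the value of the check, then so does the tuple entry, and all chosen
    -- elements keep their group colors. Otherwise both disagree, and the two colors are exchanged.
    by_cases hia : σ i = a
    · refine existsUnique_range (f := fun γ => γ) (fun γ hγ => ?_) (fun _ h => h)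
        (fun _ _ => rfl) hb
      have e0 : (elements doms cons)[idx ⟨γ, hγ⟩].1 = γ := h0 ⟨γ, hγ⟩
      have e1 : γ < doms.length → _ = σ γ := h1 ⟨γ, hγ⟩
      have e2 : γ = doms.length + t → _ := h2 ⟨γ, hγ⟩ t ht
      rw [e' hγ]
      simp only [color, Bool.cond_decide, e0]
      split_ifs with c1 c2 c3 c4
      · exact c1.symm
      · exact absurd (by rw [e1 (by omega), ← hia, c1]) c2
      · exact c3.symm
      · exact absurd (by rw [e2 c3 j hj, ← hia]) c4
      · rfl
    · refine existsUnique_range (f := Equiv.swap i (doms.length + t)) (fun γ hγ => ?_)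
        (fun γ hγ => ?_) (fun γ _ => Equiv.swap_apply_self _ _ _) hb
      · have e0 : (elements doms cons)[idx ⟨γ, hγ⟩].1 = γ := h0 ⟨γ, hγ⟩
        have e1 : γ < doms.length → _ = σ γ := h1 ⟨γ, hγ⟩
        have e2 : γ = doms.length + t → _ := h2 ⟨γ, hγ⟩ t ht
        rw [e' hγ]
        simp only [color, Bool.cond_decide, e0, Equiv.swap_apply_def]
        split_ifs with c1 c2 c3 c4
        · exact absurd (by rw [← c2, e1 (by omega), c1]) hia
        · rfl
        · exact absurd (by rw [← c4, e2 c3 j hj]) hia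
        · rfl
        · rfl
      · rw [Equiv.swap_apply_def]
        split_ifs <;> omega

theorem hasTransversal_iff_sat (h : ∀ c ∈ cons, ∀ j < c.1.length, c.1.getD j 0 < doms.length) :
    HasTransversal (rows doms cons) ((checks doms cons).length + 1) (doms.length + cons.length) ↔
      Sat doms cons := by
  rw [hasTransversal_rows_iff]
  exact ⟨fun ⟨_, hS⟩ => sat_of_transversal h hS, transversal_of_sat h⟩

/-- The instance of Vertex Deletion to Regular Subgraph for a constraint satisfaction problem. -/
def inst (doms : List (List ℕ)) (cons : List (List ℕ × List (List ℕ))) (M : ℕ) : Data :=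
  ColoringGraph.inst (rows doms cons) ((checks doms cons).length + 1) (doms.length + cons.length) M

@[fun_prop]
theorem ptime_inst {γ : Type} [Enc γ] {doms : γ → List (List ℕ)}
    {cons : γ → List (List ℕ × List (List ℕ))} {M : γ → ℕ} (hd : PTime doms) (hc : PTime cons)
    (hM : PTime M) : PTime fun x => inst (doms x) (cons x) (M x) := by
  unfold inst; fun_prop

theorem inst_gapCorrect {A : ParamProblem} {g : ℕ → ℕ} {I : Inst} {M N : ℕ}
    (h : ∀ c ∈ cons, ∀ j < c.1.length, c.1.getD j 0 < doms.length)
    (hN : N = doms.length + cons.length) (hM : N ≤ M) (hg : g N ≤ M)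
    (hA : I ∈ A ↔ Sat doms cons) :
    GapCorrect A VertexDeletionToRegular g I (inst doms cons M, N) := by
  subst hN
  exact ColoringGraph.inst_gapCorrect (rows_lt h) (Nat.succ_pos _) hM hg
    (hA.trans (hasTransversal_iff_sat h).symm)

end Csp

/-! ### Strongly Regular Multicolored Clique -/

theorem ptime_edgelessInst {γ : Type} [Enc γ] {M : γ → ℕ} (hM : PTime M) :
    PTime fun x => edgelessInst (M x) := by
  unfold edgelessInst
  fun_prop

attribute [fun_prop] ptime_edgelessInst

theorem edgelessInst_gapCorrect {A : ParamProblem} {g : ℕ → ℕ} {I : Inst} {M N : ℕ}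
    (hM : N ≤ M) (hg : g N ≤ M) (hI : I ∉ A) :
    GapCorrect A VertexDeletionToRegular g I (edgelessInst M, N) :=
  gapCorrect_of M hM hg (fun h => absurd h hI) fun _ S hS => edgelessInst_no S hS

theorem ncard_fin_eq_length_filter {n : ℕ} (f : ℕ → Bool) :
    {v : Fin n | f v = true}.ncard = ((List.range n).filter f).length := by
  rw [← List.toFinset_card_of_nodup (List.nodup_range.filter _), ← Set.ncard_coe_finset,
    ← Set.ncard_image_of_injective _ Fin.val_injective]
  congr 1
  ext v
  simp only [Set.mem_image, Set.mem_ofPred_eq, List.coe_toFinset, List.mem_filter, List.mem_range]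
  exact ⟨fun ⟨w, hw, h⟩ => h ▸ ⟨w.2, hw⟩, fun ⟨h, hv⟩ => ⟨⟨v, h⟩, hv, rfl⟩⟩

/-- Makes the search for the class size `s` and the degree `d` finite. They are cardinalities at
most `n`, or else unconstrained when there is nothing to count; truncation at `n` is harmless in
both cases. -/
theorem exists_le_iff_of_imp_le {n : ℕ} {p : ℕ → Prop} (h : ∀ s, p s → p (min s n)) :
    (∃ s, p s) ↔ ∃ s < n + 1, p s :=
  ⟨fun ⟨s, hs⟩ => ⟨min s n, by omega, h s hs⟩, fun ⟨s, _, hs⟩ => ⟨s, hs⟩⟩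

namespace MulticoloredClique

def colorOf (x : Data) (v : ℕ) : ℕ := (x.tl.hd.toList.map Data.toNat).getD v 0

def adjb (x : Data) (u v : ℕ) : Bool :=
  !decide (u = v) && x.tl.tl.toList.any fun e =>
    (decide (e.hd.toNat = u) && decide (e.tl.toNat = v)) ||
      (decide (e.hd.toNat = v) && decide (e.tl.toNat = u))

/-- The pairs `(i, j)` with `i < j < k`. -/
def pairs (k : ℕ) : List (ℕ × ℕ) :=
  (List.range k).flatMap fun j => (List.range j).map fun i => (i, j)

/-- Whether the input has the required form. -/
def valid (x : Data) (k : ℕ) : Bool :=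
  ((List.range x.hd.toNat).all fun v => decide (colorOf x v < k)) &&
  (((List.range (x.hd.toNat + 1)).any fun s => (List.range k).all fun i =>
      decide (((List.range x.hd.toNat).filter fun v => decide (colorOf x v = i)).length = s)) &&
  ((List.range (x.hd.toNat + 1)).any fun d => (List.range x.hd.toNat).all fun v =>
    (List.range k).all fun j => decide (j = colorOf x v) ||
      decide (((List.range x.hd.toNat).filter fun w =>
        decide (colorOf x w = j) && adjb x v w).length = d)))

def doms (x : Data) (k : ℕ) : List (List ℕ) :=
  (List.range k).map fun i => (List.range x.hd.toNat).filter fun v => decide (colorOf x v = i)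

def cons (x : Data) (k : ℕ) : List (List ℕ × List (List ℕ)) :=
  (pairs k).map fun p => ([p.1, p.2],
    (List.range x.hd.toNat).flatMap fun u => ((List.range x.hd.toNat).filter fun v =>
      decide (colorOf x u = p.1) && (decide (colorOf x v = p.2) && adjb x u v)).map fun v => [u, v])

/-- The reduction to Vertex Deletion to Regular Subgraph. -/
def toVertexDeletion (p : Inst × ℕ) : Inst :=
  (bif valid p.1.1 p.1.2 then Csp.inst (doms p.1.1 p.1.2) (cons p.1.1 p.1.2) p.2
    else edgelessInst p.2, p.1.2 + (pairs p.1.2).length)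

section PTime
variable {γ : Type} [Enc γ] {x : γ → Data} {k u v : γ → ℕ}

@[fun_prop]
theorem ptime_colorOf (hx : PTime x) (hv : PTime v) : PTime fun a => colorOf (x a) (v a) := by
  unfold colorOf; fun_prop

@[fun_prop]
theorem ptime_adjb (hx : PTime x) (hu : PTime u) (hv : PTime v) :
    PTime fun a => adjb (x a) (u a) (v a) := by
  unfold adjb; fun_prop

@[fun_prop]
theorem ptime_pairs (hk : PTime k) : PTime fun a => pairs (k a) := by
  unfold pairs; fun_prop

@[fun_prop]
theorem ptime_valid (hx : PTime x) (hk : PTime k) : PTime fun a => valid (x a) (k a) := by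
  unfold valid; fun_prop

@[fun_prop]
theorem ptime_doms (hx : PTime x) (hk : PTime k) : PTime fun a => doms (x a) (k a) := by
  unfold doms; fun_prop

@[fun_prop]
theorem ptime_cons (hx : PTime x) (hk : PTime k) : PTime fun a => cons (x a) (k a) := by
  unfold cons; fun_prop

theorem ptime_toVertexDeletion : PTime toVertexDeletion := by
  unfold toVertexDeletion; fun_prop

end PTime

/-! ### Correctness of the clique reduction -/

theorem length_pairs (k : ℕ) : (pairs k).length = k.choose 2 := by
  induction k with
  | zero => rfl
  | succ k ih =>
    rw [pairs] at ih
    rw [pairs, List.range_succ, List.flatMap_append, List.length_append, ih, Nat.choose_succ_succ']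
    simp [add_comm]

theorem mem_pairs {k : ℕ} {p : ℕ × ℕ} : p ∈ pairs k ↔ p.1 < p.2 ∧ p.2 < k := by
  obtain ⟨i, j⟩ := p
  simp only [pairs, List.mem_flatMap, List.mem_range, List.mem_map, Prod.mk.injEq]
  constructor
  · rintro ⟨j, hj, i, hi, rfl, rfl⟩; exact ⟨hi, hj⟩
  · rintro ⟨hi, hj⟩; exact ⟨j, hj, i, hi, rfl, rfl⟩

theorem adjb_iff (x : Data) (u v : Fin x.hd.toNat) :
    adjb x u v = true ↔ (graphOfEdges x.hd.toNat x.tl.tl.toList).Adj u v := by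
  simp only [adjb, Bool.and_eq_true, Bool.not_eq_true', decide_eq_false_iff_not, List.any_eq_true,
    Bool.or_eq_true, decide_eq_true_eq, graphOfEdges, SimpleGraph.fromRel_adj, Fin.val_inj, ne_eq]
  refine and_congr_right fun _ => ?_
  rw [← exists_or]
  refine exists_congr fun e => ?_
  tauto

theorem valid_iff (x : Data) (k : ℕ) : valid x k = true ↔ ∃ s d : ℕ,
    (∀ v : Fin x.hd.toNat, colorOf x v < k) ∧
    (∀ i < k, {v : Fin x.hd.toNat | colorOf x v = i}.ncard = s) ∧
    ∀ v : Fin x.hd.toNat, ∀ j < k, j ≠ colorOf x v → {w : Fin x.hd.toNat | colorOf x w = j ∧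
      (graphOfEdges x.hd.toNat x.tl.tl.toList).Adj v w}.ncard = d := by
  have e1 : ∀ i, {v : Fin x.hd.toNat | colorOf x v = i}.ncard =
      ((List.range x.hd.toNat).filter fun v => decide (colorOf x v = i)).length := fun i => by
    rw [← ncard_fin_eq_length_filter]; simp
  have e2 : ∀ (v : Fin x.hd.toNat) j, {w : Fin x.hd.toNat | colorOf x w = j ∧
      (graphOfEdges x.hd.toNat x.tl.tl.toList).Adj v w}.ncard =
      ((List.range x.hd.toNat).filter fun w => decide (colorOf x w = j) && adjb x v w).length :=
    fun v j => by
      rw [← ncard_fin_eq_length_filter]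
      simp only [Bool.and_eq_true, decide_eq_true_eq, adjb_iff]
  have hle : ∀ f, ((List.range x.hd.toNat).filter f).length ≤ x.hd.toNat := fun f =>
    (List.length_filter_le _ _).trans_eq List.length_range
  simp only [e1, e2, exists_and_left, exists_and_right]
  have h1 := exists_le_iff_of_imp_le (n := x.hd.toNat) (p := fun s => ∀ i < k,
    ((List.range x.hd.toNat).filter fun v => decide (colorOf x v = i)).length = s)
    fun s hs i hi => by
      have := hs i hi
      have := hle fun v => decide (colorOf x v = i)
      omega
  have h2 := exists_le_iff_of_imp_le (n := x.hd.toNat) (p := fun d => ∀ v : Fin x.hd.toNat,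
    ∀ j < k, j ≠ colorOf x v → ((List.range x.hd.toNat).filter fun w =>
      decide (colorOf x w = j) && adjb x v w).length = d) fun s hs v j hj hne => by
      have := hs v j hj hne
      have := hle fun w => decide (colorOf x w = j) && adjb x v w
      omega
  rw [h1, h2]
  simp only [valid, Bool.and_eq_true, List.all_eq_true, List.any_eq_true, List.mem_range,
    decide_eq_true_eq, Bool.or_eq_true, Fin.forall_iff, ne_eq, or_iff_not_imp_left]

theorem mem_iff (x : Data) (k : ℕ) : (x, k) ∈ StronglyRegularMulticoloredClique ↔
    valid x k = true ∧ ∃ Q : Set (Fin x.hd.toNat),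
      (graphOfEdges x.hd.toNat x.tl.tl.toList).IsClique Q ∧
        ∀ i < k, ∃! v : Fin x.hd.toNat, v ∈ Q ∧ colorOf x v = i := by
  rw [valid_iff]; rfl

theorem mem_doms {x : Data} {k i v : ℕ} (hi : i < k) :
    v ∈ (doms x k).getD i [] ↔ v < x.hd.toNat ∧ colorOf x v = i := by
  simp [doms, List.getD_eq_getElem?_getD, hi]

/-- Variable `i` is the vertex of color `i` in the clique. Regularity between the classes plays no
role here; it enters only through `valid`. -/
theorem sat_iff (x : Data) (k : ℕ) : Csp.Sat (doms x k) (cons x k) ↔ ∃ Q : Set (Fin x.hd.toNat),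
      (graphOfEdges x.hd.toNat x.tl.tl.toList).IsClique Q ∧
        ∀ i < k, ∃! v : Fin x.hd.toNat, v ∈ Q ∧ colorOf x v = i := by
  have hl : (doms x k).length = k := by simp [doms]
  unfold Csp.Sat
  rw [hl]
  have key : ∀ σ : ℕ → ℕ, (∀ c ∈ cons x k, ∃ τ ∈ c.2, ∀ j < c.1.length,
      τ.getD j 0 = σ (c.1.getD j 0)) ↔ ∀ j < k, ∀ i < j, σ i < x.hd.toNat ∧ σ j < x.hd.toNat ∧
        colorOf x (σ i) = i ∧ colorOf x (σ j) = j ∧ adjb x (σ i) (σ j) = true := by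
    intro σ
    rw [cons, List.forall_mem_map]
    simp only [Prod.forall, mem_pairs, and_imp, List.mem_flatMap, List.mem_range, List.mem_map,
      List.mem_filter, Bool.and_eq_true, decide_eq_true_eq, List.length_cons, List.length_nil]
    constructor
    · intro h j hj i hi
      obtain ⟨τ, ⟨u, hu, v, ⟨hv, h1, h2, h3⟩, rfl⟩, hτ⟩ := h i j hi hj
      obtain rfl : u = σ i := hτ 0 (by omega)
      obtain rfl : v = σ j := hτ 1 (by omega)
      exact ⟨hu, hv, h1, h2, h3⟩
    · intro h i j hi hj
      obtain ⟨hu, hv, h1, h2, h3⟩ := h j hj i hi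
      refine ⟨_, ⟨σ i, hu, σ j, ⟨hv, h1, h2, h3⟩, rfl⟩, fun t ht => ?_⟩
      interval_cases t <;> rfl
  simp only [key]
  constructor
  · rintro ⟨σ, hσ, hE⟩
    have hσ' : ∀ i < k, σ i < x.hd.toNat ∧ colorOf x (σ i) = i := fun i hi =>
      (mem_doms hi).1 (hσ i hi)
    refine ⟨{v | ∃ i < k, σ i = v}, ?_, fun i hi => ⟨⟨σ i, (hσ' i hi).1⟩,
      ⟨⟨i, hi, rfl⟩, (hσ' i hi).2⟩, ?_⟩⟩
    · rintro u ⟨i, hi, hu⟩ v ⟨j, hj, hv⟩ hne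
      rcases lt_trichotomy i j with h | rfl | h
      · exact (adjb_iff x u v).1 (by rw [← hu, ← hv]; exact (hE j hj i h).2.2.2.2)
      · exact absurd (Fin.ext (hu.symm.trans hv)) hne
      · exact ((adjb_iff x v u).1 (by rw [← hu, ← hv]; exact (hE i hi j h).2.2.2.2)).symm
    · rintro v ⟨⟨j, hj, hv⟩, hc⟩
      rw [← hv, (hσ' j hj).2] at hc
      subst hc
      exact Fin.ext hv.symm
  · rintro ⟨Q, hQ, hu⟩
    have hw : ∀ i, ∃ v : ℕ, i < k → ∃ w ∈ Q, colorOf x w = i ∧ (w : ℕ) = v := fun i => by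
      by_cases hi : i < k
      · obtain ⟨w, ⟨hw, hc⟩, -⟩ := hu i hi
        exact ⟨w, fun _ => ⟨w, hw, hc, rfl⟩⟩
      · exact ⟨0, fun h => absurd h hi⟩
    choose σ hσ using hw
    refine ⟨σ, fun i hi => ?_, fun j hj i hi => ?_⟩
    · obtain ⟨w, -, hc, hw⟩ := hσ i hi
      exact (mem_doms hi).2 ⟨hw ▸ w.2, hw ▸ hc⟩
    · obtain ⟨u, hu, hcu, hu'⟩ := hσ i (hi.trans hj)
      obtain ⟨v, hv, hcv, hv'⟩ := hσ j hj
      rw [← hu', ← hv']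
      refine ⟨u.2, v.2, hcu, hcv, (adjb_iff x u v).2 (hQ hu hv ?_)⟩
      rintro rfl
      omega

theorem gapCorrect {g : ℕ → ℕ} (I : Inst) {M : ℕ} (hM : I.2 + I.2.choose 2 ≤ M)
    (hg : g (I.2 + I.2.choose 2) ≤ M) :
    GapCorrect StronglyRegularMulticoloredClique VertexDeletionToRegular g I
      (toVertexDeletion (I, M)) := by
  obtain ⟨x, k⟩ := I
  rw [toVertexDeletion, length_pairs]
  by_cases h : valid x k = true
  · rw [h, cond_true]
    have hl : (doms x k).length = k := by simp [doms]
    refine Csp.inst_gapCorrect ?_ ?_ hM hg ?_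
    · rw [cons, List.forall_mem_map, hl]
      rintro ⟨i, j⟩ hp t ht
      obtain ⟨hi, hj⟩ := mem_pairs.1 hp
      dsimp only at hi hj ht
      simp only [List.length_cons, List.length_nil] at ht
      interval_cases t
      · exact hi.trans hj
      · exact hj
    · rw [hl, cons, List.length_map, length_pairs]
    · rw [mem_iff, sat_iff, and_iff_right h]
  · rw [Bool.eq_false_iff.2 h, cond_false]
    exact edgelessInst_gapCorrect hM hg fun hI => h ((mem_iff x k).1 hI).1

end MulticoloredClique

theorem FPTTransforms.mono {R R' : Inst → Inst → Prop} (h : FPTTransforms R)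
    (hRR' : ∀ I J, R I J → R' I J) : FPTTransforms R' := by
  obtain ⟨p, c, f, h', hf, hh, H⟩ := h
  refine ⟨p, c, f, h', hf, hh, fun x k => ?_⟩
  obtain ⟨x', k', t, h1, h2, h3, h4⟩ := H x k
  exact ⟨x', k', t, h1, h2, h3, hRR' _ _ h4⟩

theorem computable_choose_two : Computable fun k : ℕ => k.choose 2 := by
  refine ((Primrec.nat_div.comp (Primrec.nat_mul.comp .id (Primrec.nat_sub.comp .id (.const 1)))
    (.const 2)).to_comp).of_eq fun k => ?_
  rw [Nat.choose_two_right]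
  rfl

theorem stronglyRegularMulticoloredClique_reduces {g : ℕ → ℕ} (hg : Computable g) :
    FPTTransforms fun I J =>
      GapCorrect StronglyRegularMulticoloredClique VertexDeletionToRegular g I J ∧
      J.2 = I.2 + I.2.choose 2 := by
  have hκ : Computable fun k : ℕ => k + k.choose 2 :=
    Primrec.nat_add.to_comp.comp .id computable_choose_two
  -- The value of `G` serves as `M`; the sum dominates both the new parameter and its image under
  -- `g`.
  refine (fptTransforms_eq.comp_ptime (G := fun k => g (k + k.choose 2) + (k + k.choose 2))
    (Primrec.nat_add.to_comp.comp (hg.comp hκ) hκ) hκ MulticoloredClique.ptime_toVertexDeletion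
    fun I a => ?_).mono ?_
  · rw [MulticoloredClique.toVertexDeletion, MulticoloredClique.length_pairs]
  · rintro I _ ⟨_, rfl, rfl⟩
    refine ⟨MulticoloredClique.gapCorrect I (Nat.le_add_left _ _) (Nat.le_add_right _ _), ?_⟩
    rw [MulticoloredClique.toVertexDeletion, MulticoloredClique.length_pairs]

/-! ### Refutation of circuits with partial information on the assignment -/

/-- Whether the value `b` is possible, for a pair that says whether `true` and whether `false` is
possible. -/
def possible (p : Bool × Bool) (b : Bool) : Bool := bif b then p.1 else p.2

@[simp] theorem possible_swap (p : Bool × Bool) (b : Bool) :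
    possible p.swap b = possible p (!b) := by cases b <;> rfl

@[simp] theorem possible_false_true (b : Bool) : possible (false, true) b = !b := by
  cases b <;> rfl

namespace Gate

/-- The conjunction for `c = true`, and the disjunction for `c = false`. -/
def junction (c : Bool) (l : List ℕ) : Gate := bif c then conj l else disj l

/-- Conjunctions and disjunctions are dual: the value `c` needs all wires, the value `!c` needs one.
Treating them together halves the inductions over circuits. -/
theorem rec_junction {motive : Gate → Prop} (input : ∀ i, motive (input i))
    (neg : ∀ j, motive (neg j)) (junction : ∀ c l, motive (junction c l)) (g : Gate) : motive g := by
  cases g with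
  | input i => exact input i
  | neg j => exact neg j
  | conj l => exact junction true l
  | disj l => exact junction false l

theorem value_junction (a : ℕ → Bool) (v : List Bool) (c : Bool) (l : List ℕ) :
    (junction c l).value a v = c ↔ ∀ j ∈ l, v.getD j false = c := by
  cases c
  · change (l.any fun j => v.getD j false) = false ↔ _
    simp only [List.any_eq_false, Bool.not_eq_true]
  · change (l.all fun j => v.getD j false) = true ↔ _
    simp only [List.all_eq_true]

theorem pathWeight_junction (w : ℕ → ℕ) (v : List ℕ) (c : Bool) (l : List ℕ) :
    (junction c l).pathWeight w v = w l.length + (l.map fun j => v.getD j 0).foldr max 0 := by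
  cases c <;> rfl

/-- Whether the wire `j` of a gate of fan-in `m` is taken into account as a possible witness, where
`N` is the number of gates after the gate. -/
def selected (w : List (ℕ × ℕ)) (N m j : ℕ) : Bool :=
  decide (m ≤ 2) || (decide (N ≤ j) || w.any fun p => decide (p.1 = N) && decide (p.2 = j))

/-- The possible values of a gate, given those of the inputs and of the gates after it. -/
def possibleValues (inp : ℕ → Bool × Bool) (w : List (ℕ × ℕ)) (v : List (Bool × Bool)) :
    Gate → Bool × Bool
  | input i => inp i
  | neg j => (v.getD j (false, true)).swap
  | conj l => (l.all fun j => (v.getD j (false, true)).1,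
      l.any fun j => selected w v.length l.length j && (v.getD j (false, true)).2)
  | disj l => (l.any fun j => selected w v.length l.length j && (v.getD j (false, true)).1,
      l.all fun j => (v.getD j (false, true)).2)

theorem possible_junction (inp : ℕ → Bool × Bool) (w : List (ℕ × ℕ)) (v : List (Bool × Bool))
    (c : Bool) (l : List ℕ) : possible ((junction c l).possibleValues inp w v) c = true ↔
      ∀ j ∈ l, possible (v.getD j (false, true)) c = true := by
  rw [← List.all_eq_true (p := fun j => possible (v.getD j (false, true)) c)]
  cases c <;> rfl

theorem possible_junction_not (inp : ℕ → Bool × Bool) (w : List (ℕ × ℕ)) (v : List (Bool × Bool))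
    (c : Bool) (l : List ℕ) : possible ((junction c l).possibleValues inp w v) (!c) = true ↔
      ∃ j ∈ l, selected w v.length l.length j = true ∧
        possible (v.getD j (false, true)) (!c) = true := by
  simp only [← Bool.and_eq_true]
  rw [← List.any_eq_true (p := fun j => selected w v.length l.length j &&
    possible (v.getD j (false, true)) (!c))]
  cases c <;> rfl

theorem selected_mono {w w' : List (ℕ × ℕ)} (h : w ⊆ w') {N m j : ℕ}
    (hs : selected w N m j = true) : selected w' N m j = true := by
  simp only [selected, Bool.or_eq_true, List.any_eq_true] at hs ⊢
  exact hs.imp_right (Or.imp_right fun ⟨p, hp, hp'⟩ => ⟨p, h hp, hp'⟩)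

end Gate

namespace Circuit

/-- The possible values of all gates. -/
def possibleValues (inp : ℕ → Bool × Bool) (w : List (ℕ × ℕ)) : List Gate → List (Bool × Bool)
  | [] => []
  | g :: C => g.possibleValues inp w (possibleValues inp w C) :: possibleValues inp w C

/-- The possibility of the value `b` for gate `j`. -/
def Possible (inp : ℕ → Bool × Bool) (w : List (ℕ × ℕ)) (C : List Gate) (j : ℕ) (b : Bool) : Prop :=
  possible ((possibleValues inp w C).getD j (false, true)) b = true

variable {inp inp' : ℕ → Bool × Bool} {w w' : List (ℕ × ℕ)} {C : List Gate} {g : Gate} {j : ℕ}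
  {b c : Bool}

@[simp] theorem length_possibleValues (inp : ℕ → Bool × Bool) (w : List (ℕ × ℕ)) (C : List Gate) :
    (possibleValues inp w C).length = C.length := by
  induction C with
  | nil => rfl
  | cons g C ih => simp [possibleValues, ih]

theorem possible_of_length_le (h : C.length ≤ j) : Possible inp w C j b ↔ b = false := by
  rw [Possible, List.getD_eq_default _ _ (by simpa using h)]
  simp

theorem possible_neg {i : ℕ} : Possible inp w (.neg i :: C) 0 b ↔ Possible inp w C i (!b) := by
  rw [Possible, Possible, ← possible_swap]; rfl

theorem possible_junction {l : List ℕ} : Possible inp w (.junction c l :: C) 0 c ↔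
    ∀ j ∈ l, Possible inp w C j c := Gate.possible_junction ..

theorem possible_junction_not {l : List ℕ} : Possible inp w (.junction c l :: C) 0 (!c) ↔
    ∃ j ∈ l, Gate.selected w C.length l.length j = true ∧ Possible inp w C j (!c) := by
  rw [← length_possibleValues inp w C]
  exact Gate.possible_junction_not ..

theorem eq_or_eq_not' (b c : Bool) : b = c ∨ b = !c := by cases b <;> cases c <;> simp

/-- The evaluation is monotone because a negation only swaps the two possibilities, so that truth
and falsity are tracked independently and positively. -/
theorem Possible.mono (hinp : ∀ i b, possible (inp i) b = true → possible (inp' i) b = true)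
    (hw : w ⊆ w') (h : Possible inp w C j b) : Possible inp' w' C j b := by
  induction C generalizing j b with
  | nil => exact h
  | cons g C ih =>
    rcases j with _ | j
    · induction g using Gate.rec_junction with
      | input i => exact hinp i b h
      | neg i => exact possible_neg.2 (ih (possible_neg.1 h))
      | junction c l =>
        rcases eq_or_eq_not' b c with rfl | rfl
        · exact possible_junction.2 fun j hj => ih (possible_junction.1 h j hj)
        · obtain ⟨j, hj, hs, h⟩ := possible_junction_not.1 h
          exact possible_junction_not.2 ⟨j, hj, Gate.selected_mono hw hs, ih h⟩
    · exact ih h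

/-- Soundness with complete information on the inputs, whatever the witnesses are: restricting the
wires taken into account can only remove possibilities. -/
theorem value_eq_of_possible {a : ℕ → Bool} (hinp : ∀ i b, possible (inp i) b = true → a i = b)
    (h : Possible inp w C j b) : (values a C).getD j false = b := by
  induction C generalizing j b with
  | nil => exact ((possible_of_length_le (Nat.zero_le j)).1 h).symm
  | cons g C ih =>
    rcases j with _ | j
    · change g.value a (values a C) = b
      induction g using Gate.rec_junction with
      | input i => exact hinp i b h
      | neg i =>
        have := ih (possible_neg.1 h)
        rw [Gate.value, this, Bool.not_not]
      | junction c l =>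
        rcases eq_or_eq_not' b c with rfl | rfl
        · exact (Gate.value_junction ..).2 fun j hj => ih (possible_junction.1 h j hj)
        · obtain ⟨j, hj, -, h⟩ := possible_junction_not.1 h
          refine (eq_or_eq_not' _ c).resolve_left fun hc => ?_
          have := (Gate.value_junction ..).1 hc j hj
          rw [ih h] at this
          exact Bool.not_ne_self c this
    · exact ih h

/-- The individual lists are concatenated, which monotonicity of `Q` permits. It is used both for
refutations and for witnesses. -/
theorem exists_list_forall {α ι : Type*} {s : List α} {B : ℕ} {P : ι → Prop}
    {Q : α → List ι → Prop} (hQ : ∀ x R R', R ⊆ R' → Q x R → Q x R')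
    (h : ∀ x ∈ s, ∃ R, (∀ i ∈ R, P i) ∧ R.length ≤ B ∧ Q x R) :
    ∃ R, (∀ i ∈ R, P i) ∧ R.length ≤ s.length * B ∧ ∀ x ∈ s, Q x R := by
  induction s with
  | nil => exact ⟨[], by simp, by simp, by simp⟩
  | cons x s ih =>
    obtain ⟨R, h1, h2, h3⟩ := ih fun y hy => h y (List.mem_cons_of_mem _ hy)
    obtain ⟨R', h1', h2', h3'⟩ := h x List.mem_cons_self
    refine ⟨R' ++ R, ?_, ?_, ?_⟩
    · simpa only [List.mem_append, or_imp, forall_and] using ⟨h1', h1⟩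
    · rw [List.length_append, List.length_cons, Nat.succ_mul]; omega
    · simp only [List.mem_cons, forall_eq_or_imp]
      exact ⟨hQ _ _ _ (List.subset_append_left _ _) h3',
        fun y hy => hQ _ _ _ (List.subset_append_right _ _) (h3 y hy)⟩

theorem le_foldr_max {l : List ℕ} {f : ℕ → ℕ} (hj : j ∈ l) : f j ≤ (l.map f).foldr max 0 := by
  induction l with
  | nil => simp at hj
  | cons i l ih =>
    simp only [List.map_cons, List.foldr_cons]
    rcases List.mem_cons.1 hj with rfl | h
    · exact le_max_left _ _
    · exact (ih h).trans (le_max_right _ _)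

/-- The maximal weight of a path from an input to gate `j`. -/
def weightAt (W : ℕ → ℕ) (C : List Gate) (j : ℕ) : ℕ := (pathWeights W C).getD j 0

theorem weightAt_neg {W : ℕ → ℕ} {i : ℕ} :
    weightAt W (.neg i :: C) 0 = W 1 + weightAt W C i := rfl

theorem weightAt_junction {W : ℕ → ℕ} {l : List ℕ} : weightAt W (.junction c l :: C) 0 =
    W l.length + (l.map fun j => weightAt W C j).foldr max 0 := Gate.pathWeight_junction ..

theorem add_weightAt_le {W : ℕ → ℕ} {l : List ℕ} (hj : j ∈ l) :
    W l.length + weightAt W C j ≤ weightAt W (.junction c l :: C) 0 := by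
  rw [weightAt_junction]
  exact Nat.add_le_add_left (le_foldr_max (f := weightAt W C) hj) _

/-- A refutation of a gate of small depth needs little information on the assignment. -/
theorem exists_refutation {ι : Type*} {inp : List ι → ℕ → Bool × Bool} {F : ℕ → Bool × Bool}
    {P : ι → Prop} (hmono : ∀ R R', R ⊆ R' → ∀ i b, possible (inp R' i) b = true →
      possible (inp R i) b = true)
    (hF : ∀ i b, ¬ possible (F i) b = true → ∃ R, (∀ x ∈ R, P x) ∧ R.length ≤ 2 ∧
      ¬ possible (inp R i) b = true)
    (h : ¬ Possible F w C j b) : ∃ R, (∀ x ∈ R, P x) ∧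
      R.length ≤ 2 * (w.length + 2) ^ weightAt (fun _ => 1) C j ∧ ¬ Possible (inp R) w C j b := by
  induction C generalizing j b with
  | nil => exact ⟨[], by simp, by simp, h⟩
  | cons g C ih =>
    have hpow : ∀ {m m' : ℕ}, m ≤ m' → 2 * (w.length + 2) ^ m ≤ 2 * (w.length + 2) ^ m' :=
      fun hm => Nat.mul_le_mul_left _ (Nat.pow_le_pow_right (by omega) hm)
    rcases j with _ | j
    · induction g using Gate.rec_junction with
      | input i => exact hF i b h
      | neg i =>
        obtain ⟨R, h1, h2, h3⟩ := ih (mt possible_neg.2 h)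
        exact ⟨R, h1, h2.trans (hpow (Nat.le_add_left _ _)), mt possible_neg.1 h3⟩
      | junction c l =>
        rcases eq_or_eq_not' b c with rfl | rfl
        · rw [possible_junction] at h
          push Not at h
          obtain ⟨i, hi, h⟩ := h
          obtain ⟨R, h1, h2, h3⟩ := ih h
          exact ⟨R, h1, h2.trans (hpow (le_of_add_le_right (add_weightAt_le hi))),
            fun h => h3 (possible_junction.1 h i hi)⟩
        · rw [possible_junction_not] at h
          push Not at h
          obtain ⟨s, hs, hsl⟩ : ∃ s : List ℕ, s.length ≤ w.length + 2 ∧ ∀ i ∈ l,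
              Gate.selected w C.length l.length i = true → i < C.length → i ∈ s := by
            -- The wires to be refuted are the at most two wires of a small gate, or those that `w`
            -- names for a large gate. Hence the branching factor `w.length + 2` per level.
            by_cases hl : l.length ≤ 2
            · exact ⟨l, by omega, fun i hi _ _ => hi⟩
            · refine ⟨w.map Prod.snd, by simp, fun i hi hsel hC => ?_⟩
              simp only [Gate.selected, Bool.or_eq_true, decide_eq_true_eq, hl, false_or,
                hC.not_ge, List.any_eq_true, Bool.and_eq_true] at hsel
              obtain ⟨p, hp, -, rfl⟩ := hsel
              exact List.mem_map_of_mem hp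
          obtain ⟨R, h1, h2, h3⟩ := exists_list_forall (s := s) (P := P)
            (B := 2 * (w.length + 2) ^ (l.map fun j => weightAt (fun _ => 1) C j).foldr max 0)
            (Q := fun i R => i ∈ l → Gate.selected w C.length l.length i = true →
              ¬ Possible (inp R) w C i (!c))
            (fun x R R' hR hQ hi hsel hp => hQ hi hsel (hp.mono (hmono R R' hR) (List.Subset.refl _)))
            fun i _ => by
              by_cases hi : i ∈ l ∧ Gate.selected w C.length l.length i = true
              · obtain ⟨R, h1, h2, h3⟩ := ih (h i hi.1 hi.2)
                exact ⟨R, h1, h2.trans (hpow (le_foldr_max (f := weightAt (fun _ => 1) C) hi.1)),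
                  fun _ _ => h3⟩
              · exact ⟨[], by simp, by simp, fun h1 h2 => absurd ⟨h1, h2⟩ hi⟩
          refine ⟨R, h1, h2.trans ?_, ?_⟩
          · rw [weightAt_junction, Nat.pow_add, pow_one, mul_left_comm]
            exact Nat.mul_le_mul_left _ (Nat.mul_le_mul_right _ hs)
          · rw [possible_junction_not]
            rintro ⟨i, hi, hsel, hp⟩
            -- A dangling wire is constantly false, whatever is known about the inputs, so it needs
            -- no refutation of its own.
            rcases lt_or_ge i C.length with hC | hC
            · exact h3 i (hsl i hi hsel hC) hi hsel hp
            · exact h i hi hsel ((possible_of_length_le hC).2 ((possible_of_length_le hC).1 hp))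
    · exact ih h

/-- The weight that is used in the definition of the weft. -/
abbrev largeWeight (m : ℕ) : ℕ := if 2 < m then 1 else 0

/-- Without large gates below, `selected` discards no wire, so the true value stays possible for
every `w`. -/
theorem possible_of_weft_eq_zero {a : ℕ → Bool} (hinp : ∀ i, possible (inp i) (a i) = true)
    (hw : weightAt largeWeight C j = 0) : Possible inp w C j ((values a C).getD j false) := by
  induction C generalizing j with
  | nil => exact (possible_of_length_le (Nat.zero_le j)).2 rfl
  | cons g C ih =>
    rcases j with _ | j
    · change Possible inp w (g :: C) 0 (g.value a (values a C))
      induction g using Gate.rec_junction with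
      | input i => exact hinp i
      | neg i =>
        rw [possible_neg, Gate.value, Bool.not_not]
        exact ih (by simpa [weightAt_neg] using hw)
      | junction c l =>
        have hl : ∀ i ∈ l, l.length ≤ 2 ∧ weightAt largeWeight C i = 0 := fun i hi => by
          have := add_weightAt_le (W := largeWeight) (C := C) (c := c) hi
          rw [hw] at this
          unfold largeWeight at this ⊢
          split_ifs at this <;> omega
        rcases eq_or_eq_not' ((Gate.junction c l).value a (values a C)) c with h | h
        · rw [h, possible_junction]
          intro i hi
          rw [← (Gate.value_junction ..).1 h i hi]
          exact ih (hl i hi).2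
        · rw [h, possible_junction_not]
          obtain ⟨i, hi, hv⟩ : ∃ i ∈ l, (values a C).getD i false = !c := by
            by_contra! hne
            rw [(Gate.value_junction a _ c l).2 fun i hi => by simpa using hne i hi] at h
            exact Bool.not_ne_self c h.symm
          refine ⟨i, hi, by simp [Gate.selected, (hl i hi).1], ?_⟩
          rw [← hv]
          exact ih (hl i hi).2
    · exact ih hw

/-- The value of a gate of small depth, and weft at most one, has few witnesses. -/
theorem exists_witnesses {a : ℕ → Bool} (hinp : ∀ i, possible (inp i) (a i) = true)
    (hw : weightAt largeWeight C j ≤ 1) : ∃ w : List (ℕ × ℕ),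
      (∀ p ∈ w, p.1 < C.length ∧ p.2 < C.length) ∧ w.length ≤ 2 ^ weightAt (fun _ => 1) C j ∧
      Possible inp w C j ((values a C).getD j false) := by
  induction C generalizing j with
  | nil => exact ⟨[], by simp, by simp, (possible_of_length_le (Nat.zero_le j)).2 rfl⟩
  | cons g C ih =>
    have hmem : ∀ {w : List (ℕ × ℕ)}, (∀ p ∈ w, p.1 < C.length ∧ p.2 < C.length) →
        ∀ p ∈ w, p.1 < (g :: C).length ∧ p.2 < (g :: C).length := fun h p hp => by
      have := h p hp
      rw [List.length_cons]
      omega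
    have hpow : ∀ {m m' : ℕ}, m ≤ m' → 2 ^ m ≤ 2 ^ m' := fun hm =>
      Nat.pow_le_pow_right (by omega) hm
    rcases j with _ | j
    · change ∃ w : List (ℕ × ℕ), _ ∧ _ ∧ Possible inp w (g :: C) 0 (g.value a (values a C))
      induction g using Gate.rec_junction with
      | input i => exact ⟨[], by simp, by simp, hinp i⟩
      | neg i =>
        obtain ⟨w, h1, h2, h3⟩ := ih (j := i) (by simpa [weightAt_neg, largeWeight] using hw)
        refine ⟨w, hmem h1, h2.trans (hpow (Nat.le_add_left _ _)), ?_⟩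
        rwa [possible_neg, Gate.value, Bool.not_not]
      | junction c l =>
        have hl : ∀ i ∈ l, weightAt largeWeight C i ≤ 1 ∧
            (2 < l.length → weightAt largeWeight C i = 0) := fun i hi => by
          have := (add_weightAt_le (W := largeWeight) (C := C) (c := c) hi).trans hw
          unfold largeWeight at this ⊢
          split_ifs at this <;> omega
        have hd : ∀ i ∈ l, 1 + weightAt (fun _ => 1) C i ≤
            weightAt (fun _ => 1) (.junction c l :: C) 0 := fun i hi =>
          add_weightAt_le (W := fun _ => 1) hi
        rcases eq_or_eq_not' ((Gate.junction c l).value a (values a C)) c with h | h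
        · have hv := (Gate.value_junction ..).1 h
          simp only [h, possible_junction]
          by_cases hlen : 2 < l.length
          · refine ⟨[], by simp, by simp, fun i hi => ?_⟩
            rw [← hv i hi]
            exact possible_of_weft_eq_zero hinp ((hl i hi).2 hlen)
          · obtain ⟨w, h1, h2, h3⟩ := exists_list_forall (s := l)
              (B := 2 ^ (l.map fun j => weightAt (fun _ => 1) C j).foldr max 0)
              (Q := fun i w => Possible inp w C i c)
              (fun i w w' hww' hp => hp.mono (fun _ _ h => h) hww') fun i hi => by
                obtain ⟨w, h1, h2, h3⟩ := ih (j := i) (hl i hi).1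
                exact ⟨w, h1, h2.trans (hpow (le_foldr_max (f := weightAt (fun _ => 1) C) hi)),
                  by rwa [hv i hi] at h3⟩
            refine ⟨w, hmem h1, h2.trans ?_, h3⟩
            -- A small gate merges the witness lists of at most two wires, so the bound doubles per
            -- level.
            rw [weightAt_junction, Nat.pow_add, pow_one]
            exact Nat.mul_le_mul_right _ (by omega)
        · obtain ⟨i, hi, hv⟩ : ∃ i ∈ l, (values a C).getD i false = !c := by
            by_contra! hne
            rw [(Gate.value_junction a _ c l).2 fun i hi => by simpa using hne i hi] at h
            exact Bool.not_ne_self c h.symm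
          simp only [h, possible_junction_not]
          by_cases hlen : 2 < l.length
          -- Nothing large lies below this large gate, so the single wire `i` justifies its value.
          -- The gate is identified by `C.length`, the number of gates after it.
          · have hp : ∀ w, Possible inp w C i (!c) := fun w => by
              rw [← hv]
              exact possible_of_weft_eq_zero hinp ((hl i hi).2 hlen)
            rcases lt_or_ge i C.length with hC | hC
            · exact ⟨[(C.length, i)], by simp; omega, by simpa using Nat.one_le_two_pow,
                i, hi, by simp [Gate.selected], hp _⟩
            · exact ⟨[], by simp, by simp, i, hi, by simp [Gate.selected, hC], hp _⟩
          · obtain ⟨w, h1, h2, h3⟩ := ih (j := i) (hl i hi).1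
            refine ⟨w, hmem h1, h2.trans (hpow (by have := hd i hi; omega)), i, hi,
              by simp [Gate.selected]; omega, by rwa [hv] at h3⟩
    · obtain ⟨w, h1, h2, h3⟩ := ih hw
      exact ⟨w, hmem h1, h2, h3⟩

end Circuit

/-! ### Weighted circuit satisfiability as a constraint satisfaction problem -/

namespace Gate

/-- Truncation is compatible with sums and maxima of natural numbers. It keeps the entries of the
computed list bounded, as the increment criterion for folds requires. -/
theorem pathWeight_map_min (W : ℕ → ℕ) (m : ℕ) (v : List ℕ) (g : Gate) :
    min m (g.pathWeight W (v.map (min m))) = min m (g.pathWeight W v) := by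
  have h : ∀ j, (v.map (min m)).getD j 0 = min m (v.getD j 0) := fun j => by
    rw [List.getD_eq_getElem?_getD, List.getD_eq_getElem?_getD, List.getElem?_map]
    cases v[j]? <;> simp
  induction g using rec_junction with
  | input i => rfl
  | neg i => simp only [pathWeight, h]; omega
  | junction c l =>
    simp only [pathWeight_junction, h]
    have : ∀ l : List ℕ, min m ((l.map fun j => min m (v.getD j 0)).foldr max 0) =
        min m ((l.map fun j => v.getD j 0).foldr max 0) := fun l => by
      induction l with
      | nil => rfl
      | cons i l ih => simp only [List.map_cons, List.foldr_cons]; omega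
    have := this l
    omega

end Gate

theorem Circuit.map_min_pathWeights (W : ℕ → ℕ) (m : ℕ) (l : List Data) :
    (pathWeights W (l.map Data.toGate)).map (min m) =
      l.foldr (fun x v => min m (x.toGate.pathWeight W v) :: v) [] := by
  induction l with
  | nil => rfl
  | cons x l ih =>
    rw [List.foldr_cons, ← ih, Gate.pathWeight_map_min]; rfl

namespace PTime
variable {γ : Type} [Enc γ]

@[fun_prop]
theorem nat_min {f g : γ → ℕ} (hf : PTime f) (hg : PTime g) : PTime fun x => min (f x) (g x) :=
  of_eq (f := fun x => f x - (f x - g x)) (by fun_prop) fun x => by omega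

@[fun_prop]
theorem nat_max {f g : γ → ℕ} (hf : PTime f) (hg : PTime g) : PTime fun x => max (f x) (g x) :=
  of_eq (f := fun x => f x + (g x - f x)) (by fun_prop) fun x => by omega

@[fun_prop]
theorem foldr_max {f : γ → List ℕ} (hf : PTime f) : PTime fun x => (f x).foldr max 0 :=
  foldr (f := fun _ a b => max a b) (A := fun x => esize (f x)) (by fun_prop) hf (const 0) hf.1
    fun x y a ha => by
      have := esize_le_of_mem ha
      simp only [esize_nat] at this ⊢
      omega

theorem toGate_pathWeight {W : ℕ → ℕ} (hW : PTime W) {f : γ → Data} {v : γ → List ℕ}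
    (hf : PTime f) (hv : PTime v) : PTime fun x => (f x).toGate.pathWeight W (v x) := by
  have h : PTime fun x => W (f x).tl.toList.length := hW.comp (by fun_prop)
  refine of_eq (f := fun x => bif decide ((f x).hd.toNat = 0) then 0
    else bif decide ((f x).hd.toNat = 1) then W 1 + (v x).getD (f x).tl.toNat 0
    else W (f x).tl.toList.length +
      ((f x).tl.toList.map fun y => (v x).getD y.toNat 0).foldr max 0) (by fun_prop) fun x => ?_
  unfold Data.toGate
  rcases (f x).hd.toNat with _ | _ | _ | _ <;>
    simp [Gate.pathWeight, List.map_map, Function.comp_def]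

theorem decide_pathWeights_le {W : ℕ → ℕ} (hW : PTime W) (m : ℕ) {l : γ → List Data}
    (hl : PTime l) : PTime fun x =>
      decide ((Circuit.pathWeights W ((l x).map Data.toGate)).headD 0 ≤ m) := by
  have h1 : PTime fun q : γ × Data × List ℕ => q.2.1.toGate.pathWeight W q.2.2 :=
    toGate_pathWeight hW (by fun_prop) (by fun_prop)
  -- Truncation at `m + 1` is the smallest that still distinguishes weights above `m`.
  have h2 : PTime fun x => (l x).foldr (fun y v => min (m + 1) (y.toGate.pathWeight W v) :: v) [] :=
    foldr (f := fun (_ : γ) (y : Data) (v : List ℕ) => min (m + 1) (y.toGate.pathWeight W v) :: v)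
      (A := fun _ => m + 2) (by fun_prop) hl (const _) (.const _) fun x y a ha => by
        simp only [esize_cons, esize_nat]; omega
  refine of_eq (f := fun x => decide (((l x).foldr
    (fun y v => min (m + 1) (y.toGate.pathWeight W v) :: v) []).headD 0 ≤ m)) (by fun_prop)
    fun x => ?_
  rw [← Circuit.map_min_pathWeights, decide_eq_decide]
  cases Circuit.pathWeights W ((l x).map Data.toGate) with
  | nil => simp
  | cons a l => simp only [List.headD_cons, List.map_cons]; omega

end PTime

namespace CircuitSat

/-- The possible values of input `v`, if it is known about the increasing enumeration
`0 = p₀ < ⋯ < pₖ₊₁ = n + 1`, in which `v + 1` occurs if and only if input `v` is true, that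
`pᵢ = p` for all pairs `(i, p)` in the list `pts`. -/
def possibleInput (n : ℕ) (pts : List (ℕ × ℕ)) (v : ℕ) : Bool × Bool :=
  (decide (v < n) && !(pts.any fun a => pts.any fun b => decide (b.1 = a.1 + 1) &&
    (decide (a.2 < v + 1) && decide (v + 1 < b.2))),
  !decide (v < n) || !(pts.any fun a => decide (a.2 = v + 1)))

/-- Whether pairs `(i, p)` may be part of such an enumeration. -/
def consistent (n k : ℕ) (pts : List (ℕ × ℕ)) : Bool :=
  pts.all fun a => (!decide (a.1 = 0) || decide (a.2 = 0)) &&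
    ((!decide (a.1 = k + 1) || decide (a.2 = n + 1)) &&
      pts.all fun b => !decide (a.1 < b.1) || decide (a.2 < b.2))

def circuit (x : Data) : List Gate := x.tl.toList.map Data.toGate

/-- The list of the possible lists of witnesses. -/
def advice (d : ℕ) (x : Data) : List (List (ℕ × ℕ)) :=
  listTuples ((List.range (x.tl.toList.length + 1)).flatMap fun i =>
    (List.range (x.tl.toList.length + 1)).map fun j => (i, j)) (2 ^ d)

/-- The number of points that suffice for a refutation. -/
def arity (d : ℕ) : ℕ := 2 * (2 ^ d + 2) ^ d

def points (d : ℕ) (R π : List ℕ) : List (ℕ × ℕ) :=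
  (List.range (arity d)).map fun j => (R.getD j 0, π.getD j 0)

/-- Whether the points pass all tests, and do not refute that the circuit is satisfied. -/
def accepts (d : ℕ) (x : Data) (k : ℕ) (R π : List ℕ) (w : List (ℕ × ℕ)) : Bool :=
  consistent x.hd.toNat k (points d R π) && ((Circuit.possibleValues
    (possibleInput x.hd.toNat (points d R π)) w (circuit x)).getD 0 (false, true)).1

/-- Variable `0` is an index into `advice`; variable `i + 1` is the point `pᵢ` of the enumeration,
between `0` and `n + 1`. -/
def doms (d : ℕ) (x : Data) (k : ℕ) : List (List ℕ) :=
  List.range (advice d x).length ::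
    (List.range (k + 2)).map fun _ => List.range (x.hd.toNat + 2)

/-- Every constraint looks at the advice and at `arity d` points. The number of constraints depends
only on `k` and `d`; the circuit enters only through the allowed tuples. -/
def cons (d : ℕ) (x : Data) (k : ℕ) : List (List ℕ × List (List ℕ)) :=
  (listTuples (List.range (k + 2)) (arity d)).map fun R => (0 :: R.map fun i => i + 1,
    (List.range (advice d x).length).flatMap fun a =>
      ((listTuples (List.range (x.hd.toNat + 2)) (arity d)).filter fun π =>
        accepts d x k R π ((advice d x).getD a [])).map fun π => a :: π)

/-- Whether the circuit has weft at most `1` and depth at most `d`. -/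
def valid (d : ℕ) (x : Data) : Bool :=
  decide (Circuit.weft (circuit x) ≤ 1) && decide (Circuit.depth (circuit x) ≤ d)

/-- The reduction to Vertex Deletion to Regular Subgraph. -/
def toVertexDeletion (d : ℕ) (p : Inst × ℕ) : Inst :=
  (bif valid d p.1.1 then Csp.inst (doms d p.1.1 p.1.2) (cons d p.1.1 p.1.2) p.2
    else edgelessInst p.2, (p.1.2 + 3) + (p.1.2 + 2) ^ arity d)

section PTime
variable {γ : Type} [Enc γ] {x : γ → Data} {k n v : γ → ℕ} {R π : γ → List ℕ}
  {w pts : γ → List (ℕ × ℕ)}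

@[fun_prop]
theorem ptime_possibleInput (hn : PTime n) (hp : PTime pts) (hv : PTime v) :
    PTime fun a => possibleInput (n a) (pts a) (v a) := by
  unfold possibleInput; fun_prop

@[fun_prop]
theorem ptime_consistent (hn : PTime n) (hk : PTime k) (hp : PTime pts) :
    PTime fun a => consistent (n a) (k a) (pts a) := by
  unfold consistent; fun_prop

@[fun_prop]
theorem ptime_selected {N m j : γ → ℕ} (hw : PTime w) (hN : PTime N) (hm : PTime m)
    (hj : PTime j) : PTime fun a => Gate.selected (w a) (N a) (m a) (j a) := by
  unfold Gate.selected; fun_prop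

theorem ptime_gate_possibleValues {u : γ → List (Bool × Bool)} (hn : PTime n) (hp : PTime pts)
    (hw : PTime w) (hu : PTime u) (hx : PTime x) :
    PTime fun a => (x a).toGate.possibleValues (possibleInput (n a) (pts a)) (w a) (u a) := by
  refine .of_eq (f := fun a => bif decide ((x a).hd.toNat = 0) then
      possibleInput (n a) (pts a) (x a).tl.toNat
    else bif decide ((x a).hd.toNat = 1) then
      (((u a).getD (x a).tl.toNat (false, true)).2, ((u a).getD (x a).tl.toNat (false, true)).1)
    else bif decide ((x a).hd.toNat = 2) then
      ((x a).tl.toList.all fun y => ((u a).getD y.toNat (false, true)).1,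
      (x a).tl.toList.any fun y => Gate.selected (w a) (u a).length (x a).tl.toList.length y.toNat &&
        ((u a).getD y.toNat (false, true)).2)
    else ((x a).tl.toList.any fun y =>
        Gate.selected (w a) (u a).length (x a).tl.toList.length y.toNat &&
          ((u a).getD y.toNat (false, true)).1,
      (x a).tl.toList.all fun y => ((u a).getD y.toNat (false, true)).2)) (by fun_prop) fun a => ?_
  unfold Data.toGate
  rcases (x a).hd.toNat with _ | _ | _ | _
  · rfl
  · rfl
  · simp only [Gate.possibleValues, List.all_map, List.any_map, List.length_map]; rfl
  · simp only [Gate.possibleValues, List.all_map, List.any_map, List.length_map]; rfl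

@[fun_prop]
theorem ptime_possibleValues (hn : PTime n) (hp : PTime pts) (hw : PTime w) (hx : PTime x) :
    PTime fun a => Circuit.possibleValues (possibleInput (n a) (pts a)) (w a) (circuit (x a)) := by
  have h : PTime fun q : γ × Data × List (Bool × Bool) => q.2.1.toGate.possibleValues
      (possibleInput (n q.1) (pts q.1)) (w q.1) q.2.2 :=
    ptime_gate_possibleValues (by fun_prop) (by fun_prop) (by fun_prop) (by fun_prop) (by fun_prop)
  refine .of_eq (.foldr (f := fun a (y : Data) u => y.toGate.possibleValues
    (possibleInput (n a) (pts a)) (w a) u :: u) (A := fun _ => 4) (g := fun a => (x a).tl.toList)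
    (by fun_prop) (by fun_prop) (.const []) (.const _) fun a u y hy => ?_) fun a => ?_
  · rw [esize_cons, esize_pair]
    have := esize_bool_le (y.toGate.possibleValues (possibleInput (n a) (pts a)) (w a) u).1
    have := esize_bool_le (y.toGate.possibleValues (possibleInput (n a) (pts a)) (w a) u).2
    omega
  · unfold circuit
    induction (x a).tl.toList with
    | nil => rfl
    | cons y l ih => rw [List.map_cons, Circuit.possibleValues, ih]; rfl

@[fun_prop]
theorem ptime_advice (d : ℕ) (hx : PTime x) : PTime fun a => advice d (x a) := by
  unfold advice; fun_prop

@[fun_prop]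
theorem ptime_points (d : ℕ) (hR : PTime R) (hπ : PTime π) :
    PTime fun a => points d (R a) (π a) := by
  unfold points; fun_prop

@[fun_prop]
theorem ptime_accepts (d : ℕ) (hx : PTime x) (hk : PTime k) (hR : PTime R) (hπ : PTime π)
    (hw : PTime w) : PTime fun a => accepts d (x a) (k a) (R a) (π a) (w a) := by
  unfold accepts; fun_prop

@[fun_prop]
theorem ptime_doms (d : ℕ) (hx : PTime x) (hk : PTime k) : PTime fun a => doms d (x a) (k a) := by
  unfold doms; fun_prop

@[fun_prop]
theorem ptime_cons (d : ℕ) (hx : PTime x) (hk : PTime k) : PTime fun a => cons d (x a) (k a) := by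
  unfold cons; fun_prop

@[fun_prop]
theorem ptime_valid (d : ℕ) (hx : PTime x) : PTime fun a => valid d (x a) := by
  have h1 : PTime fun a => decide (Circuit.weft (circuit (x a)) ≤ 1) :=
    .decide_pathWeights_le (.of_eq (f := fun m => bif decide (2 < m) then 1 else 0) (by fun_prop)
      fun m => by rw [Bool.cond_decide]) 1 (l := fun a => (x a).tl.toList) (by fun_prop)
  have h2 : PTime fun a => decide (Circuit.depth (circuit (x a)) ≤ d) :=
    .decide_pathWeights_le (.const 1) d (l := fun a => (x a).tl.toList) (by fun_prop)
  unfold valid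
  fun_prop

theorem ptime_toVertexDeletion (d : ℕ) : PTime (toVertexDeletion d) := by
  unfold toVertexDeletion; fun_prop

end PTime

end CircuitSat

/-! ### Correctness of the constraint satisfaction problem for circuits -/

namespace CircuitSat

variable {n k d : ℕ} {x : Data} {p : ℕ → ℕ} {w : List (ℕ × ℕ)} {R R' : List ℕ}

/-- The points with the indices in the list `R`. -/
def graphOn (p : ℕ → ℕ) (R : List ℕ) : List (ℕ × ℕ) := R.map fun i => (i, p i)

theorem points_map (hR : R.length = arity d) : points d R (R.map p) = graphOn p R := by
  refine List.ext_getElem (by simp [points, graphOn, hR]) fun j h1 h2 => ?_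
  have hj : j < R.length := by simpa [graphOn] using h2
  simp [points, graphOn, List.getD_eq_getElem?_getD, hj]

theorem length_doms (d : ℕ) (x : Data) (k : ℕ) : (doms d x k).length = k + 3 := by simp [doms]

theorem length_cons (d : ℕ) (x : Data) (k : ℕ) : (cons d x k).length = (k + 2) ^ arity d := by
  rw [cons, List.length_map, length_listTuples, List.length_range]

theorem sat_iff (d : ℕ) (x : Data) (k : ℕ) : Csp.Sat (doms d x k) (cons d x k) ↔
    ∃ w ∈ advice d x, ∃ p : ℕ → ℕ, (∀ i < k + 2, p i < x.hd.toNat + 2) ∧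
      ∀ R : List ℕ, R.length = arity d → (∀ i ∈ R, i < k + 2) →
        accepts d x k R (R.map p) w = true := by
  have hdom0 : ∀ a, a ∈ (doms d x k).getD 0 [] ↔ a < (advice d x).length := fun a => by
    simp [doms]
  have hdom : ∀ i < k + 2, ∀ a, a ∈ (doms d x k).getD (i + 1) [] ↔ a < x.hd.toNat + 2 :=
    fun i hi a => by simp [doms, List.getD_eq_getElem?_getD, hi]
  unfold Csp.Sat
  rw [length_doms]
  constructor
  · rintro ⟨σ, hσ, hc⟩
    rw [cons, List.forall_mem_map] at hc
    simp only [mem_listTuples, List.mem_range, and_imp, List.mem_flatMap,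
      List.mem_map, List.mem_filter, List.length_cons, List.length_map] at hc
    have h0 := (hdom0 _).1 (hσ 0 (by omega))
    refine ⟨(advice d x)[σ 0], List.getElem_mem _, fun i => σ (i + 1),
      fun i hi => (hdom i hi _).1 (hσ (i + 1) (by omega)), fun R hR hRk => ?_⟩
    obtain ⟨_, ⟨a, ha, π, ⟨⟨hπ, -⟩, hacc⟩, rfl⟩, hτ⟩ := hc R hR hRk
    obtain rfl : a = σ 0 := hτ 0 (by omega)
    obtain rfl : π = R.map fun i => σ (i + 1) := by
      refine List.ext_getElem (by simp [hπ, hR]) fun j h1 h2 => ?_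
      have hj : j < R.length := by simpa using h2
      have := hτ (j + 1) (by omega)
      simpa [List.getD_eq_getElem?_getD, h1, hj] using this
    rwa [List.getD_eq_getElem _ _ h0] at hacc
  · rintro ⟨w, hw, p, hp, hacc⟩
    obtain ⟨a, ha, rfl⟩ := List.mem_iff_getElem.1 hw
    refine ⟨fun i => if i = 0 then a else p (i - 1), fun i hi => ?_, ?_⟩
    · rcases i with _ | i
      · exact (hdom0 _).2 ha
      · exact (hdom i (by omega) _).2 (hp i (by omega))
    rw [cons, List.forall_mem_map]
    simp only [mem_listTuples, List.mem_range, and_imp, List.mem_flatMap,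
      List.mem_map, List.mem_filter, List.length_cons, List.length_map]
    refine fun R hR hRk =>
      ⟨_, ⟨a, ha, R.map p, ⟨⟨by simpa using hR, ?_⟩, ?_⟩, rfl⟩, fun j hj => ?_⟩
    · simpa using fun i hi => hp i (hRk i hi)
    · rw [List.getD_eq_getElem _ _ ha]
      exact hacc R hR hRk
    · rcases j with _ | j
      · rfl
      · have hj : j < R.length := by omega
        simp [List.getD_eq_getElem?_getD, hj]

/-- The values `p 0 < ⋯ < p (k + 1)` are `0`, the successors of the elements of `S`, and `n + 1`. -/
structure Enumerates (n k : ℕ) (S : Finset ℕ) (p : ℕ → ℕ) : Prop where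
  lt : ∀ i j, i < j → j < k + 2 → p i < p j
  zero : p 0 = 0
  last : p (k + 1) = n + 1
  mem_iff : ∀ v < n, v ∈ S ↔ ∃ i < k + 2, p i = v + 1
  subset : S ⊆ Finset.range n

theorem exists_enumerates {S : Finset ℕ} (hS : S ⊆ Finset.range n) (hk : S.card = k) :
    ∃ p, Enumerates n k S p := by
  classical
  have hSn : ∀ v ∈ S, v < n := fun v hv => Finset.mem_range.1 (hS hv)
  -- Elements are shifted by one to make room for the sentinels `0` and `n + 1`, so that every false
  -- input lies in a gap between two consecutive points.
  let T := insert 0 (insert (n + 1) (S.image (· + 1)))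
  have hT : ∀ {t}, t ∈ T ↔ t = 0 ∨ t = n + 1 ∨ ∃ v ∈ S, v + 1 = t := by simp [T]
  have hcard : T.card = k + 2 := by
    rw [Finset.card_insert_of_notMem, Finset.card_insert_of_notMem,
      Finset.card_image_of_injective _ (add_left_injective 1), hk]
    · rw [Finset.mem_image]
      rintro ⟨v, hv, h⟩
      have := hSn v hv
      omega
    · simp
  let e := T.orderEmbOfFin hcard
  have he : ∀ {t}, t ∈ T ↔ ∃ i, e i = t := fun {t} => by
    rw [← Finset.mem_coe, ← Finset.range_orderEmbOfFin T hcard]; rfl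
  have hle : ∀ i, e i ≤ n + 1 := fun i => by
    rcases hT.1 (he.2 ⟨i, rfl⟩) with h | h | ⟨v, hv, h⟩
    · omega
    · omega
    · have := hSn v hv
      omega
  have hp : ∀ {i} (hi : i < k + 2), (if h : i < k + 2 then e ⟨i, h⟩ else 0) = e ⟨i, hi⟩ :=
    fun hi => dif_pos hi
  refine ⟨fun i => if h : i < k + 2 then e ⟨i, h⟩ else 0, fun i j hij hj => ?_, ?_, ?_,
    fun v hv => ⟨fun hvS => ?_, ?_⟩, hS⟩
  · rw [hp hj, hp (hij.trans hj)]
    exact e.strictMono hij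
  · obtain ⟨i, hi⟩ := he.1 (hT.2 (.inl rfl))
    have := e.monotone (Fin.zero_le i)
    rw [hp (Nat.succ_pos _)]
    exact Nat.le_zero.1 (this.trans_eq hi)
  · obtain ⟨i, hi⟩ := he.1 (hT.2 (.inr (.inl rfl)))
    have := e.monotone (Fin.le_last i)
    rw [hp (Nat.lt_succ_self _)]
    exact (hle _).antisymm (hi.symm.trans_le this)
  · obtain ⟨i, hi⟩ := he.1 (hT.2 (.inr (.inr ⟨v, hvS, rfl⟩)))
    exact ⟨i, i.2, (hp i.2).trans hi⟩
  · rintro ⟨i, hi, h⟩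
    rw [hp hi] at h
    rcases hT.1 (he.2 ⟨_, h⟩) with h | h | ⟨u, hu, h⟩
    · omega
    · omega
    · rwa [← Nat.succ_injective h]

theorem enumerates_of_lt (hlt : ∀ i j, i < j → j < k + 2 → p i < p j) (h0 : p 0 = 0)
    (hn : p (k + 1) = n + 1) : ∃ S, S ⊆ Finset.range n ∧ S.card = k ∧ Enumerates n k S p := by
  classical
  have hinj : ∀ {i j}, i < k + 2 → j < k + 2 → p i = p j → i = j := fun {i j} hi hj h => by
    rcases lt_trichotomy i j with hij | hij | hij
    · have := hlt i j hij hj; omega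
    · exact hij
    · have := hlt j i hij hi; omega
  have hpos : ∀ i < k, 0 < p (i + 1) ∧ p (i + 1) < n + 1 := fun i hi => by
    have h1 := hlt 0 (i + 1) (by omega) (by omega)
    have h2 := hlt (i + 1) (k + 1) (by omega) (by omega)
    omega
  have hsub : (Finset.range k).image (fun i => p (i + 1) - 1) ⊆ Finset.range n := fun v hv => by
    obtain ⟨i, hi, rfl⟩ := Finset.mem_image.1 hv
    have := hpos i (Finset.mem_range.1 hi)
    exact Finset.mem_range.2 (by omega)
  refine ⟨_, hsub, ?_, hlt, h0, hn, fun v hv => ?_, hsub⟩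
  · rw [Finset.card_image_of_injOn, Finset.card_range]
    intro i hi j hj h
    rw [Finset.mem_coe, Finset.mem_range] at hi hj
    have h1 := hpos i hi
    have h2 := hpos j hj
    dsimp only at h
    exact Nat.succ_injective (hinj (by omega) (by omega) (by omega : p (i + 1) = p (j + 1)))
  · simp only [Finset.mem_image, Finset.mem_range]
    constructor
    · rintro ⟨i, hi, h⟩
      have := hpos i hi
      exact ⟨i + 1, by omega, by omega⟩
    · rintro ⟨i, hi, h⟩
      have hi0 : i ≠ 0 := by rintro rfl; omega
      have hik : i ≠ k + 1 := by rintro rfl; omega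
      exact ⟨i - 1, by omega, by rw [Nat.sub_add_cancel (by omega)]; omega⟩

theorem possibleInput_true {v : ℕ} : possible (possibleInput n (graphOn p R) v) true = true ↔
    v < n ∧ ∀ i ∈ R, i + 1 ∈ R → p i < v + 1 → ¬ v + 1 < p (i + 1) := by
  simp only [possible, cond_true, possibleInput, graphOn, Bool.and_eq_true, decide_eq_true_eq,
    Bool.not_eq_true', List.any_map, ← Bool.not_eq_true, List.any_eq_true, Function.comp_apply]
  refine and_congr_right fun _ => ⟨fun h i hi hi' h1 h2 => h ⟨i, hi, i + 1, hi', rfl, h1, h2⟩, ?_⟩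
  rintro h ⟨i, hi, _, hi', rfl, h1, h2⟩
  exact h i hi hi' h1 h2

theorem possibleInput_false {v : ℕ} : possible (possibleInput n (graphOn p R) v) false = true ↔
    (v < n → ∀ i ∈ R, p i ≠ v + 1) := by
  simp only [possible, cond_false, possibleInput, graphOn, Bool.or_eq_true,
    Bool.not_eq_true', List.any_map, ← Bool.not_eq_true, List.any_eq_true, Function.comp_apply,
    decide_eq_true_eq, ← imp_iff_not_or, not_exists, not_and, ne_eq]

theorem possibleInput_mono (h : R ⊆ R') {v : ℕ} {b : Bool}
    (hp : possible (possibleInput n (graphOn p R') v) b = true) :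
    possible (possibleInput n (graphOn p R) v) b = true := by
  cases b
  · exact possibleInput_false.2 fun hv i hi => possibleInput_false.1 hp hv i (h hi)
  · exact possibleInput_true.2 ⟨(possibleInput_true.1 hp).1, fun i hi hi' =>
      (possibleInput_true.1 hp).2 i (h hi) (h hi')⟩

/-- A point at `v + 1` excludes falsity, two consecutive points around `v + 1` exclude truth, and an
input outside the range needs no point. This is the factor `2` in `arity`. -/
theorem exists_refuting_points {v : ℕ} {b : Bool}
    (h : ¬ possible (possibleInput n (graphOn p R') v) b = true) :
    ∃ R, (∀ i ∈ R, i ∈ R') ∧ R.length ≤ 2 ∧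
      ¬ possible (possibleInput n (graphOn p R) v) b = true := by
  cases b
  · rw [possibleInput_false] at h
    push Not at h
    obtain ⟨hv, i, hi, h⟩ := h
    exact ⟨[i], by simpa using hi, by simp, by simp [possibleInput_false, hv, h]⟩
  · rw [possibleInput_true] at h
    by_cases hv : v < n
    · simp only [hv, true_and] at h
      push Not at h
      obtain ⟨i, hi, hi', h1, h2⟩ := h
      exact ⟨[i, i + 1], by simp [hi, hi'], by simp, fun h =>
        (possibleInput_true.1 h).2 i (by simp) (by simp) h1 h2⟩
    · exact ⟨[], by simp, by simp, fun h => hv (possibleInput_true.1 h).1⟩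

/-- A number strictly between `0` and `n + 1` is a point or lies strictly between consecutive
points, so all points together determine every input. -/
theorem Enumerates.possible_iff {S : Finset ℕ} (h : Enumerates n k S p) (v : ℕ) (b : Bool) :
    possible (possibleInput n (graphOn p (List.range (k + 2))) v) b = true ↔
      decide (v ∈ S) = b := by
  cases b
  · simp only [possibleInput_false, List.mem_range, decide_eq_false_iff_not]
    constructor
    · intro hv hvS
      have hvn := Finset.mem_range.1 (h.subset hvS)
      obtain ⟨i, hi, hiv⟩ := (h.mem_iff v hvn).1 hvS
      exact hv hvn i hi hiv
    · exact fun hv hvn i hi hiv => hv ((h.mem_iff v hvn).2 ⟨i, hi, hiv⟩)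
  · simp only [possibleInput_true, List.mem_range, decide_eq_true_eq]
    constructor
    · rintro ⟨hvn, hv⟩
      rw [h.mem_iff v hvn]
      by_contra! hne
      have hlt : ∀ i < k + 2, p i < v + 1 := fun i hi => by
        induction i with
        | zero => rw [h.zero]; omega
        | succ i ih =>
          exact lt_of_le_of_ne (not_lt.1 (hv i (by omega) hi (ih (by omega)))) (hne _ hi)
      have := hlt (k + 1) (by omega)
      rw [h.last] at this
      omega
    · intro hvS
      have hvn := Finset.mem_range.1 (h.subset hvS)
      refine ⟨hvn, fun i hi hi' h1 h2 => ?_⟩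
      obtain ⟨j, hj, hjv⟩ := (h.mem_iff v hvn).1 hvS
      rw [← hjv] at h1 h2
      rcases lt_trichotomy j i with hji | rfl | hji
      · have := h.lt j i hji hi; omega
      · omega
      · rcases (Nat.succ_le_of_lt hji).lt_or_eq with h3 | h3
        · have := h.lt (i + 1) j h3 hj; omega
        · rw [← h3] at h2; exact lt_irrefl _ h2

theorem consistent_iff : consistent n k (graphOn p R) = true ↔ ∀ i ∈ R, (i = 0 → p i = 0) ∧
    (i = k + 1 → p i = n + 1) ∧ ∀ j ∈ R, i < j → p i < p j := by
  simp only [consistent, graphOn, List.all_map, List.all_eq_true, Function.comp_apply,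
    Bool.and_eq_true, Bool.or_eq_true, Bool.not_eq_true', decide_eq_false_iff_not, decide_eq_true_eq, imp_iff_not_or]

theorem accepts_iff (hR : R.length = arity d) : accepts d x k R (R.map p) w = true ↔
    consistent x.hd.toNat k (graphOn p R) = true ∧
      Circuit.Possible (possibleInput x.hd.toNat (graphOn p R)) w (circuit x) 0 true := by
  rw [accepts, points_map hR, Bool.and_eq_true]
  rfl

/-- Constraints and advice use tuples of an exact length, whereas refutations and witnesses come
with upper bounds. -/
theorem exists_pad {α : Type*} (l : List α) (a : α) {m : ℕ} (h : l.length ≤ m) :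
    ∃ l', l'.length = m ∧ l ⊆ l' ∧ ∀ b ∈ l', b ∈ l ∨ b = a :=
  ⟨l ++ List.replicate (m - l.length) a, by simp; omega, List.subset_append_left _ _,
    fun b hb => (List.mem_append.1 hb).imp_right List.eq_of_mem_replicate⟩

theorem two_le_arity (d : ℕ) : 2 ≤ arity d :=
  Nat.le_mul_of_pos_right 2 (Nat.pow_pos (Nat.succ_pos _))

theorem getD_zero {α : Type*} (l : List α) (a : α) : l.getD 0 a = l.headD a := by cases l <;> rfl

theorem mem_advice : w ∈ advice d x ↔ w.length = 2 ^ d ∧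
    ∀ q ∈ w, q.1 < (circuit x).length + 1 ∧ q.2 < (circuit x).length + 1 := by
  rw [advice, mem_listTuples, circuit, List.length_map]
  refine and_congr_right fun _ => forall₂_congr fun q _ => ?_
  simp only [List.mem_flatMap, List.mem_range, List.mem_map]
  exact ⟨fun ⟨i, hi, j, hj, h⟩ => h ▸ ⟨hi, hj⟩, fun ⟨hi, hj⟩ => ⟨q.1, hi, q.2, hj, rfl⟩⟩

/-- Weft at most one is needed only to find advice for a satisfying assignment; bounded depth makes
the advice short and the local tests conclusive. -/
theorem sat_iff_mem (hvalid : valid d x = true) :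
    Csp.Sat (doms d x k) (cons d x k) ↔ (x, k) ∈ WeightedCircuitSat 1 d := by
  obtain ⟨hweft, hdepth⟩ : Circuit.weft (circuit x) ≤ 1 ∧ Circuit.depth (circuit x) ≤ d := by
    simpa [valid] using hvalid
  have hmem : (x, k) ∈ WeightedCircuitSat 1 d ↔ ∃ S : Finset ℕ, S ⊆ Finset.range x.hd.toNat ∧
      S.card = k ∧ Circuit.eval (circuit x) (fun i => decide (i ∈ S)) = true :=
    ⟨fun h => h.2.2, fun h => ⟨hweft, hdepth, h⟩⟩
  rw [Circuit.weft, ← getD_zero] at hweft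
  rw [Circuit.depth, ← getD_zero] at hdepth
  simp only [sat_iff, hmem, Circuit.eval, ← getD_zero]
  constructor
  · rintro ⟨w, hw, p, hp, hacc⟩
    rw [mem_advice] at hw
    have hacc' : ∀ R : List ℕ, R.length ≤ arity d → (∀ i ∈ R, i < k + 2) → ∃ R', R ⊆ R' ∧
        consistent x.hd.toNat k (graphOn p R') = true ∧
        Circuit.Possible (possibleInput x.hd.toNat (graphOn p R')) w (circuit x) 0 true := by
      intro R hR hRk
      obtain ⟨R', h1, h2, h3⟩ := exists_pad R 0 hR
      exact ⟨R', h2, (accepts_iff h1).1 (hacc R' h1 fun i hi => (h3 i hi).elim (hRk i)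
        (by rintro rfl; exact Nat.succ_pos _))⟩
    -- Two points suffice to test the sentinels and the order, and `arity d` is at least two.
    have hcons : ∀ i < k + 2, ∀ j < k + 2, (i = 0 → p i = 0) ∧ (i = k + 1 → p i = x.hd.toNat + 1) ∧
        (i < j → p i < p j) := fun i hi j hj => by
      obtain ⟨R', h1, h2, -⟩ := hacc' [i, j] (two_le_arity d) (by simp [hi, hj])
      obtain ⟨h3, h4, h5⟩ := consistent_iff.1 h2 i (h1 (by simp))
      exact ⟨h3, h4, h5 j (h1 (by simp))⟩
    obtain ⟨S, hS, hcard, hen⟩ := enumerates_of_lt (p := p) (k := k) (n := x.hd.toNat)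
      (fun i j hij hj => (hcons i (hij.trans hj) j hj).2.2 hij)
      ((hcons 0 (Nat.succ_pos _) 0 (Nat.succ_pos _)).1 rfl)
      ((hcons (k + 1) (Nat.lt_succ_self _) 0 (Nat.succ_pos _)).2.1 rfl)
    refine ⟨S, hS, hcard, ?_⟩
    refine Circuit.value_eq_of_possible (w := w) (fun i b => (hen.possible_iff i b).1) ?_
    -- If truth of the output were impossible given all points, some `arity d` of them would already
    -- show it, and the constraint on a tuple containing these would be violated.
    by_contra hposs
    obtain ⟨R, h1, h2, h3⟩ := Circuit.exists_refutation
      (inp := fun R => possibleInput x.hd.toNat (graphOn p R))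
      (fun R R' h i b => possibleInput_mono h) (fun i b => exists_refuting_points) hposs
    rw [hw.1] at h2
    obtain ⟨R', h4, -, h5⟩ := hacc' R
      (h2.trans (Nat.mul_le_mul_left _ (Nat.pow_le_pow_right (Nat.succ_pos _) hdepth)))
      fun i hi => List.mem_range.1 (h1 i hi)
    exact h3 (h5.mono (fun i b => possibleInput_mono h4) (List.Subset.refl _))
  · rintro ⟨S, hS, hcard, heval⟩
    obtain ⟨p, hen⟩ := exists_enumerates hS hcard
    obtain ⟨w, h1, h2, h3⟩ := Circuit.exists_witnesses (j := 0)
      (fun i => (hen.possible_iff i (decide (i ∈ S))).2 rfl) hweft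
    rw [heval] at h3
    -- Superfluous witnesses only add possibilities. The pair `(0, 0)` is always available, as the
    -- entries of `advice` range up to the length of the circuit inclusive.
    obtain ⟨w', h4, h5, h6⟩ := exists_pad w (0, 0)
      (h2.trans (Nat.pow_le_pow_right (Nat.succ_pos _) hdepth))
    refine ⟨w', mem_advice.2 ⟨h4, fun q hq => ?_⟩, p, fun i hi => ?_, fun R hR hRk =>
      (accepts_iff hR).2 ⟨consistent_iff.2 fun i hi => ⟨?_, ?_, fun j hj hij =>
        hen.lt i j hij (hRk j hj)⟩, h3.mono (fun i b => possibleInput_mono fun i hi =>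
          List.mem_range.2 (hRk i hi)) h5⟩⟩
    · rcases h6 q hq with h | rfl
      · exact ⟨(h1 q h).1.trans (Nat.lt_succ_self _), (h1 q h).2.trans (Nat.lt_succ_self _)⟩
      · exact ⟨Nat.succ_pos _, Nat.succ_pos _⟩
    · rcases (Nat.le_of_lt_succ hi).lt_or_eq with h | rfl
      · have := hen.lt i (k + 1) h (Nat.lt_succ_self _)
        rw [hen.last] at this
        omega
      · rw [hen.last]; omega
    · rintro rfl; exact hen.zero
    · rintro rfl; exact hen.last

theorem gapCorrect {g : ℕ → ℕ} (I : Inst) {M : ℕ} (hM : (I.2 + 3) + (I.2 + 2) ^ arity d ≤ M)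
    (hg : g ((I.2 + 3) + (I.2 + 2) ^ arity d) ≤ M) :
    GapCorrect (WeightedCircuitSat 1 d) VertexDeletionToRegular g I (toVertexDeletion d (I, M)) := by
  obtain ⟨x, k⟩ := I
  rw [toVertexDeletion]
  by_cases h : valid d x = true
  · rw [h, cond_true]
    refine Csp.inst_gapCorrect ?_ (by rw [length_doms, length_cons]) hM hg (sat_iff_mem h).symm
    rw [cons, List.forall_mem_map, length_doms]
    intro R hR j hj
    rcases j with _ | j
    · exact Nat.succ_pos _
    · have hj' : j < R.length := by simpa using hj
      have := (mem_listTuples.1 hR).2 _ (List.getElem_mem hj')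
      simp [List.getD_eq_getElem?_getD, hj'] at this ⊢
      omega
  · rw [Bool.eq_false_iff.2 h, cond_false]
    refine edgelessInst_gapCorrect hM hg fun hI => h ?_
    rw [valid, Bool.and_eq_true, decide_eq_true_eq, decide_eq_true_eq]
    exact ⟨hI.1, hI.2.1⟩

end CircuitSat

/-! ### Hardness for `W[1]` and the final statement -/

theorem approxHard_wClass_one {g : ℕ → ℕ} (hg : Computable g) :
    ApproxHard (WClass 1) VertexDeletionToRegular g := by
  rintro A ⟨d, hA⟩
  have hκ : Computable fun k : ℕ => (k + 3) + (k + 2) ^ CircuitSat.arity d :=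
    Primrec.nat_add.to_comp.comp (Primrec.nat_add.to_comp.comp .id (.const 3))
      ((computable_pow_const _).comp (Primrec.nat_add.to_comp.comp .id (.const 2)))
  refine (hA.comp_ptime (G := fun k => g ((k + 3) + (k + 2) ^ CircuitSat.arity d) +
    ((k + 3) + (k + 2) ^ CircuitSat.arity d)) (Primrec.nat_add.to_comp.comp (hg.comp hκ) hκ) hκ
    (CircuitSat.ptime_toVertexDeletion d) fun I a => le_rfl).mono ?_
  rintro I _ ⟨I', hI, rfl⟩
  have := CircuitSat.gapCorrect (g := g) (d := d) I' (Nat.le_add_left _ _) (Nat.le_add_right _ _)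
  rw [GapCorrect, ← hI] at this
  exact this

theorem mainTheorem2 (g : ℕ → ℕ) (hg : Computable g) :
    ApproxHard (WClass 1) VertexDeletionToRegular g ∧
    FPTTransforms (fun I J =>
      GapCorrect StronglyRegularMulticoloredClique VertexDeletionToRegular g I J ∧
      J.2 = I.2 + I.2.choose 2) :=
  ⟨approxHard_wClass_one hg, stronglyRegularMulticoloredClique_reduces hg⟩
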